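/- **Setting.** For $n\ge 0$ qubits and $L\ge 0$ layers let $\mathcal U(\theta)=\mathcal U_L\cdots\mathcal U_1$, where layer $\mathcal U_i$ is a product of Pauli rotations $\exp(-i\frac{\theta_{i,j}}2\sigma_{i,j})$, $j=1,\dots,R_i$, with $\sigma_{i,j}\in\{\mathbb I,X,Y,Z\}^{\otimes n}$, and of Clifford gates $V_{i,k}\in\{\mathrm H(a),\mathrm S(a),\mathrm{CNOT}(a,b)\}_{a\ne b}$, $k=1,\dots,C_i$, all acting on mutually disjoint qubits. Put $\mathcal V_i=\prod_kV_{i,k}$ and $\overline\sigma_{i,j}=\mathcal V_1^\dagger\cdots\mathcal V_{i-1}^\dagger\sigma_{i,j}\mathcal V_{i-1}\cdots\mathcal V_1$. The *generation hypothesis* says that every Pauli word is, up to a phase in $\{1,i,-1,-i\}$, a finite product of elements of $\{\overline\sigma_{i,j}\}$. Let $H$ be a real linear combination of distinct $n$-qubit Pauli words, let $\rho$ be an $n$-qubit density matrix, and let $\|H\|_\infty$ be the operator norm of $H$. With the single-qubit depolarizing channel $\mathcal N(\phi)=(1-\lambda)\phi+\lambda\frac{\mathrm{Tr}\,\phi}2\mathbb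 I$, the noisy cost function is $$\widehat{\mathcal L}(\theta)=\mathrm{Tr}\{H\,\mathcal N^{\otimes n}(\mathcal U_L\mathcal N^{\otimes n}(\cdots\mathcal U_1\mathcal N^{\otimes n}(\rho)\,\mathcal U_1^\dagger\cdots)\,\mathcal U_L^\dagger)\}.$$ A Pauli path is a sequence $s=(s_0,\dots,s_L)$ of elements of $\{\frac{\mathbb I}{\sqrt2},\frac X{\sqrt2},\frac Y{\sqrt2},\frac Z{\sqrt2}\}^{\otimes n}$; its weight $|s|$ is the total number of non-identity tensor factors in $s_0,\dots,s_L$, and its contribution is $$\hat f(\theta,s)=\mathrm{Tr}\{H\mathcal N^{\otimes n}(s_L)\}\Big(\prod_{i=1}^L\mathrm{Tr}\{s_i\,\mathcal U_i\,\mathcal N^{\otimes n}(s_{i-1})\,\mathcal U_i^\dagger\}\Big)\mathrm{Tr}\{s_0\rho\}.$$ The estimate truncated at weight $M\in\mathbb N$ is $\widetilde{\mathcal L}_M(\theta)=\sum_{|s|\le M}\hat f(\theta,s)$. Expectations $\mathbb E_\theta$ are over independent parameters $\theta_{i,j}$, each uniform on $[-\pi,\pi]$. Time is the number of steps of a real random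 access machine, which stores natural numbers and real numbers in indexed memory, adds, subtracts (truncated) and compares natural numbers, adds, subtracts, multiplies and compares real numbers exactly, and reads the angles $\theta_{i,j}$ through their cosines and sines, each operation costing one step. Its input consists of $n$, $L$, $\lambda$, an error bound $\nu$, the gates of the circuit, the list of Pauli words of $H$ with their coefficients, a list of matrix entries of $\rho$ that contains all non-zero ones, and $\theta$. **Statement.** There is one program such that, for every fixed error rate $\lambda\in(0,1]$ and every polynomial $q$, there is a polynomial $p$ in four variables with the following property. Let $n,L$, a circuit, $H$ and $\rho$ be as above, let the generation hypothesis hold, and let $H$ have at most $q(n)$ listed Pauli words, $\rho$ at most $q(n)$ listed entries, and each layer at most $q(n)$ rotations (the last condition is automatic for $q(n)\ge n$ if no $\sigma_{i,j}$ is the identity word). Then for every $\nu>0$ there is an $M\in\mathbb N$, not depending on $\theta$, such that $$\mathbb E_\theta\,|\widetilde{\mathcal L}_M(\theta)-\widehat{\mathcal L}(\theta)|^2\le\nu ,$$ and for every $\theta$ the program halts with output $\widetilde{\mathcal L}_M(\theta)$ after at most $p\big(n,L,\tfrac1{\sqrt\nu},\|H\|_\infty\big)$ steps. -/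

import Mathlib

open scoped Matrix ComplexOrder

noncomputable section

namespace NoisyVQA

/-! ### Pauli words and tensor products -/

/-- The four single-qubit Pauli labels. -/
inductive Pauli where
  | I | X | Y | Z
  deriving DecidableEq

instance : Fintype Pauli where
  elems := {.I, .X, .Y, .Z}
  complete := by intro p; cases p <;> simp

/-- The matrix of a Pauli label. -/
def Pauli.mat : Pauli → Matrix (Fin 2) (Fin 2) ℂ
  | .I => 1
  | .X => !![0, 1; 1, 0]
  | .Y => !![0, -Complex.I; Complex.I, 0]
  | .Z => !![1, 0; 0, -1]

/-- Numerical code of a Pauli label, used to write Pauli words into memory. -/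
def Pauli.code : Pauli → ℕ
  | .I => 0
  | .X => 1
  | .Y => 2
  | .Z => 3

/-- Labels of the computational basis of `n` qubits. -/
abbrev Basis (n : ℕ) := Fin n → Fin 2

/-- Operators on `n` qubits, in the computational basis. -/
abbrev Op (n : ℕ) := Matrix (Basis n) (Basis n) ℂ

/-- Words in the Pauli labels, one letter for each qubit. -/
abbrev Word (n : ℕ) := Fin n → Pauli

/-- The tensor product of one single-qubit matrix for each qubit. -/
def tensor {n : ℕ} (m : Fin n → Matrix (Fin 2) (Fin 2) ℂ) : Op n :=
  Matrix.of fun x y => ∏ q, m q (x q) (y q)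

/-- The Pauli word as an operator. -/
def Word.op {n : ℕ} (w : Word n) : Op n := tensor fun q => (w q).mat

/-- The normalized Pauli word, with every letter divided by `√2`. -/
def Word.normOp {n : ℕ} (w : Word n) : Op n :=
  tensor fun q => ((1 / Real.sqrt 2 : ℝ) : ℂ) • (w q).mat

/-- The qubits on which the word is not the identity. -/
def Word.supp {n : ℕ} (w : Word n) : Finset (Fin n) :=
  Finset.univ.filter fun q => w q ≠ Pauli.I

/-- The Hamming weight of a word. -/
def Word.weight {n : ℕ} (w : Word n) : ℕ := w.supp.card

/-! ### Circuits -/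

/-- The elementary Clifford gates on `n` qubits. -/
inductive Clifford (n : ℕ) where
  | H (a : Fin n)
  | S (a : Fin n)
  | CNOT (a b : Fin n) (hab : a ≠ b)

/-- The unitary matrix of a Clifford gate. -/
def Clifford.op {n : ℕ} : Clifford n → Op n
  | .H a => tensor (Function.update (fun _ => 1) a
      (((1 / Real.sqrt 2 : ℝ) : ℂ) • !![1, 1; 1, -1]))
  | .S a => tensor (Function.update (fun _ => 1) a !![1, 0; 0, Complex.I])
  | .CNOT a b _ => Matrix.of fun x y =>
      if x = Function.update y b (y a + y b) then 1 else 0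

/-- The qubits on which a Clifford gate acts. -/
def Clifford.supp {n : ℕ} : Clifford n → Finset (Fin n)
  | .H a => {a}
  | .S a => {a}
  | .CNOT a b _ => {a, b}

/-- Kind of gate and its qubits as numbers (`0` for a missing second qubit). -/
def Clifford.code {n : ℕ} : Clifford n → ℕ × ℕ × ℕ
  | .H a => (0, a, 0)
  | .S a => (1, a, 0)
  | .CNOT a b _ => (2, a, b)

/-- One layer: `R` Pauli rotations and `C` Clifford gates on mutually disjoint qubits. -/
structure Layer (n : ℕ) where
  R : ℕ
  rot : Fin R → Word n
  C : ℕ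
  cliff : Fin C → Clifford n
  rot_disjoint : ∀ j j', j ≠ j' → Disjoint (rot j).supp (rot j').supp
  cliff_disjoint : ∀ k k', k ≠ k' → Disjoint (cliff k).supp (cliff k').supp
  rot_cliff_disjoint : ∀ j k, Disjoint (rot j).supp (cliff k).supp

/-- The rotation `exp (-i (t/2) σ)`. -/
def rotation {n : ℕ} (t : ℝ) (w : Word n) : Op n :=
  NormedSpace.exp ((-Complex.I * ((t / 2 : ℝ) : ℂ)) • w.op)

/-- The product of all Clifford gates of a layer. -/
def Layer.cliffOp {n : ℕ} (l : Layer n) : Op n :=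
  (List.ofFn fun k => (l.cliff k).op).prod

/-- The unitary of a layer (its gates commute, so their order is immaterial). -/
def Layer.op {n : ℕ} (l : Layer n) (t : Fin l.R → ℝ) : Op n :=
  (List.ofFn fun j => rotation (t j) (l.rot j)).prod * l.cliffOp

/-- A circuit with `L` layers; layer `0` is applied first. -/
abbrev Circuit (n L : ℕ) := Fin L → Layer n

/-- Indices of the rotation gates, hence of the variational parameters. -/
abbrev Circuit.Param {n L : ℕ} (U : Circuit n L) := (i : Fin L) × Fin (U i).R

/-- The unitary of layer `i` at the parameters `θ`. -/
def Circuit.layerOp {n L : ℕ} (U : Circuit n L) (θ : U.Param → ℝ) (i : Fin L) : Op n :=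
  (U i).op fun j => θ ⟨i, j⟩

/-- The Clifford part `V_{i-1} ⋯ V_0` of the layers before layer `i`. -/
def Circuit.cliffBefore {n L : ℕ} (U : Circuit n L) (i : Fin L) : Op n :=
  (List.ofFn fun k : Fin i => (U (Fin.castLE i.isLt.le k)).cliffOp).reverse.prod

/-- The Clifford effected Pauli word of a rotation gate. -/
def Circuit.effected {n L : ℕ} (U : Circuit n L) (p : U.Param) : Op n :=
  (U.cliffBefore p.1)ᴴ * ((U p.1).rot p.2).op * U.cliffBefore p.1

/-- Every Pauli word is, up to a phase in `{1, i, -1, -i}`, a finite product of Clifford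
effected Pauli words. (These are involutions, so finite products are all of the generated
group.) -/
def Circuit.Generates {n L : ℕ} (U : Circuit n L) : Prop :=
  ∀ w : Word n, ∃ k : ℕ,
    (Complex.I ^ k) • w.op ∈ Submonoid.closure (Set.range U.effected)

/-! ### Hamiltonian and input state -/

/-- A Hamiltonian given as a real linear combination of `K` distinct Pauli words. -/
structure Hamiltonian (n : ℕ) where
  K : ℕ
  word : Fin K → Word n
  coeff : Fin K → ℝ
  word_injective : Function.Injective word

def Hamiltonian.op {n : ℕ} (H : Hamiltonian n) : Op n :=
  ∑ k, (H.coeff k : ℂ) • (H.word k).op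

/-- The operator norm with respect to the Euclidean norm. -/
def Hamiltonian.norm {n : ℕ} (H : Hamiltonian n) : ℝ :=
  ‖Matrix.toEuclideanCLM (n := Basis n) (𝕜 := ℂ) H.op‖

/-- An `n`-qubit density matrix given by a list of `K` matrix entries at distinct positions;
all other entries are zero. -/
structure InputState (n : ℕ) where
  K : ℕ
  row : Fin K → Basis n
  col : Fin K → Basis n
  val : Fin K → ℂ
  pos_injective : Function.Injective fun k => (row k, col k)
  posSemidef : (∑ k, Matrix.single (row k) (col k) (val k) : Op n).PosSemidef
  trace_eq_one : (∑ k, Matrix.single (row k) (col k) (val k) : Op n).trace = 1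

def InputState.op {n : ℕ} (ρ : InputState n) : Op n :=
  ∑ k, Matrix.single (ρ.row k) (ρ.col k) (ρ.val k)

/-! ### Noisy cost function and its truncation -/

/-- The single-qubit depolarizing channel. -/
def depolarize (lam : ℝ) (φ : Matrix (Fin 2) (Fin 2) ℂ) : Matrix (Fin 2) (Fin 2) ℂ :=
  ((1 - lam : ℝ) : ℂ) • φ + ((lam : ℂ) * (φ.trace / 2)) • (1 : Matrix (Fin 2) (Fin 2) ℂ)

/-- The `n`-fold tensor power of the depolarizing channel: the linear map that sends
`⨂ |x_q⟩⟨y_q|` to `⨂ N(|x_q⟩⟨y_q|)`. -/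
def noise {n : ℕ} (lam : ℝ) (φ : Op n) : Op n :=
  ∑ x, ∑ y, φ x y • tensor fun q => depolarize lam (Matrix.single (x q) (y q) 1)

/-- The noisy cost function, with noise before each layer and before the observable. -/
def noisyCost {n L : ℕ} (lam : ℝ) (U : Circuit n L) (H : Hamiltonian n) (ρ : InputState n)
    (θ : U.Param → ℝ) : ℂ :=
  (H.op * Fin.foldl L
    (fun φ i => noise lam (U.layerOp θ i * φ * (U.layerOp θ i)ᴴ)) (noise lam ρ.op)).trace

/-- A Pauli path `s_0, …, s_L`, each entry standing for the normalized word. -/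
abbrev Path (n L : ℕ) := Fin (L + 1) → Word n

def Path.weight {n L : ℕ} (s : Path n L) : ℕ := ∑ i, (s i).weight

/-- The contribution of a Pauli path to the noisy cost function. -/
def noisyContribution {n L : ℕ} (lam : ℝ) (U : Circuit n L) (H : Hamiltonian n)
    (ρ : InputState n) (θ : U.Param → ℝ) (s : Path n L) : ℂ :=
  (H.op * noise lam (s (Fin.last L)).normOp).trace *
    (∏ i : Fin L, ((s i.succ).normOp * U.layerOp θ i *
      noise lam (s i.castSucc).normOp * (U.layerOp θ i)ᴴ).trace) *
    ((s 0).normOp * ρ.op).trace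

/-- The truncated estimate: the sum over all Pauli paths of Hamming weight at most `M`. -/
def truncatedCost {n L : ℕ} (lam : ℝ) (U : Circuit n L) (H : Hamiltonian n)
    (ρ : InputState n) (M : ℕ) (θ : U.Param → ℝ) : ℂ :=
  ∑ s : Path n L with s.weight ≤ M, noisyContribution lam U H ρ θ s

/-- Independent parameters, each uniform on `[-π, π]`. -/
def paramMeasure {n L : ℕ} (U : Circuit n L) : MeasureTheory.Measure (U.Param → ℝ) :=
  MeasureTheory.Measure.pi fun _ =>
    ProbabilityTheory.cond MeasureTheory.volume (Set.Icc (-Real.pi) Real.pi)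

/-! ### A real random access machine with a step count

Programs are while-programs. The memory has natural-number cells and real cells; a cell is
addressed by the (fixed) number of an array and three computed indices. Natural numbers can be
added, subtracted (truncated) and compared; reals can be added, subtracted, multiplied and
compared exactly. The input angles are read-only and accessible only through their cosines and
sines. Each operation, each memory access and each test costs one step. -/

/-- Memory contents. -/
structure Mem where
  nat : ℕ → ℕ → ℕ → ℕ → ℕ
  real : ℕ → ℕ → ℕ → ℕ → ℝ
  angle : ℕ → ℕ → ℝ

/-- Natural-number expressions; `read a i j k` is the cell `(i, j, k)` of array `a`. -/
inductive NExp where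
  | lit (c : ℕ)
  | read (a : ℕ) (i j k : NExp)
  | add (e f : NExp)
  | sub (e f : NExp)

def NExp.eval (m : Mem) : NExp → ℕ
  | .lit c => c
  | .read a i j k => m.nat a (i.eval m) (j.eval m) (k.eval m)
  | .add e f => e.eval m + f.eval m
  | .sub e f => e.eval m - f.eval m

def NExp.cost : NExp → ℕ
  | .lit _ => 1
  | .read _ i j k => 1 + i.cost + j.cost + k.cost
  | .add e f => 1 + e.cost + f.cost
  | .sub e f => 1 + e.cost + f.cost

/-- Real expressions; only integer constants are available. -/
inductive RExp where
  | lit (c : ℤ)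
  | read (a : ℕ) (i j k : NExp)
  | cosAngle (i j : NExp)
  | sinAngle (i j : NExp)
  | add (e f : RExp)
  | sub (e f : RExp)
  | mul (e f : RExp)

def RExp.eval (m : Mem) : RExp → ℝ
  | .lit c => c
  | .read a i j k => m.real a (i.eval m) (j.eval m) (k.eval m)
  | .cosAngle i j => Real.cos (m.angle (i.eval m) (j.eval m))
  | .sinAngle i j => Real.sin (m.angle (i.eval m) (j.eval m))
  | .add e f => e.eval m + f.eval m
  | .sub e f => e.eval m - f.eval m
  | .mul e f => e.eval m * f.eval m

def RExp.cost : RExp → ℕ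
  | .lit _ => 1
  | .read _ i j k => 1 + i.cost + j.cost + k.cost
  | .cosAngle i j => 1 + i.cost + j.cost
  | .sinAngle i j => 1 + i.cost + j.cost
  | .add e f => 1 + e.cost + f.cost
  | .sub e f => 1 + e.cost + f.cost
  | .mul e f => 1 + e.cost + f.cost

/-- Tests. -/
inductive BExp where
  | eqN (e f : NExp)
  | ltN (e f : NExp)
  | leR (e f : RExp)
  | not (b : BExp)
  | and (b c : BExp)

def BExp.holds (m : Mem) : BExp → Prop
  | .eqN e f => e.eval m = f.eval m
  | .ltN e f => e.eval m < f.eval m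
  | .leR e f => e.eval m ≤ f.eval m
  | .not b => ¬ b.holds m
  | .and b c => b.holds m ∧ c.holds m

def BExp.cost : BExp → ℕ
  | .eqN e f => 1 + e.cost + f.cost
  | .ltN e f => 1 + e.cost + f.cost
  | .leR e f => 1 + e.cost + f.cost
  | .not b => 1 + b.cost
  | .and b c => 1 + b.cost + c.cost

/-- Programs. -/
inductive Prog where
  | skip
  | setN (a : ℕ) (i j k : NExp) (e : NExp)
  | setR (a : ℕ) (i j k : NExp) (e : RExp)
  | seq (c d : Prog)
  | ite (b : BExp) (c d : Prog)
  | while (b : BExp) (c : Prog)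

/-- Overwrite the cell `(i, j, k)` of array `a`. -/
def upd {α : Type} (f : ℕ → ℕ → ℕ → ℕ → α) (a i j k : ℕ) (v : α) : ℕ → ℕ → ℕ → ℕ → α :=
  fun a' i' j' k' => if a' = a ∧ i' = i ∧ j' = j ∧ k' = k then v else f a' i' j' k'

/-- `Run c m m' t`: started in memory `m`, the program `c` halts in memory `m'` after exactly
`t` steps. -/
inductive Run : Prog → Mem → Mem → ℕ → Prop where
  | skip (m : Mem) : Run .skip m m 1
  | setN (a : ℕ) (i j k e : NExp) (m : Mem) :
      Run (.setN a i j k e) m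
        { m with nat := upd m.nat a (i.eval m) (j.eval m) (k.eval m) (e.eval m) }
        (1 + i.cost + j.cost + k.cost + e.cost)
  | setR (a : ℕ) (i j k : NExp) (e : RExp) (m : Mem) :
      Run (.setR a i j k e) m
        { m with real := upd m.real a (i.eval m) (j.eval m) (k.eval m) (e.eval m) }
        (1 + i.cost + j.cost + k.cost + e.cost)
  | seq {c d : Prog} {m m' m'' : Mem} {t t' : ℕ} :
      Run c m m' t → Run d m' m'' t' → Run (.seq c d) m m'' (t + t')
  | iteTrue {b : BExp} {c d : Prog} {m m' : Mem} {t : ℕ} :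
      b.holds m → Run c m m' t → Run (.ite b c d) m m' (1 + b.cost + t)
  | iteFalse {b : BExp} {c d : Prog} {m m' : Mem} {t : ℕ} :
      ¬ b.holds m → Run d m m' t → Run (.ite b c d) m m' (1 + b.cost + t)
  | whileTrue {b : BExp} {c : Prog} {m m' m'' : Mem} {t t' : ℕ} :
      b.holds m → Run c m m' t → Run (.while b c) m' m'' t' →
      Run (.while b c) m m'' (1 + b.cost + t + t')
  | whileFalse {b : BExp} {c : Prog} {m : Mem} :
      ¬ b.holds m → Run (.while b c) m m (1 + b.cost)

/-! ### Input format -/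

/-- A finite sequence as an infinite array, filled up with zeros. -/
def pad {α : Type} [Zero α] {k : ℕ} (f : Fin k → α) (i : ℕ) : α :=
  if h : i < k then f ⟨i, h⟩ else 0

/-- The discrete part of the input: sizes, circuit, words of `H`, positions of entries of `ρ`. -/
def inputNat {n L : ℕ} (U : Circuit n L) (H : Hamiltonian n) (ρ : InputState n) :
    ℕ → ℕ → ℕ → ℕ → ℕ
  | 0, 0, _, _ => n
  | 0, 1, _, _ => L
  | 0, 2, _, _ => H.K
  | 0, 3, _, _ => ρ.K
  | 1, i, _, _ => pad (fun i => (U i).R) i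
  | 2, i, j, q => pad (fun i => pad (fun j => pad (fun q => ((U i).rot j q).code) q) j) i
  | 3, i, _, _ => pad (fun i => (U i).C) i
  | 4, i, k, 0 => pad (fun i => pad (fun k => ((U i).cliff k).code.1) k) i
  | 4, i, k, 1 => pad (fun i => pad (fun k => ((U i).cliff k).code.2.1) k) i
  | 4, i, k, 2 => pad (fun i => pad (fun k => ((U i).cliff k).code.2.2) k) i
  | 5, k, q, _ => pad (fun k => pad (fun q => (H.word k q).code) q) k
  | 6, k, q, _ => pad (fun k => pad (fun q => (ρ.row k q : ℕ)) q) k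
  | 7, k, q, _ => pad (fun k => pad (fun q => (ρ.col k q : ℕ)) q) k
  | _, _, _, _ => 0

/-- The real part of the input: noise rate, error bound, coefficients of `H`, real and imaginary
parts of the entries of `ρ`. -/
def inputReal {n : ℕ} (lam ν : ℝ) (H : Hamiltonian n) (ρ : InputState n) :
    ℕ → ℕ → ℕ → ℕ → ℝ
  | 1, 0, _, _ => lam
  | 1, 1, _, _ => ν
  | 2, k, _, _ => pad H.coeff k
  | 3, k, _, _ => pad (fun k => (ρ.val k).re) k
  | 4, k, _, _ => pad (fun k => (ρ.val k).im) k
  | _, _, _, _ => 0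

/-- The initial memory of the machine. -/
def input {n L : ℕ} (lam ν : ℝ) (U : Circuit n L) (H : Hamiltonian n) (ρ : InputState n)
    (θ : U.Param → ℝ) : Mem where
  nat := inputNat U H ρ
  real := inputReal lam ν H ρ
  angle := fun i j => pad (fun i => pad (fun j => θ ⟨i, j⟩) j) i

/-- The result is read off the first cell of real array `0`. -/
def Mem.output (m : Mem) : ℝ := m.real 0 0 0 0

/-- Sizes of the input are bounded by `q n`: Pauli words of `H`, listed entries of `ρ`,
rotations in each layer. (The rotation bound matters only for rotations about the identity word,
which act on no qubit; the other gates of a layer number at most `n`.) -/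
def SizeBound {n L : ℕ} (q : Polynomial ℕ) (U : Circuit n L) (H : Hamiltonian n)
    (ρ : InputState n) : Prop :=
  H.K ≤ q.eval n ∧ ρ.K ≤ q.eval n ∧ ∀ i, (U i).R ≤ q.eval n

end NoisyVQA

end

/-! Work in the Heisenberg picture and in the Pauli basis. Pulled back through a Clifford gate, a
Pauli word `w` becomes another word up to sign. Pulled back through a rotation about `σ`, it is
unchanged if `σ` and `w` commute, and otherwise becomes `cos θ · w ± sin θ · σw`. Depolarizing noise
multiplies it by `(1 - λ) ^ |w|`. The expectation of a word is thus a binary tree of signed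
trigonometric monomials, and the damping of a leaf depends only on the weight collected on the way
to it. `propagate` leaves this damping as a free function `χ` of the weight: `χ k = (1 - λ) ^ k`
gives the noisy cost (`noisyCost_eq_sum`), and the same function cut off above `M` gives the
truncated cost (`truncatedCost_eq_sum`). By linearity in `χ` the truncation error is again such a
tree, with `|χ| ≤ (1 - λ) ^ M`.

Mean square error: every angle belongs to a single rotation, the means of `cos`, `sin` and `sin ·
cos` vanish, and those of `cos²` and `sin²` are `1/2`. So the second moment of one tree is at most
the supremum of `χ²` (`integral_propagate_sq_le`). The trees of `w` and `v` are orthogonal unless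
the product `wv` commutes with all rotations that it meets (`integral_propagate_mul_eq_zero`). Such
a product, pulled back to the input, commutes with all effected words. By the generation hypothesis
it then commutes with every operator, which forces `wv` to be the identity word
(`eq_one_of_commutesAlong`). The error is therefore at most `(1 - λ) ^ (2M) · ∑ c_k²`, where the
`c_k` are the coefficients of `H`.

Running time: rotations of one layer have disjoint supports, so a word `w` entering a layer branches
at most `|w|` times there, and `|w|` has just been added to the collected weight by the noise. Up to
weight `M` there are at most `M` branchings (`branchings_steps_le`), so the numbers below `2 ^ M`,
read as bit strings, enumerate the tree (`sum_value_run`). The program takes the least `M` with `(1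
- λ) ^ (2M) · ∑ c_k² ≤ ν`, found by repeated multiplication. For this `M`, `2 ^ M` is bounded by a
fixed power of `∑ c_k² / ν` (`two_pow_le_of_cutoff`), and `∑ c_k²` is at most the number of terms
times `‖H‖²` (`Hamiltonian.sum_coeff_sq_le`). All loops are shorter than one polynomially bounded
`D`, so the time is at most a constant times a fixed power of `D` (`Prog.timeBound_le`). -/

noncomputable section
namespace NoisyVQA

/-! ### Products of Pauli words -/

/-- The product of two Pauli labels, up to a phase. -/
def Pauli.mul : Pauli → Pauli → Pauli
  | .I, b => b
  | a, .I => a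
  | .X, .X => .I
  | .X, .Y => .Z
  | .X, .Z => .Y
  | .Y, .X => .Z
  | .Y, .Y => .I
  | .Y, .Z => .X
  | .Z, .X => .Y
  | .Z, .Y => .X
  | .Z, .Z => .I

/-- The exponent of `i` in the product of two Pauli labels. -/
def Pauli.phase : Pauli → Pauli → ℕ
  | .X, .Y => 1
  | .Y, .Z => 1
  | .Z, .X => 1
  | .Y, .X => 3
  | .Z, .Y => 3
  | .X, .Z => 3
  | _, _ => 0

theorem Pauli.mat_mul_mat (a b : Pauli) :
    a.mat * b.mat = Complex.I ^ a.phase b • (a.mul b).mat := by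
  have h3 : Complex.I ^ 3 = -Complex.I := by rw [pow_succ, Complex.I_sq]; ring
  cases a <;> cases b <;> ext i j <;> fin_cases i <;> fin_cases j <;>
    simp [Pauli.mat, Pauli.phase, Pauli.mul, h3]

theorem Pauli.conjTranspose_mat (a : Pauli) : a.matᴴ = a.mat := by
  cases a <;> ext i j <;> fin_cases i <;> fin_cases j <;> simp [Pauli.mat]

theorem Pauli.trace_mat (a : Pauli) : a.mat.trace = if a = .I then 2 else 0 := by
  cases a <;> simp [Pauli.mat, Matrix.trace_fin_two]

/-- Completeness relation: `∑ P ⊗ P` is twice the swap. Its tensor power yields the Pauli expansion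
of an arbitrary operator. -/
theorem Pauli.sum_mat_mul_mat (a b c d : Fin 2) :
    ∑ P : Pauli, P.mat a b * P.mat c d = if a = d ∧ b = c then 2 else 0 := by
  have : (Finset.univ : Finset Pauli) = {.I, .X, .Y, .Z} := rfl
  rw [this]
  fin_cases a <;> fin_cases b <;> fin_cases c <;> fin_cases d <;>
    simp [Pauli.mat] <;> norm_num

theorem Pauli.mul_self (a : Pauli) : a.mul a = .I := by cases a <;> rfl
theorem Pauli.phase_self (a : Pauli) : a.phase a = 0 := by cases a <;> rfl
theorem Pauli.mul_comm (a b : Pauli) : a.mul b = b.mul a := by cases a <;> cases b <;> rfl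
theorem Pauli.mul_eq_I_iff (a b : Pauli) : a.mul b = .I ↔ a = b := by
  cases a <;> cases b <;> simp [Pauli.mul]
theorem Pauli.phase_add_phase_swap (a b : Pauli) : (a.phase b + b.phase a) % 4 = 0 := by
  cases a <;> cases b <;> rfl
theorem Pauli.phase_mul_right (a b c : Pauli) :
    a.phase (b.mul c) % 2 = (a.phase b + a.phase c) % 2 := by
  cases a <;> cases b <;> cases c <;> rfl

/-! ### Tensor products of matrices -/

section Tensor

variable {n : ℕ}

theorem tensor_mul (a b : Fin n → Matrix (Fin 2) (Fin 2) ℂ) :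
    tensor a * tensor b = tensor fun q => a q * b q := by
  ext x y
  simp only [tensor, Matrix.mul_apply, Matrix.of_apply, Finset.prod_univ_sum,
    Fintype.piFinset_univ, Finset.prod_mul_distrib]

theorem tensor_smul (c : Fin n → ℂ) (m : Fin n → Matrix (Fin 2) (Fin 2) ℂ) :
    (tensor fun q => c q • m q) = (∏ q, c q) • tensor m := by
  ext x y
  simp [tensor, Finset.prod_mul_distrib]

theorem tensor_one : tensor (fun _ : Fin n => 1) = 1 := by
  ext x y
  simp only [tensor, Matrix.of_apply, Matrix.one_apply]
  by_cases h : x = y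
  · simp [h]
  · obtain ⟨q, hq⟩ := Function.ne_iff.mp h
    rw [if_neg h]
    exact Finset.prod_eq_zero (Finset.mem_univ q) (by simp [hq])

theorem trace_tensor (m : Fin n → Matrix (Fin 2) (Fin 2) ℂ) :
    (tensor m).trace = ∏ q, (m q).trace := by
  simp only [tensor, Matrix.trace, Matrix.diag_apply, Matrix.of_apply, Finset.prod_univ_sum,
    Fintype.piFinset_univ]

theorem conjTranspose_tensor (m : Fin n → Matrix (Fin 2) (Fin 2) ℂ) :
    (tensor m)ᴴ = tensor fun q => (m q)ᴴ := by
  ext x y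
  simp [tensor]

/-! ### Words -/

/-- The product of two Pauli words, up to a phase. -/
def Word.mul (v w : Word n) : Word n := fun q => (v q).mul (w q)

/-- The exponent of `i` in the product of two Pauli words. -/
def Word.phase (v w : Word n) : ℕ := ∑ q, (v q).phase (w q)

/-- The two words anticommute. -/
def Word.Anti (v w : Word n) : Prop := v.phase w % 2 = 1

instance (v w : Word n) : Decidable (v.Anti w) := inferInstanceAs (Decidable (_ = _))

theorem Word.op_mul_op (v w : Word n) :
    v.op * w.op = Complex.I ^ v.phase w • (v.mul w).op := by
  simp only [Word.op, tensor_mul, Pauli.mat_mul_mat]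
  rw [tensor_smul, Finset.prod_pow_eq_pow_sum]
  rfl

theorem Word.conjTranspose_op (w : Word n) : w.opᴴ = w.op := by
  simp only [Word.op, conjTranspose_tensor, Pauli.conjTranspose_mat]

theorem Word.op_one : Word.op (fun _ : Fin n => Pauli.I) = 1 := tensor_one

theorem Word.mul_self (w : Word n) : w.mul w = fun _ => .I := by
  funext q; exact Pauli.mul_self _

theorem Word.op_mul_self (w : Word n) : w.op * w.op = 1 := by
  rw [Word.op_mul_op, Word.mul_self, Word.op_one]
  simp [Word.phase, Pauli.phase_self]

/-- When two words are both multiplied by the same rotation word, their product is unchanged. This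
is the invariant behind the orthogonality of propagated words. -/
theorem Word.mul_mul_mul_cancel (s v w : Word n) : (s.mul v).mul (s.mul w) = v.mul w := by
  funext q
  simp only [Word.mul]
  generalize s q = a
  generalize v q = b
  generalize w q = c
  cases a <;> cases b <;> cases c <;> rfl

theorem Word.mul_ne_one {v w : Word n} (h : v ≠ w) : v.mul w ≠ fun _ => .I := by
  intro h'
  exact h (funext fun q => (Pauli.mul_eq_I_iff _ _).mp (congrFun h' q))

/-- The phases of `vw` and `wv` are inverse to each other. So they agree when the exponent is even
and are opposite when it is odd: two words always commute or anticommute. -/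
theorem Word.phase_add_swap (v w : Word n) : 4 ∣ v.phase w + w.phase v := by
  rw [Word.phase, Word.phase, ← Finset.sum_add_distrib]
  exact Finset.dvd_sum fun q _ => Nat.dvd_of_mod_eq_zero (Pauli.phase_add_phase_swap _ _)

theorem Word.mul_comm (v w : Word n) : v.mul w = w.mul v := funext fun _ => Pauli.mul_comm _ _

theorem Word.commute_of_not_anti {v w : Word n} (h : ¬ v.Anti w) : v.op * w.op = w.op * v.op := by
  rw [Word.op_mul_op, Word.op_mul_op w, Word.mul_comm]
  have h1 := Word.phase_add_swap v w
  unfold Word.Anti at h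
  congr 1
  rw [← Nat.mod_add_div (v.phase w) 4, ← Nat.mod_add_div (w.phase v) 4]
  simp only [pow_add, pow_mul, Complex.I_pow_four, one_pow, mul_one]
  congr 1
  omega

theorem Word.anticommute_of_anti {v w : Word n} (h : v.Anti w) :
    v.op * w.op = -(w.op * v.op) := by
  rw [Word.op_mul_op, Word.op_mul_op w, Word.mul_comm, ← neg_smul]
  have h1 := Word.phase_add_swap v w
  unfold Word.Anti at h
  congr 1
  rw [← Nat.mod_add_div (v.phase w) 4, ← Nat.mod_add_div (w.phase v) 4]
  simp only [pow_add, pow_mul, Complex.I_pow_four, one_pow, mul_one]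
  have h2 : v.phase w % 4 = 1 ∧ w.phase v % 4 = 3 ∨ v.phase w % 4 = 3 ∧ w.phase v % 4 = 1 := by
    omega
  have h3 : Complex.I ^ 3 = -Complex.I := by rw [pow_succ, Complex.I_sq]; ring
  rcases h2 with ⟨h, h'⟩ | ⟨h, h'⟩ <;> rw [h, h', h3] <;> simp

/-- Anticommutation is a symplectic form over the field with two elements, hence additive in its
second argument. -/
theorem Word.anti_mul_iff (s v w : Word n) :
    s.Anti (v.mul w) ↔ ¬ (s.Anti v ↔ s.Anti w) := by
  have : s.phase (v.mul w) % 2 = (s.phase v + s.phase w) % 2 := by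
    unfold Word.phase
    rw [← Finset.sum_add_distrib]
    conv_lhs => rw [Finset.sum_nat_mod]
    conv_rhs => rw [Finset.sum_nat_mod]
    simp only [Word.mul, Pauli.phase_mul_right]
  unfold Word.Anti
  rw [this]
  omega

theorem Word.op_ne_zero (w : Word n) : w.op ≠ 0 := by
  intro h
  have := Word.op_mul_self w
  rw [h, zero_mul] at this
  exact zero_ne_one this

theorem Word.trace_op (w : Word n) : w.op.trace = if w = (fun _ => .I) then 2 ^ n else 0 := by
  rw [Word.op, trace_tensor]
  simp only [Pauli.trace_mat]
  split_ifs with h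
  · simp [h]
  · obtain ⟨q, hq⟩ := Function.ne_iff.mp h
    exact Finset.prod_eq_zero (Finset.mem_univ q) (by simp [hq])

theorem Word.trace_op_mul_op (v w : Word n) :
    (v.op * w.op).trace = if v = w then 2 ^ n else 0 := by
  rw [Word.op_mul_op, Matrix.trace_smul, Word.trace_op]
  by_cases h : v = w
  · subst h
    simp [Word.mul_self, Word.phase, Pauli.phase_self]
  · rw [if_neg (Word.mul_ne_one h), if_neg h, smul_zero]

/-- The coefficient of a Pauli word in an operator. -/
def pauliCoeff (w : Word n) (O : Op n) : ℂ := (w.op * O).trace / 2 ^ n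

theorem sum_word_op_apply (x y x' y' : Basis n) :
    ∑ w : Word n, w.op x y * w.op x' y' = if x = y' ∧ y = x' then 2 ^ n else 0 := by
  have h1 : ∑ w : Word n, w.op x y * w.op x' y' =
      ∏ q, ∑ P : Pauli, P.mat (x q) (y q) * P.mat (x' q) (y' q) := by
    rw [Finset.prod_univ_sum, Fintype.piFinset_univ]
    simp only [Word.op, tensor, Matrix.of_apply, Finset.prod_mul_distrib]
  rw [h1]
  simp only [Pauli.sum_mat_mul_mat]
  split_ifs with h
  · simp [h.1, h.2]
  · have : ∃ q, ¬ (x q = y' q ∧ y q = x' q) := by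
      by_contra hc
      push Not at hc
      exact h ⟨funext fun q => (hc q).1, funext fun q => (hc q).2⟩
    obtain ⟨q, hq⟩ := this
    exact Finset.prod_eq_zero (Finset.mem_univ q) (by rw [if_neg hq])

theorem sum_pauliCoeff_smul_op (O : Op n) : ∑ w : Word n, pauliCoeff w O • w.op = O := by
  ext x y
  simp only [Matrix.sum_apply, Matrix.smul_apply, smul_eq_mul, pauliCoeff, Matrix.trace,
    Matrix.diag_apply, Matrix.mul_apply]
  have h : ∀ w : Word n, (∑ a, ∑ b, w.op a b * O b a) / 2 ^ n * w.op x y =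
      ∑ a, ∑ b, O b a / 2 ^ n * (w.op a b * w.op x y) := by
    intro w
    rw [Finset.sum_div, Finset.sum_mul]
    refine Finset.sum_congr rfl fun a _ => ?_
    rw [Finset.sum_div, Finset.sum_mul]
    refine Finset.sum_congr rfl fun b _ => ?_
    ring
  simp only [h]
  rw [Finset.sum_comm]
  have h2 : ∀ a, ∑ w : Word n, ∑ b, O b a / 2 ^ n * (w.op a b * w.op x y) =
      ∑ b, O b a / 2 ^ n * (if a = y ∧ b = x then 2 ^ n else 0) := by
    intro a
    rw [Finset.sum_comm]
    refine Finset.sum_congr rfl fun b _ => ?_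
    rw [← Finset.mul_sum, sum_word_op_apply]
  simp only [h2]
  rw [Finset.sum_eq_single y (by intro a _ ha; simp [ha]) (by simp),
    Finset.sum_eq_single x (by intro a _ ha; simp [ha]) (by simp)]
  simp

theorem pauliCoeff_op (v w : Word n) : pauliCoeff v w.op = if v = w then 1 else 0 := by
  rw [pauliCoeff, Word.trace_op_mul_op]
  split_ifs <;> simp

theorem pauliCoeff_add (w : Word n) (A B : Op n) :
    pauliCoeff w (A + B) = pauliCoeff w A + pauliCoeff w B := by
  simp [pauliCoeff, mul_add, add_div]

theorem pauliCoeff_smul (w : Word n) (c : ℂ) (A : Op n) :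
    pauliCoeff w (c • A) = c * pauliCoeff w A := by
  simp [pauliCoeff, mul_div_assoc]

theorem pauliCoeff_sum {ι : Type*} (w : Word n) (s : Finset ι) (A : ι → Op n) :
    pauliCoeff w (∑ i ∈ s, A i) = ∑ i ∈ s, pauliCoeff w (A i) := by
  simp [pauliCoeff, Finset.mul_sum, Matrix.trace_sum, Finset.sum_div]

end Tensor

end NoisyVQA
end

/-! ### The action of noise, rotations and Clifford gates on Pauli words. -/

noncomputable section
namespace NoisyVQA

variable {n : ℕ}

/-! ### Noise in the Pauli basis -/

theorem trace_mat_mul_depolarize (lam : ℝ) (a : Pauli) (φ : Matrix (Fin 2) (Fin 2) ℂ) :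
    (a.mat * depolarize lam φ).trace =
      (if a = .I then 1 else ((1 - lam : ℝ) : ℂ)) * (a.mat * φ).trace := by
  simp only [depolarize, mul_add, Matrix.mul_smul, Matrix.trace_add, Matrix.trace_smul, mul_one,
    Pauli.trace_mat, smul_eq_mul]
  split_ifs with h
  · subst h
    simp only [Pauli.mat, one_mul]
    push_cast
    ring
  · simp

theorem prod_ite_identity (w : Word n) (c : ℂ) :
    ∏ q, (if w q = .I then 1 else c) = c ^ w.weight := by
  rw [Finset.prod_ite, Finset.prod_const_one, one_mul, Finset.prod_const]
  rfl

theorem sum_smul_tensor_single (φ : Op n) :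
    ∑ x, ∑ y, φ x y • tensor (fun q => Matrix.single (x q) (y q) (1 : ℂ)) = φ := by
  have h : ∀ x y : Basis n, tensor (fun q => Matrix.single (x q) (y q) (1 : ℂ)) =
      Matrix.single x y 1 := by
    intro x y
    ext a b
    simp only [tensor, Matrix.of_apply, Matrix.single_apply]
    split_ifs with hab
    · simp [hab.1, hab.2]
    · have : ∃ q, ¬ (x q = a q ∧ y q = b q) := by
        by_contra hc
        push Not at hc
        exact hab ⟨funext fun q => (hc q).1, funext fun q => (hc q).2⟩
      obtain ⟨q, hq⟩ := this
      exact Finset.prod_eq_zero (Finset.mem_univ q) (by rw [if_neg hq])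
  simp only [h, Matrix.smul_single, smul_eq_mul, mul_one]
  exact (Matrix.matrix_eq_sum_single φ).symm

/-- The channel is diagonal in the Pauli basis: on one qubit it keeps the identity component and
scales the other three by `1 - lam`. By linearity it is enough to check tensor products of matrix
units, where the trace factorizes. -/
theorem pauliCoeff_noise (lam : ℝ) (w : Word n) (φ : Op n) :
    pauliCoeff w (noise lam φ) = ((1 - lam : ℝ) : ℂ) ^ w.weight * pauliCoeff w φ := by
  conv_rhs => rw [← sum_smul_tensor_single φ]
  simp only [noise, pauliCoeff_sum, pauliCoeff_smul, Finset.mul_sum]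
  refine Finset.sum_congr rfl fun x _ => Finset.sum_congr rfl fun y _ => ?_
  rw [pauliCoeff, pauliCoeff, Word.op, tensor_mul, tensor_mul, trace_tensor, trace_tensor]
  simp only [trace_mat_mul_depolarize]
  rw [Finset.prod_mul_distrib, prod_ite_identity]
  ring

theorem noise_op (lam : ℝ) (w : Word n) :
    noise lam w.op = ((1 - lam : ℝ) : ℂ) ^ w.weight • w.op := by
  rw [← sum_pauliCoeff_smul_op (noise lam w.op)]
  simp only [pauliCoeff_noise, pauliCoeff_op]
  rw [Finset.sum_eq_single w (by intro v _ hv; simp [hv]) (by simp)]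
  simp

theorem noise_smul (lam : ℝ) (c : ℂ) (φ : Op n) : noise lam (c • φ) = c • noise lam φ := by
  simp only [noise, Matrix.smul_apply, smul_eq_mul, mul_smul, Finset.smul_sum]

theorem Word.normOp_eq (w : Word n) :
    w.normOp = (((1 / Real.sqrt 2 : ℝ) : ℂ) ^ n) • w.op := by
  rw [Word.normOp, tensor_smul]
  simp [Word.op]

/-! ### Rotations -/

/-- The involution is the difference of the complementary projections `(1 + P) / 2` and `(1 - P) /
2`, so the exponential series is summed separately on the eigenvalues `1` and `-1`. -/
theorem exp_smul_involution {m : Type*} [Fintype m] [DecidableEq m] (a : ℂ) (P : Matrix m m ℂ)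
    (hP : P * P = 1) :
    NormedSpace.exp (a • P) = Complex.cosh a • (1 : Matrix m m ℂ) + Complex.sinh a • P := by
  have hpow : ∀ k : ℕ, P ^ k = (1 / 2 : ℂ) • ((1 : Matrix m m ℂ) + P) +
      ((-1) ^ k * (1 / 2 : ℂ)) • (1 - P) := by
    intro k
    induction k with
    | zero => ext i j; simp; ring
    | succ k ih =>
      rw [pow_succ, ih]
      simp only [add_mul, Matrix.smul_mul, one_mul, sub_mul, hP]
      ext i j
      simp only [Matrix.add_apply, Matrix.smul_apply, Matrix.sub_apply, smul_eq_mul]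
      ring
  have hs : ∀ z : ℂ, HasSum (fun k : ℕ => (k.factorial⁻¹ : ℂ) * z ^ k) (Complex.exp z) := by
    intro z
    have := NormedSpace.exp_series_hasSum_exp' (𝕂 := ℂ) z
    simpa [Complex.exp_eq_exp_ℂ] using this
  have h1 := ((hs a).smul_const ((1 / 2 : ℂ) • ((1 : Matrix m m ℂ) + P))).add
    ((hs (-a)).smul_const ((1 / 2 : ℂ) • ((1 : Matrix m m ℂ) - P)))
  rw [NormedSpace.exp_eq_tsum ℂ]
  have h2 : (fun k : ℕ => ((k.factorial : ℂ)⁻¹) • (a • P) ^ k) = fun k : ℕ =>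
      (((k.factorial : ℂ)⁻¹) * a ^ k) • ((1 / 2 : ℂ) • ((1 : Matrix m m ℂ) + P)) +
      (((k.factorial : ℂ)⁻¹) * (-a) ^ k) • ((1 / 2 : ℂ) • ((1 : Matrix m m ℂ) - P)) := by
    funext k
    rw [smul_pow, hpow, neg_pow a]
    ext i j
    simp only [Matrix.add_apply, Matrix.smul_apply, Matrix.sub_apply, smul_eq_mul]
    ring
  simp only [h2]
  rw [h1.tsum_eq, Complex.cosh, Complex.sinh]
  ext i j
  simp only [Matrix.add_apply, Matrix.smul_apply, Matrix.sub_apply, smul_eq_mul]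
  ring

theorem rotation_eq (t : ℝ) (w : Word n) :
    rotation t w = ((Real.cos (t / 2) : ℝ) : ℂ) • (1 : Op n) -
      (Complex.I * ((Real.sin (t / 2) : ℝ) : ℂ)) • w.op := by
  rw [rotation, exp_smul_involution _ _ (Word.op_mul_self w)]
  have h : -Complex.I * ((t / 2 : ℝ) : ℂ) = (-((t / 2 : ℝ) : ℂ)) * Complex.I := by ring
  rw [h, Complex.cosh_mul_I, Complex.sinh_mul_I, Complex.cos_neg, Complex.sin_neg,
    Complex.ofReal_cos, Complex.ofReal_sin]
  ext i j
  simp only [Matrix.add_apply, Matrix.smul_apply, Matrix.sub_apply, smul_eq_mul]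
  ring

theorem conjTranspose_rotation (t : ℝ) (w : Word n) :
    (rotation t w)ᴴ = ((Real.cos (t / 2) : ℝ) : ℂ) • (1 : Op n) +
      (Complex.I * ((Real.sin (t / 2) : ℝ) : ℂ)) • w.op := by
  rw [rotation_eq, Matrix.conjTranspose_sub, Matrix.conjTranspose_smul, Matrix.conjTranspose_smul,
    Matrix.conjTranspose_one, Word.conjTranspose_op]
  ext i j
  simp only [Matrix.add_apply, Matrix.smul_apply, Matrix.sub_apply, smul_eq_mul, star_mul',
    Complex.star_def, Complex.conj_ofReal, Complex.conj_I]
  ring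

/-- The sign of the Pauli word `σ w` in `i σ w`, for anticommuting words. -/
def Word.rotSign (σ w : Word n) : ℝ := if σ.phase w % 4 = 1 then -1 else 1

theorem Word.I_smul_op_mul_op {σ w : Word n} (h : σ.Anti w) :
    Complex.I • (σ.op * w.op) = (σ.rotSign w : ℂ) • (σ.mul w).op := by
  rw [Word.op_mul_op, smul_smul]
  congr 1
  unfold Word.Anti at h
  rw [← Nat.mod_add_div (σ.phase w) 4]
  simp only [pow_add, pow_mul, Complex.I_pow_four, one_pow, mul_one, Word.rotSign]
  have h2 : σ.phase w % 4 = 1 ∨ σ.phase w % 4 = 3 := by omega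
  rcases h2 with h2 | h2
  · simp [h2]
  · simp only [h2]
    rw [← pow_succ', Complex.I_pow_four]
    norm_num

theorem rotation_conj_of_not_anti (t : ℝ) {σ w : Word n} (h : ¬ σ.Anti w) :
    (rotation t σ)ᴴ * w.op * rotation t σ = w.op := by
  rw [conjTranspose_rotation, rotation_eq]
  have hc := Word.commute_of_not_anti h
  have hs := Word.op_mul_self σ
  simp only [add_mul, mul_sub, Matrix.smul_mul, Matrix.mul_smul, one_mul, mul_one]
  rw [hc, mul_assoc w.op, hs, mul_one]
  have hcs : ((Real.cos (t / 2) : ℝ) : ℂ) ^ 2 + ((Real.sin (t / 2) : ℝ) : ℂ) ^ 2 = 1 := by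
    rw [← Complex.ofReal_pow, ← Complex.ofReal_pow, ← Complex.ofReal_add,
      Real.cos_sq_add_sin_sq, Complex.ofReal_one]
  ext i j
  simp only [Matrix.add_apply, Matrix.smul_apply, Matrix.sub_apply, smul_eq_mul]
  linear_combination (w.op i j) * hcs - ((Real.sin (t / 2) : ℝ) : ℂ) ^ 2 * w.op i j * Complex.I_sq

/-- Since `σ w σ = -w`, the half-angle products combine to `cos t` and `sin t`. The operator `i σ w`
is plus or minus a Pauli word, because the phase of `σ w` is `i` or `-i`. -/
theorem rotation_conj_of_anti (t : ℝ) {σ w : Word n} (h : σ.Anti w) :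
    (rotation t σ)ᴴ * w.op * rotation t σ =
      ((Real.cos t : ℝ) : ℂ) • w.op + ((Real.sin t * σ.rotSign w : ℝ) : ℂ) • (σ.mul w).op := by
  have hI := Word.I_smul_op_mul_op h
  rw [Complex.ofReal_mul, mul_smul, ← hI, conjTranspose_rotation, rotation_eq]
  have hc := Word.anticommute_of_anti h
  have hs := Word.op_mul_self σ
  have hc' : w.op * σ.op = -(σ.op * w.op) := by rw [hc, neg_neg]
  simp only [add_mul, mul_sub, Matrix.smul_mul, Matrix.mul_smul, one_mul, mul_one]
  rw [mul_assoc σ.op, hc', mul_neg, ← mul_assoc, hs, one_mul]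
  have ht : t = 2 * (t / 2) := by ring
  conv_rhs => rw [ht, Real.cos_two_mul', Real.sin_two_mul]
  push_cast
  ext i j
  simp only [Matrix.add_apply, Matrix.smul_apply, Matrix.sub_apply, Matrix.neg_apply, smul_eq_mul]
  linear_combination (Complex.sin (t / 2)) ^ 2 * w.op i j * Complex.I_sq

/-! ### Clifford gates -/

/-- Action of the Hadamard gate on Pauli labels, up to sign. -/
def Pauli.hadamard : Pauli → Pauli
  | .I => .I
  | .X => .Z
  | .Y => .Y
  | .Z => .X

/-- Action of the phase gate on Pauli labels, up to sign. -/
def Pauli.phaseGate : Pauli → Pauli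
  | .I => .I
  | .X => .Y
  | .Y => .X
  | .Z => .Z

/-- The control letter after conjugation by a CNOT gate, up to sign. -/
def Pauli.cnotControl (a b : Pauli) : Pauli := if b = .Y ∨ b = .Z then a.mul .Z else a

/-- The target letter after conjugation by a CNOT gate, up to sign. -/
def Pauli.cnotTarget (a b : Pauli) : Pauli := if a = .X ∨ a = .Y then Pauli.X.mul b else b

/-- Conjugation of a Pauli word by a Clifford gate, up to sign. -/
def Clifford.act : Clifford n → Word n → Word n
  | .H a, w => Function.update w a (w a).hadamard
  | .S a, w => Function.update w a (w a).phaseGate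
  | .CNOT a b _, w =>
    Function.update (Function.update w b ((w a).cnotTarget (w b))) a ((w a).cnotControl (w b))

/-- Whether conjugation of a Pauli word by a Clifford gate produces a minus sign. -/
def Clifford.Flips : Clifford n → Word n → Prop
  | .H a, w => w a = .Y
  | .S a, w => w a = .X
  | .CNOT a b _, w => (w a = .X ∧ w b = .Z) ∨ (w a = .Y ∧ w b = .Y)

open Classical in
/-- The sign produced by conjugation of a Pauli word by a Clifford gate. -/
def Clifford.sign (V : Clifford n) (w : Word n) : ℝ := if V.Flips w then -1 else 1

theorem tensor_update_conj (a : Fin n) (g : Matrix (Fin 2) (Fin 2) ℂ) (w : Word n) (c : ℂ)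
    (P : Pauli) (h : gᴴ * (w a).mat * g = c • P.mat) :
    (tensor (Function.update (fun _ => 1) a g))ᴴ * w.op *
      tensor (Function.update (fun _ => 1) a g) = c • Word.op (Function.update w a P) := by
  rw [conjTranspose_tensor, Word.op, tensor_mul, tensor_mul]
  have hf : (fun q => ((Function.update (fun _ => 1) a g : Fin n → _) q)ᴴ * (w q).mat *
      (Function.update (fun _ => 1) a g : Fin n → _) q) =
      fun q => (Function.update (fun _ => 1) a c : Fin n → ℂ) q •
        ((Function.update w a P : Word n) q).mat := by
    funext q
    by_cases hq : q = a
    · subst hq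
      simpa using h
    · simp [Function.update_of_ne hq]
  rw [hf, tensor_smul, Finset.prod_update_of_mem (Finset.mem_univ a)]
  simp [Word.op]

theorem hadamard_conj (P : Pauli) :
    ((((1 / Real.sqrt 2 : ℝ) : ℂ) • !![1, 1; 1, -1] : Matrix (Fin 2) (Fin 2) ℂ))ᴴ * P.mat *
      (((1 / Real.sqrt 2 : ℝ) : ℂ) • !![1, 1; 1, -1]) =
      (((if P = .Y then -1 else 1 : ℝ)) : ℂ) • P.hadamard.mat := by
  have hs : (((1 / Real.sqrt 2 : ℝ) : ℂ)) * ((1 / Real.sqrt 2 : ℝ) : ℂ) = 1 / 2 := by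
    rw [← Complex.ofReal_mul, div_mul_div_comm, Real.mul_self_sqrt (by norm_num)]
    norm_num
  generalize hc : ((1 / Real.sqrt 2 : ℝ) : ℂ) = c at hs
  have hcc : star c = c := by rw [← hc, Complex.star_def, Complex.conj_ofReal]
  rw [Matrix.conjTranspose_smul, hcc, Matrix.smul_mul, Matrix.smul_mul, Matrix.mul_smul,
    smul_smul, hs]
  cases P <;> ext i j <;> fin_cases i <;> fin_cases j <;>
    simp [Pauli.mat, Pauli.hadamard, Matrix.mul_apply, Fin.sum_univ_two] <;> ring_nf

theorem phaseGate_conj (P : Pauli) :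
    (!![1, 0; 0, Complex.I] : Matrix (Fin 2) (Fin 2) ℂ)ᴴ * P.mat * !![1, 0; 0, Complex.I] =
      (((if P = .X then -1 else 1 : ℝ)) : ℂ) • P.phaseGate.mat := by
  cases P <;> ext i j <;> fin_cases i <;> fin_cases j <;>
    simp [Pauli.mat, Pauli.phaseGate, Matrix.mul_apply, Fin.sum_univ_two]

/-- A CNOT gate permutes the computational basis by `(x, y) ↦ (x, x + y)`, so conjugation by it only
reindexes matrix entries, and the rule becomes a finite check. -/
theorem cnot_mat (P Q : Pauli) (x y u v : Fin 2) :
    P.mat x u * Q.mat (x + y) (u + v) =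
      ((if (P = .X ∧ Q = .Z) ∨ (P = .Y ∧ Q = .Y) then -1 else 1 : ℝ) : ℂ) *
        ((P.cnotControl Q).mat x u * (P.cnotTarget Q).mat y v) := by
  cases P <;> cases Q <;> simp only [Pauli.cnotControl, Pauli.cnotTarget] <;>
    fin_cases x <;> fin_cases y <;> fin_cases u <;> fin_cases v <;>
    simp [Pauli.mat, Pauli.mul, Matrix.one_apply]

theorem Clifford.conj_op (V : Clifford n) (w : Word n) :
    V.opᴴ * w.op * V.op = (V.sign w : ℂ) • (V.act w).op := by
  cases V with
  | H a =>
    have hs : (Clifford.H a).sign w = if w a = .Y then -1 else 1 := by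
      simp only [Clifford.sign, Clifford.Flips]
      split_ifs with hf <;> simp [hf]
    rw [hs]
    exact tensor_update_conj a _ w _ _ (hadamard_conj (w a))
  | S a =>
    have hs : (Clifford.S a).sign w = if w a = .X then -1 else 1 := by
      simp only [Clifford.sign, Clifford.Flips]
      split_ifs with hf <;> simp [hf]
    rw [hs]
    exact tensor_update_conj a _ w _ _ (phaseGate_conj (w a))
  | CNOT a b hab =>
    ext x y
    have h1 : ((Clifford.CNOT a b hab).opᴴ * w.op * (Clifford.CNOT a b hab).op) x y =
        w.op (Function.update x b (x a + x b)) (Function.update y b (y a + y b)) := by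
      simp only [Clifford.op, Matrix.mul_apply, Matrix.conjTranspose_apply, Matrix.of_apply]
      rw [Finset.sum_eq_single (Function.update y b (y a + y b))]
      · rw [Finset.sum_eq_single (Function.update x b (x a + x b))]
        · simp
        · intro z _ hz
          simp [hz]
        · simp
      · intro z _ hz
        simp [hz]
      · simp
    rw [h1]
    simp only [Word.op, tensor, Matrix.smul_apply, Matrix.of_apply, smul_eq_mul]
    have hb : b ∈ Finset.univ.erase a := by simp [hab.symm]
    rw [← Finset.mul_prod_erase _ _ (Finset.mem_univ a), ← Finset.mul_prod_erase _ _ hb,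
      ← Finset.mul_prod_erase (Finset.univ : Finset (Fin n)) (fun q =>
        ((Clifford.CNOT a b hab).act w q).mat (x q) (y q)) (Finset.mem_univ a),
      ← Finset.mul_prod_erase _ (fun q =>
        ((Clifford.CNOT a b hab).act w q).mat (x q) (y q)) hb]
    have hr : ∏ q ∈ (Finset.univ.erase a).erase b,
        (w q).mat ((Function.update x b (x a + x b) : Basis n) q)
          ((Function.update y b (y a + y b) : Basis n) q) =
        ∏ q ∈ (Finset.univ.erase a).erase b,
          ((Clifford.CNOT a b hab).act w q).mat (x q) (y q) := by
      refine Finset.prod_congr rfl fun q hq => ?_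
      have hqb : q ≠ b := by simp at hq; exact hq.1
      have hqa : q ≠ a := by simp at hq; exact hq.2
      simp [Clifford.act, Function.update_of_ne hqb, Function.update_of_ne hqa]
    rw [hr]
    have key := cnot_mat (w a) (w b) (x a) (x b) (y a) (y b)
    simp only [Clifford.act, Function.update_self, Function.update_of_ne hab,
      Function.update_of_ne hab.symm, Clifford.sign, Clifford.Flips]
    rw [← mul_assoc, key]
    simp only [mul_assoc]
    congr 2
    split_ifs with hf <;> simp [hf]

theorem Clifford.op_mul_conjTranspose (V : Clifford n) : V.op * V.opᴴ = 1 := by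
  have h1 : V.opᴴ * V.op = 1 := by
    -- Unitarity is the conjugation rule applied to the identity word.
    have h := V.conj_op (fun _ => .I)
    rw [Word.op_one, mul_one] at h
    rw [h]
    have h2 : V.act (fun _ => .I) = fun _ => .I := by
      cases V <;> simp [Clifford.act, Pauli.hadamard, Pauli.phaseGate, Pauli.cnotControl,
        Pauli.cnotTarget]
    have h3 : ¬ V.Flips (fun _ => .I) := by
      cases V <;> simp [Clifford.Flips]
    rw [h2, Word.op_one, Clifford.sign, if_neg h3]
    simp
  exact mul_eq_one_comm.mp h1

/-- Conjugation is multiplicative, so up to phases it is a homomorphism on words. Hence the product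
of two propagated words is transformed by the same gate. -/
theorem Clifford.act_mul (V : Clifford n) (v w : Word n) :
    V.act (v.mul w) = (V.act v).mul (V.act w) := by
  have hH : ∀ P Q : Pauli, (P.mul Q).hadamard = P.hadamard.mul Q.hadamard := by
    intro P Q; cases P <;> cases Q <;> rfl
  have hS : ∀ P Q : Pauli, (P.mul Q).phaseGate = P.phaseGate.mul Q.phaseGate := by
    intro P Q; cases P <;> cases Q <;> rfl
  have hc : ∀ P Q P' Q' : Pauli, (P.mul Q).cnotControl (P'.mul Q') =
      (P.cnotControl P').mul (Q.cnotControl Q') := by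
    intro P Q P' Q'; cases P <;> cases Q <;> cases P' <;> cases Q' <;> rfl
  have ht : ∀ P Q P' Q' : Pauli, (P.mul Q).cnotTarget (P'.mul Q') =
      (P.cnotTarget P').mul (Q.cnotTarget Q') := by
    intro P Q P' Q'; cases P <;> cases Q <;> cases P' <;> cases Q' <;> rfl
  cases V with
  | H a =>
    funext q
    by_cases hq : q = a
    · subst hq; simp [Clifford.act, Word.mul, hH]
    · simp [Clifford.act, Word.mul, Function.update_of_ne hq]
  | S a =>
    funext q
    by_cases hq : q = a
    · subst hq; simp [Clifford.act, Word.mul, hS]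
    · simp [Clifford.act, Word.mul, Function.update_of_ne hq]
  | CNOT a b hab =>
    funext q
    by_cases hq : q = a
    · subst hq; simp [Clifford.act, Word.mul, hc]
    · by_cases hb : q = b
      · subst hb; simp [Clifford.act, Word.mul, Function.update_of_ne hq, ht]
      · simp [Clifford.act, Word.mul, Function.update_of_ne hq, Function.update_of_ne hb]

/-- A Clifford gate fixes the words that are trivial on its qubits. -/
theorem Clifford.conj_op_of_disjoint (V : Clifford n) (σ : Word n) (h : Disjoint σ.supp V.supp) :
    V.opᴴ * σ.op * V.op = σ.op := by
  have hI : ∀ a ∈ V.supp, σ a = .I := by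
    intro a ha
    by_contra hne
    exact Finset.disjoint_left.mp h (by simp [Word.supp, hne]) ha
  rw [Clifford.conj_op]
  have h2 : V.act σ = σ := by
    cases V with
    | H a =>
      have ha : σ a = .I := hI a (by simp [Clifford.supp])
      simp [Clifford.act, ha, Pauli.hadamard, Function.update_eq_self_iff]
    | S a =>
      have ha : σ a = .I := hI a (by simp [Clifford.supp])
      simp [Clifford.act, ha, Pauli.phaseGate, Function.update_eq_self_iff]
    | CNOT a b hab =>
      have ha : σ a = .I := hI a (by simp [Clifford.supp])
      have hb : σ b = .I := hI b (by simp [Clifford.supp])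
      have hu : Function.update σ b Pauli.I = σ := by rw [← hb, Function.update_eq_self]
      simp only [Clifford.act, ha, hb, Pauli.cnotControl, Pauli.cnotTarget, reduceCtorEq,
        or_self, if_false, hu]
      rw [← ha, Function.update_eq_self]
  have h3 : ¬ V.Flips σ := by
    cases V <;> simp_all [Clifford.Flips, Clifford.supp]
  rw [h2, Clifford.sign, if_neg h3]
  simp

end NoisyVQA
end

/-! ### Expansion of the noisy and the truncated cost over Pauli paths. -/

noncomputable section
namespace NoisyVQA

variable {n L : ℕ} {P : Type}

/-! ### Propagation of Pauli words in the Heisenberg picture -/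

/-- Elementary steps of a noisy circuit, read from the observable to the input state. -/
inductive Step (n : ℕ) (P : Type) where
  | rot (p : P) (σ : Word n)
  | cliff (V : Clifford n)
  | noise

/-- The expectation value of a Pauli word that is propagated backwards through a list of steps.
The noise is accounted for by a function `χ` of the accumulated weight `W`, and `g` holds the
expectation values in the input state. -/
def propagate (χ : ℕ → ℝ) (g : Word n → ℝ) (θ : P → ℝ) :
    List (Step n P) → Word n → ℕ → ℝ
  | [], w, W => χ W * g w
  | .rot p σ :: l, w, W =>
    if σ.Anti w then Real.cos (θ p) * propagate χ g θ l w W +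
      Real.sin (θ p) * (σ.rotSign w * propagate χ g θ l (σ.mul w) W)
    else propagate χ g θ l w W
  | .cliff V :: l, w, W => V.sign w * propagate χ g θ l (V.act w) W
  | .noise :: l, w, W => propagate χ g θ l w (W + w.weight)

/-- The unitary of a gate. -/
def Step.op (θ : P → ℝ) : Step n P → Op n
  | .rot p σ => rotation (θ p) σ
  | .cliff V => V.op
  | .noise => 1

/-- Expanding `O` in Pauli words composes the transition amplitudes of two successive conjugations.
-/
theorem sum_mul_pauliCoeff_conj (F : Word n → ℂ) (A O : Op n) :
    ∑ v, (∑ u, F u * pauliCoeff u (Aᴴ * v.op * A)) * pauliCoeff v O =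
      ∑ u, F u * pauliCoeff u (Aᴴ * O * A) := by
  conv_rhs => rw [← sum_pauliCoeff_smul_op O]
  simp only [Finset.mul_sum, Finset.sum_mul, pauliCoeff_sum, pauliCoeff_smul, Matrix.mul_smul,
    Matrix.smul_mul]
  rw [Finset.sum_comm]
  refine Finset.sum_congr rfl fun u _ => Finset.sum_congr rfl fun v _ => ?_
  ring

/-- Without noise the collected weight stays constant, so a block of gates acts linearly, by
conjugation with the product of its unitaries. -/
theorem propagate_append (χ : ℕ → ℝ) (g : Word n → ℝ) (θ : P → ℝ) (rest l : List (Step n P))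
    (hl : Step.noise ∉ l) (w : Word n) (W : ℕ) :
    (propagate χ g θ (l ++ rest) w W : ℂ) = ∑ v, (propagate χ g θ rest v W : ℂ) *
      pauliCoeff v (((l.map (Step.op θ)).prod)ᴴ * w.op * (l.map (Step.op θ)).prod) := by
  induction l generalizing w with
  | nil =>
    simp only [List.nil_append, List.map_nil, List.prod_nil, Matrix.conjTranspose_one, one_mul,
      mul_one, pauliCoeff_op]
    simp
  | cons s l ih =>
    have ih' := fun w => ih (fun h => hl (List.mem_cons_of_mem _ h)) w
    set A := (l.map (Step.op θ)).prod with hA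
    have key : ∀ O : Op n, (s.op θ)ᴴ * w.op * s.op θ = O →
        ∑ v, (propagate χ g θ rest v W : ℂ) * pauliCoeff v (((List.map (Step.op θ) (s :: l)).prod)ᴴ *
          w.op * (List.map (Step.op θ) (s :: l)).prod) =
        ∑ v, (propagate χ g θ (l ++ rest) v W : ℂ) * pauliCoeff v O := by
      intro O hO
      simp only [ih', List.map_cons, List.prod_cons, Matrix.conjTranspose_mul, ← hA]
      rw [sum_mul_pauliCoeff_conj, ← hO]
      simp only [mul_assoc]
    have single : ∀ (c : ℂ) (u : Word n), ∑ v, (propagate χ g θ (l ++ rest) v W : ℂ) *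
        (c * pauliCoeff v u.op) = c * (propagate χ g θ (l ++ rest) u W : ℂ) := by
      intro c u
      simp [pauliCoeff_op, mul_comm]
    cases s with
    | rot p σ =>
      by_cases h : σ.Anti w
      · rw [key _ (rotation_conj_of_anti (θ p) h)]
        simp only [pauliCoeff_add, pauliCoeff_smul, mul_add, Finset.sum_add_distrib, single]
        rw [List.cons_append, propagate, if_pos h]
        push_cast
        ring
      · rw [key _ (rotation_conj_of_not_anti (θ p) h)]
        have h1 := single 1 w
        simp only [one_mul] at h1
        rw [h1, List.cons_append, propagate,
          if_neg h]
    | cliff V =>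
      rw [key _ (V.conj_op w)]
      simp only [pauliCoeff_smul, single]
      rw [List.cons_append, propagate]
      push_cast
      ring
    | noise => simp at hl

/-- The gates of a layer as a list of steps. -/
def Layer.gates (l : Layer n) (f : Fin l.R → P) : List (Step n P) :=
  (List.ofFn fun j => Step.rot (f j) (l.rot j)) ++ List.ofFn fun k => Step.cliff (l.cliff k)

theorem Layer.noise_notMem_gates (l : Layer n) (f : Fin l.R → P) : Step.noise ∉ l.gates f := by
  simp [Layer.gates, List.mem_ofFn]

theorem Layer.prod_gates (l : Layer n) (f : Fin l.R → P) (θ : P → ℝ) :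
    ((l.gates f).map (Step.op θ)).prod = l.op fun j => θ (f j) := by
  simp only [Layer.gates, List.map_append, List.map_ofFn, List.prod_append, Layer.op,
    Layer.cliffOp]
  rfl

/-- The steps of the first `m` layers, with noise before and after each of them. -/
def Circuit.steps (U : Circuit n L) : (m : ℕ) → m ≤ L → List (Step n U.Param)
  | 0, _ => [.noise]
  | m + 1, h => .noise :: ((U ⟨m, h⟩).gates (fun j => ⟨⟨m, h⟩, j⟩) ++
      U.steps m (Nat.le_of_succ_le h))

/-- The transition amplitudes of a layer between Pauli words. -/
def Circuit.amplitude (U : Circuit n L) (θ : U.Param → ℝ) (i : Fin L) (w v : Word n) : ℂ :=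
  pauliCoeff v ((U.layerOp θ i)ᴴ * w.op * U.layerOp θ i)

theorem propagate_steps_succ (χ : ℕ → ℝ) (g : Word n → ℝ) (U : Circuit n L) (θ : U.Param → ℝ)
    (m : ℕ) (h : m + 1 ≤ L) (w : Word n) (W : ℕ) :
    (propagate χ g θ (U.steps (m + 1) h) w W : ℂ) = ∑ v, U.amplitude θ ⟨m, h⟩ w v *
      (propagate χ g θ (U.steps m (Nat.le_of_succ_le h)) v (W + w.weight) : ℂ) := by
  rw [Circuit.steps, propagate, propagate_append _ _ _ _ _ (Layer.noise_notMem_gates _ _)]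
  refine Finset.sum_congr rfl fun v _ => ?_
  rw [Layer.prod_gates, mul_comm]
  rfl

/-- The expectation value of a Pauli word in the input state. -/
def InputState.expect (ρ : InputState n) (w : Word n) : ℝ := (w.op * ρ.op).trace.re

theorem InputState.op_posSemidef (ρ : InputState n) : ρ.op.PosSemidef := ρ.posSemidef

theorem InputState.ofReal_expect (ρ : InputState n) (w : Word n) :
    (ρ.expect w : ℂ) = (w.op * ρ.op).trace := by
  have h : star (w.op * ρ.op).trace = (w.op * ρ.op).trace := by
    rw [← Matrix.trace_conjTranspose, Matrix.conjTranspose_mul, Word.conjTranspose_op,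
      ρ.op_posSemidef.isHermitian, Matrix.trace_mul_comm]
  exact Complex.conj_eq_iff_re.mp h

theorem trace_mul_eq_sum_pauliCoeff (A B : Op n) :
    (A * B).trace = ∑ v, pauliCoeff v A * (v.op * B).trace := by
  conv_lhs => rw [← sum_pauliCoeff_smul_op A]
  simp [Finset.sum_mul, Matrix.trace_sum]

theorem trace_op_mul_noise (lam : ℝ) (w : Word n) (φ : Op n) :
    (w.op * noise lam φ).trace = ((1 - lam : ℝ) : ℂ) ^ w.weight * (w.op * φ).trace := by
  have h := pauliCoeff_noise lam w φ
  have h2 : (2 : ℂ) ^ n ≠ 0 := by positivity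
  simp only [pauliCoeff] at h
  field_simp at h
  exact h

/-- The state after the first `m` layers and the following noise. -/
def noisyState (lam : ℝ) (U : Circuit n L) (ρ : InputState n) (θ : U.Param → ℝ) (m : ℕ)
    (h : m ≤ L) : Op n :=
  Fin.foldl m (fun φ i => noise lam (U.layerOp θ (Fin.castLE h i) * φ *
    (U.layerOp θ (Fin.castLE h i))ᴴ)) (noise lam ρ.op)

theorem noisyState_succ (lam : ℝ) (U : Circuit n L) (ρ : InputState n) (θ : U.Param → ℝ) (m : ℕ)
    (h : m + 1 ≤ L) : noisyState lam U ρ θ (m + 1) h = noise lam (U.layerOp θ ⟨m, h⟩ *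
      noisyState lam U ρ θ m (Nat.le_of_succ_le h) * (U.layerOp θ ⟨m, h⟩)ᴴ) := by
  rw [noisyState, Fin.foldl_succ_last]
  rfl

/-- Heisenberg and Schrödinger pictures agree: the last layer is the head of the step list and the
outermost channel of the state. Moving the noise from the state to `w` produces the factor that
`propagate` records as weight. -/
theorem propagate_eq_trace (lam : ℝ) (U : Circuit n L) (ρ : InputState n) (θ : U.Param → ℝ)
    (m : ℕ) (h : m ≤ L) (w : Word n) (W : ℕ) :
    (propagate (fun k => (1 - lam) ^ k) ρ.expect θ (U.steps m h) w W : ℂ) =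
      ((1 - lam : ℝ) : ℂ) ^ W * (w.op * noisyState lam U ρ θ m h).trace := by
  induction m generalizing w W with
  | zero =>
    rw [noisyState, Fin.foldl_zero, trace_op_mul_noise, Circuit.steps, propagate, propagate,
      Complex.ofReal_mul, ρ.ofReal_expect, pow_add]
    push_cast
    ring
  | succ m ih =>
    rw [propagate_steps_succ]
    simp only [ih]
    rw [noisyState_succ, trace_op_mul_noise, ← mul_assoc w.op, ← mul_assoc w.op,
      Matrix.trace_mul_comm, ← mul_assoc, ← mul_assoc, trace_mul_eq_sum_pauliCoeff,
      Finset.mul_sum]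
    refine Finset.sum_congr rfl fun v _ => ?_
    rw [pow_add, Circuit.amplitude, Matrix.mul_assoc]
    ring

theorem pauliCoeff_hamiltonian (H : Hamiltonian n) (w : Word n) :
    pauliCoeff w H.op = ∑ k, if H.word k = w then (H.coeff k : ℂ) else 0 := by
  simp only [Hamiltonian.op, pauliCoeff_sum, pauliCoeff_smul, pauliCoeff_op, mul_ite, mul_one,
    mul_zero, eq_comm]

theorem sum_pauliCoeff_hamiltonian_mul (H : Hamiltonian n) (F : Word n → ℂ) :
    ∑ w, pauliCoeff w H.op * F w = ∑ k, (H.coeff k : ℂ) * F (H.word k) := by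
  simp only [pauliCoeff_hamiltonian, Finset.sum_mul]
  rw [Finset.sum_comm]
  refine Finset.sum_congr rfl fun k _ => ?_
  simp

theorem noisyCost_eq_sum (lam : ℝ) (U : Circuit n L) (H : Hamiltonian n) (ρ : InputState n)
    (θ : U.Param → ℝ) :
    noisyCost lam U H ρ θ = ((∑ k, H.coeff k *
      propagate (fun k => (1 - lam) ^ k) ρ.expect θ (U.steps L le_rfl) (H.word k) 0 : ℝ) : ℂ) := by
  push_cast
  simp only [propagate_eq_trace, pow_zero, one_mul]
  rw [← sum_pauliCoeff_hamiltonian_mul H (fun w => (w.op * noisyState lam U ρ θ L le_rfl).trace),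
    ← trace_mul_eq_sum_pauliCoeff]
  rfl

/-- A path is peeled from the word nearest to the observable. The amplitude of the peeled layer
becomes the new `h`, and the weight of the peeled word moves into `W`; this is why both are
arbitrary in the induction. -/
theorem sum_path (χ : ℕ → ℝ) (g : Word n → ℝ) (U : Circuit n L) (θ : U.Param → ℝ)
    (m : ℕ) (hm : m ≤ L) (h : Word n → ℂ) (W : ℕ) :
    ∑ s : Fin (m + 1) → Word n, h (s (Fin.last m)) * (χ (W + ∑ i, (s i).weight) : ℂ) *
      (∏ i : Fin m, U.amplitude θ (Fin.castLE hm i) (s i.succ) (s i.castSucc)) * (g (s 0) : ℂ) =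
    ∑ w, h w * (propagate χ g θ (U.steps m hm) w W : ℂ) := by
  induction m generalizing h W with
  | zero =>
    rw [← (Equiv.funUnique (Fin 1) (Word n)).symm.sum_comp]
    refine Finset.sum_congr rfl fun w _ => ?_
    simp [Circuit.steps, propagate, mul_assoc]
  | succ m ih =>
    rw [← (Fin.snocEquiv fun _ : Fin (m + 2) => Word n).sum_comp, Fintype.sum_prod_type]
    refine Finset.sum_congr rfl fun w _ => ?_
    rw [propagate_steps_succ, ← ih (Nat.le_of_succ_le hm) (U.amplitude θ ⟨m, hm⟩ w) (W + w.weight),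
      Finset.mul_sum]
    refine Finset.sum_congr rfl fun s _ => ?_
    rw [Fin.prod_univ_castSucc, Fin.sum_univ_castSucc]
    simp only [Fin.snocEquiv, Equiv.coe_fn_mk, Fin.snoc_last, Fin.snoc_castSucc,
      Fin.succ_last, ← Fin.castSucc_succ, Fin.castLE_castSucc]
    have h0 : (Fin.snoc s w : Fin (m + 2) → Word n) 0 = s 0 := by
      rw [← Fin.castSucc_zero, Fin.snoc_castSucc]
    have h1 : Fin.castLE hm (Fin.last m) = ⟨m, hm⟩ := rfl
    have h2 : W + (∑ i, (s i).weight + w.weight) = W + w.weight + ∑ i, (s i).weight := by ring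
    rw [h0, h1, h2]
    ring

/-- The normalizations pair up: two factors `2 ^ (-n/2)` in each transition trace, and one in each
of the two boundary traces. Every pair is the `2 ^ (-n)` of a Pauli coefficient. -/
theorem noisyContribution_eq (lam : ℝ) (U : Circuit n L) (H : Hamiltonian n) (ρ : InputState n)
    (θ : U.Param → ℝ) (s : Path n L) :
    noisyContribution lam U H ρ θ s = pauliCoeff (s (Fin.last L)) H.op *
      ((1 - lam : ℝ) : ℂ) ^ s.weight *
      (∏ i : Fin L, U.amplitude θ i (s i.succ) (s i.castSucc)) * (ρ.expect (s 0) : ℂ) := by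
  have hc : (((1 / Real.sqrt 2 : ℝ) : ℂ) ^ n) * (((1 / Real.sqrt 2 : ℝ) : ℂ) ^ n) =
      1 / 2 ^ n := by
    rw [← mul_pow, ← Complex.ofReal_mul, div_mul_div_comm, Real.mul_self_sqrt (by norm_num)]
    push_cast
    rw [div_pow]
    norm_num
  rw [noisyContribution]
  simp only [Word.normOp_eq, noise_smul, noise_op, Matrix.smul_mul, Matrix.mul_smul,
    Matrix.trace_smul, smul_eq_mul]
  generalize ((1 / Real.sqrt 2 : ℝ) : ℂ) ^ n = c at hc
  have hp : ∀ i : Fin L, c * (((1 - lam : ℝ) : ℂ) ^ (s i.castSucc).weight *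
      (c * ((s i.succ).op * U.layerOp θ i * (s i.castSucc).op * (U.layerOp θ i)ᴴ).trace)) =
      ((1 - lam : ℝ) : ℂ) ^ (s i.castSucc).weight *
        U.amplitude θ i (s i.succ) (s i.castSucc) := by
    intro i
    have ht : ((s i.succ).op * U.layerOp θ i * (s i.castSucc).op * (U.layerOp θ i)ᴴ).trace =
        ((s i.castSucc).op * ((U.layerOp θ i)ᴴ * (s i.succ).op * U.layerOp θ i)).trace := by
      rw [Matrix.trace_mul_comm, Matrix.trace_mul_comm (s i.castSucc).op]
      simp only [mul_assoc]
    rw [ht, Circuit.amplitude, pauliCoeff]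
    linear_combination (((1 - lam : ℝ) : ℂ) ^ (s i.castSucc).weight * ((s i.castSucc).op *
      ((U.layerOp θ i)ᴴ * (s i.succ).op * U.layerOp θ i)).trace) * hc
  simp only [hp, Finset.prod_mul_distrib, Finset.prod_pow_eq_pow_sum]
  rw [Path.weight, Fin.sum_univ_castSucc, pow_add, ρ.ofReal_expect, pauliCoeff,
    Matrix.trace_mul_comm H.op]
  linear_combination (((1 - lam : ℝ) : ℂ) ^ (s (Fin.last L)).weight *
    ((s (Fin.last L)).op * H.op).trace * ((1 - lam : ℝ) : ℂ) ^
      (∑ i : Fin L, (s i.castSucc).weight) *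
    (∏ i : Fin L, U.amplitude θ i (s i.succ) (s i.castSucc)) * ((s 0).op * ρ.op).trace) * hc

/-- Damping of Pauli paths by the noise, with a cutoff at weight `M`. -/
def cutoff (lam : ℝ) (M k : ℕ) : ℝ := if k ≤ M then (1 - lam) ^ k else 0

theorem truncatedCost_eq_sum (lam : ℝ) (U : Circuit n L) (H : Hamiltonian n) (ρ : InputState n)
    (M : ℕ) (θ : U.Param → ℝ) :
    truncatedCost lam U H ρ M θ = ((∑ k, H.coeff k *
      propagate (cutoff lam M) ρ.expect θ (U.steps L le_rfl) (H.word k) 0 : ℝ) : ℂ) := by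
  push_cast
  rw [← sum_pauliCoeff_hamiltonian_mul H
    (fun w => (propagate (cutoff lam M) ρ.expect θ (U.steps L le_rfl) w 0 : ℂ)), ← sum_path, truncatedCost, Finset.sum_filter]
  refine Finset.sum_congr rfl fun s _ => ?_
  rw [noisyContribution_eq, zero_add, cutoff, Path.weight]
  split_ifs <;> simp

end NoisyVQA
end

/-! ### The mean square error: orthogonality of propagated words and the generation hypothesis. -/

noncomputable section
namespace NoisyVQA

variable {n L : ℕ} {P : Type}

/-! ### Averages over the angles -/

open MeasureTheory ProbabilityTheory

/-- The uniform distribution on `[-π, π]`. -/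
def angleMeasure : Measure ℝ := cond volume (Set.Icc (-Real.pi) Real.pi)

theorem volume_Icc_pi : volume (Set.Icc (-Real.pi) Real.pi) = ENNReal.ofReal (2 * Real.pi) := by
  rw [Real.volume_Icc]
  congr 1
  ring

instance : IsProbabilityMeasure angleMeasure := by
  refine cond_isProbabilityMeasure_of_finite ?_ ?_
  · rw [volume_Icc_pi]
    simp [Real.pi_pos]
  · rw [volume_Icc_pi]
    exact ENNReal.ofReal_ne_top

theorem integral_angleMeasure (f : ℝ → ℝ) :
    ∫ x, f x ∂angleMeasure = (2 * Real.pi)⁻¹ * ∫ x in (-Real.pi)..Real.pi, f x := by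
  rw [angleMeasure, ProbabilityTheory.cond, integral_smul_measure, volume_Icc_pi,
    intervalIntegral.integral_of_le (by linarith [Real.pi_pos]), integral_Icc_eq_integral_Ioc,
    smul_eq_mul, ENNReal.toReal_inv, ENNReal.toReal_ofReal (by positivity)]

theorem integral_cos_angleMeasure : ∫ x, Real.cos x ∂angleMeasure = 0 := by
  simp [integral_angleMeasure]

theorem integral_sin_angleMeasure : ∫ x, Real.sin x ∂angleMeasure = 0 := by
  simp [integral_angleMeasure]

theorem integral_cos_sq_angleMeasure : ∫ x, Real.cos x ^ 2 ∂angleMeasure = 1 / 2 := by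
  have := Real.pi_pos.ne'
  rw [integral_angleMeasure, integral_cos_sq]
  simp
  field_simp

theorem integral_sin_sq_angleMeasure : ∫ x, Real.sin x ^ 2 ∂angleMeasure = 1 / 2 := by
  have := Real.pi_pos.ne'
  rw [integral_angleMeasure, integral_sin_sq]
  simp
  field_simp

theorem integral_sin_mul_cos_angleMeasure :
    ∫ x, Real.sin x * Real.cos x ∂angleMeasure = 0 := by
  rw [integral_angleMeasure, integral_sin_mul_cos₁]
  simp

/-- Continuous bounded functions of the angles. -/
def Mild (G : (P → ℝ) → ℝ) : Prop := Continuous G ∧ ∃ C, ∀ θ, |G θ| ≤ C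

theorem Mild.mul {G G' : (P → ℝ) → ℝ} (h : Mild G) (h' : Mild G') :
    Mild fun θ => G θ * G' θ := by
  obtain ⟨hc, C, hC⟩ := h
  obtain ⟨hc', C', hC'⟩ := h'
  refine ⟨hc.mul hc', C * C', fun θ => ?_⟩
  rw [abs_mul]
  exact mul_le_mul (hC θ) (hC' θ) (abs_nonneg _) ((abs_nonneg _).trans (hC θ))

theorem Mild.add {G G' : (P → ℝ) → ℝ} (h : Mild G) (h' : Mild G') :
    Mild fun θ => G θ + G' θ := by
  obtain ⟨hc, C, hC⟩ := h
  obtain ⟨hc', C', hC'⟩ := h'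
  exact ⟨hc.add hc', C + C', fun θ => (abs_add_le _ _).trans (add_le_add (hC θ) (hC' θ))⟩

theorem mild_const (c : ℝ) : Mild fun _ : P → ℝ => c := ⟨continuous_const, |c|, fun _ => le_rfl⟩

theorem mild_cos (p : P) : Mild fun θ : P → ℝ => Real.cos (θ p) :=
  ⟨Real.continuous_cos.comp (continuous_apply p), 1, fun _ => Real.abs_cos_le_one _⟩

theorem mild_sin (p : P) : Mild fun θ : P → ℝ => Real.sin (θ p) :=
  ⟨Real.continuous_sin.comp (continuous_apply p), 1, fun _ => Real.abs_sin_le_one _⟩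

theorem Mild.sum {ι : Type*} (s : Finset ι) {G : ι → (P → ℝ) → ℝ} (h : ∀ i, Mild (G i)) :
    Mild fun θ => ∑ i ∈ s, G i θ := by
  classical
  induction s using Finset.induction_on with
  | empty => simpa using mild_const 0
  | insert i s hi ih => simpa [Finset.sum_insert hi] using (h i).add ih

section Average

variable [Fintype P]

theorem Mild.integrable {G : (P → ℝ) → ℝ} (h : Mild G) :
    Integrable G (Measure.pi fun _ => angleMeasure) := by
  obtain ⟨hc, C, hC⟩ := h
  exact Integrable.of_bound hc.aestronglyMeasurable C (Filter.Eventually.of_forall hC)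

variable [DecidableEq P]

theorem integral_mul_of_update_eq (p : P) {f : ℝ → ℝ} (hf : Continuous f) {G : (P → ℝ) → ℝ}
    (hG : Continuous G) (hp : ∀ θ x, G (Function.update θ p x) = G θ) :
    ∫ θ, f (θ p) * G θ ∂(Measure.pi fun _ => angleMeasure) =
      (∫ x, f x ∂angleMeasure) * ∫ θ, G θ ∂(Measure.pi fun _ => angleMeasure) := by
  have hind : iIndepFun (fun (i : P) (θ : P → ℝ) => θ i) (Measure.pi fun _ => angleMeasure) :=
    iIndepFun_pi (X := fun _ x => x) fun _ => aemeasurable_id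
  have h2 := hind.indepFun_finset {p} (Finset.univ.erase p) (by simp) fun i => measurable_pi_apply i
  let φ : (({p} : Finset P) → ℝ) → ℝ := fun y => f (y ⟨p, by simp⟩)
  -- `G` as a function of the other coordinates, with the `p`-th one set to `0`; by `hp` nothing is
  -- lost. Independence of coordinates then factors the integral.
  let ψ : (↥(Finset.univ.erase p) → ℝ) → ℝ := fun y =>
    G fun i => if h : i ∈ Finset.univ.erase p then y ⟨i, h⟩ else 0
  have hφ : Measurable φ := (hf.comp (continuous_apply _)).measurable
  have hψ : Measurable ψ := by
    refine (hG.comp (continuous_pi fun i => ?_)).measurable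
    by_cases h : i ∈ Finset.univ.erase p
    · simp only [h, dif_pos]
      exact continuous_apply _
    · simp only [h, dif_neg, not_false_eq_true]
      exact continuous_const
  have h3 := h2.comp hφ hψ
  have e2 : (ψ ∘ fun (a : P → ℝ) (i : ↥(Finset.univ.erase p)) => a i) = G := by
    funext θ
    rw [← hp θ 0]
    simp only [ψ, Function.comp_apply]
    congr 1
    funext i
    by_cases h : i = p
    · subst h; simp
    · simp [h]
  rw [e2] at h3
  have h4 := h3.integral_fun_mul_eq_mul_integral
    ((hf.comp (continuous_apply p)).aestronglyMeasurable) hG.aestronglyMeasurable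
  have h5 : ∫ θ : P → ℝ, f (θ p) ∂(Measure.pi fun _ => angleMeasure) = ∫ x, f x ∂angleMeasure :=
    integral_comp_eval (μ := fun _ : P => angleMeasure) hf.aestronglyMeasurable
  rw [← h5]
  exact h4

/-- The average of a product of two functions that depend on one angle through a rotation. -/
theorem integral_rot_mul_rot (p : P) {A B A' B' : (P → ℝ) → ℝ} (hA : Mild A) (hB : Mild B)
    (hA' : Mild A') (hB' : Mild B') (iA : ∀ θ x, A (Function.update θ p x) = A θ)
    (iB : ∀ θ x, B (Function.update θ p x) = B θ) (iA' : ∀ θ x, A' (Function.update θ p x) = A' θ)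
    (iB' : ∀ θ x, B' (Function.update θ p x) = B' θ) :
    ∫ θ, (Real.cos (θ p) * A θ + Real.sin (θ p) * B θ) *
        (Real.cos (θ p) * A' θ + Real.sin (θ p) * B' θ) ∂(Measure.pi fun _ => angleMeasure) =
      (∫ θ, A θ * A' θ ∂(Measure.pi fun _ => angleMeasure) +
        ∫ θ, B θ * B' θ ∂(Measure.pi fun _ => angleMeasure)) / 2 := by
  have key : ∀ θ : P → ℝ, (Real.cos (θ p) * A θ + Real.sin (θ p) * B θ) *
        (Real.cos (θ p) * A' θ + Real.sin (θ p) * B' θ) =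
      Real.cos (θ p) ^ 2 * (A θ * A' θ) + (Real.sin (θ p) ^ 2 * (B θ * B' θ) +
        (Real.sin (θ p) * Real.cos (θ p)) * (A θ * B' θ + B θ * A' θ)) := fun θ => by ring
  simp only [key]
  have m1 : Mild fun θ : P → ℝ => Real.cos (θ p) ^ 2 * (A θ * A' θ) := by
    simpa only [pow_two] using ((mild_cos p).mul (mild_cos p)).mul (hA.mul hA')
  have m2 : Mild fun θ : P → ℝ => Real.sin (θ p) ^ 2 * (B θ * B' θ) := by
    simpa only [pow_two] using ((mild_sin p).mul (mild_sin p)).mul (hB.mul hB')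
  have m3 : Mild fun θ : P → ℝ => (Real.sin (θ p) * Real.cos (θ p)) * (A θ * B' θ + B θ * A' θ) :=
    ((mild_sin p).mul (mild_cos p)).mul ((hA.mul hB').add (hB.mul hA'))
  rw [integral_add m1.integrable (m2.add m3).integrable,
    integral_add m2.integrable m3.integrable,
    integral_mul_of_update_eq p (f := fun x => Real.cos x ^ 2) (by fun_prop) (hA.mul hA').1
      (fun θ x => by rw [iA, iA']),
    integral_mul_of_update_eq p (f := fun x => Real.sin x ^ 2) (by fun_prop) (hB.mul hB').1
      (fun θ x => by rw [iB, iB']),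
    integral_mul_of_update_eq p (f := fun x => Real.sin x * Real.cos x) (by fun_prop)
      ((hA.mul hB').add (hB.mul hA')).1 (fun θ x => by rw [iA, iA', iB, iB']),
    integral_cos_sq_angleMeasure, integral_sin_sq_angleMeasure, integral_sin_mul_cos_angleMeasure]
  ring

theorem integral_rot_mul (p : P) {A B A' : (P → ℝ) → ℝ} (hA : Mild A) (hB : Mild B)
    (hA' : Mild A') (iA : ∀ θ x, A (Function.update θ p x) = A θ)
    (iB : ∀ θ x, B (Function.update θ p x) = B θ) (iA' : ∀ θ x, A' (Function.update θ p x) = A' θ) :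
    ∫ θ, (Real.cos (θ p) * A θ + Real.sin (θ p) * B θ) * A' θ
      ∂(Measure.pi fun _ => angleMeasure) = 0 := by
  have key : ∀ θ : P → ℝ, (Real.cos (θ p) * A θ + Real.sin (θ p) * B θ) * A' θ =
      Real.cos (θ p) * (A θ * A' θ) + Real.sin (θ p) * (B θ * A' θ) := fun θ => by ring
  simp only [key]
  rw [integral_add ((mild_cos p).mul (hA.mul hA')).integrable
      ((mild_sin p).mul (hB.mul hA')).integrable,
    integral_mul_of_update_eq p (f := Real.cos) (by fun_prop) (hA.mul hA').1
      (fun θ x => by rw [iA, iA']),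
    integral_mul_of_update_eq p (f := Real.sin) (by fun_prop) (hB.mul hA').1
      (fun θ x => by rw [iB, iA']),
    integral_cos_angleMeasure, integral_sin_angleMeasure]
  ring

end Average

/-! ### Second moments of propagated Pauli words -/

/-- The parameters that occur in a list of steps. -/
def stepParams : List (Step n P) → List P
  | [] => []
  | .rot p _ :: l => p :: stepParams l
  | .cliff _ :: l => stepParams l
  | .noise :: l => stepParams l

theorem mild_propagate (χ : ℕ → ℝ) (g : Word n → ℝ) (l : List (Step n P)) (w : Word n) (W : ℕ) :
    Mild fun θ => propagate χ g θ l w W := by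
  induction l generalizing w W with
  | nil => exact mild_const _
  | cons s l ih =>
    cases s with
    | rot p σ =>
      simp only [propagate]
      split_ifs
      · exact ((mild_cos p).mul (ih _ _)).add ((mild_sin p).mul ((mild_const _).mul (ih _ _)))
      · exact ih _ _
    | cliff V => exact (mild_const _).mul (ih _ _)
    | noise => exact ih _ _

theorem propagate_update [DecidableEq P] (χ : ℕ → ℝ) (g : Word n → ℝ) (l : List (Step n P)) (p : P)
    (hp : p ∉ stepParams l) (θ : P → ℝ) (x : ℝ) (w : Word n) (W : ℕ) :
    propagate χ g (Function.update θ p x) l w W = propagate χ g θ l w W := by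
  induction l generalizing w W with
  | nil => rfl
  | cons s l ih =>
    cases s with
    | rot p' σ =>
      simp only [stepParams, List.mem_cons, not_or] at hp
      simp only [propagate, ih hp.2, Function.update_of_ne (Ne.symm hp.1)]
    | cliff V => simp only [propagate, ih hp]
    | noise => simp only [propagate, ih hp]

theorem Word.rotSign_mul_self (σ w : Word n) : σ.rotSign w * σ.rotSign w = 1 := by
  unfold Word.rotSign
  split_ifs <;> norm_num

theorem Clifford.sign_mul_self (V : Clifford n) (w : Word n) : V.sign w * V.sign w = 1 := by
  unfold Clifford.sign
  split_ifs <;> norm_num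

/-- A word commutes with all rotations that it meets on its way through a list of steps. -/
def CommutesAlong : List (Step n P) → Word n → Prop
  | [], _ => True
  | .rot _ σ :: l, r => ¬ σ.Anti r ∧ CommutesAlong l r
  | .cliff V :: l, r => CommutesAlong l (V.act r)
  | .noise :: l, r => CommutesAlong l r

section Moments

variable [Fintype P]

/-- If a rotation anticommutes with exactly one of the two words, its angle enters through a single
cosine or sine, which has mean zero. If it anticommutes with both, the mixed terms average out, and
`(w, v)` and `(σw, σv)` have the same product. So the product word travels unbranched until it meets
a rotation with which it anticommutes. -/
theorem integral_propagate_mul_eq_zero (χ : ℕ → ℝ) (g : Word n → ℝ) (l : List (Step n P))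
    (hl : (stepParams l).Nodup) (w v : Word n) (W W' : ℕ) (h : ¬ CommutesAlong l (w.mul v)) :
    ∫ θ, propagate χ g θ l w W * propagate χ g θ l v W'
      ∂(Measure.pi fun _ => angleMeasure) = 0 := by
  classical
  induction l generalizing w v W W' with
  | nil => exact absurd trivial h
  | cons s l ih =>
    cases s with
    | rot p σ =>
      simp only [stepParams, List.nodup_cons] at hl
      have upd := propagate_update χ g l p hl.1
      have mild := mild_propagate χ g l
      have ms : ∀ (c : ℝ) (u : Word n) (W : ℕ), Mild fun θ => c * propagate χ g θ l u W :=
        fun c u W => (mild_const c).mul (mild u W)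
      simp only [CommutesAlong, Word.anti_mul_iff, not_and] at h
      by_cases hw : σ.Anti w <;> by_cases hv : σ.Anti v <;>
        simp only [propagate, hw, hv, if_true, if_false]
      · rw [integral_rot_mul_rot p (mild _ _) (ms _ _ _) (mild _ _) (ms _ _ _)
          (fun θ x => upd _ _ _ _) (fun θ x => by rw [upd]) (fun θ x => upd _ _ _ _)
          (fun θ x => by rw [upd])]
        -- The rotation commutes with the product of the two words, so the obstruction occurs later
        -- in the list.
        have h' := h (by simp [hw, hv])
        rw [ih hl.2 _ _ _ _ h']
        have e : ∀ θ : P → ℝ, σ.rotSign w * propagate χ g θ l (σ.mul w) W *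
            (σ.rotSign v * propagate χ g θ l (σ.mul v) W') =
            (σ.rotSign w * σ.rotSign v) * (propagate χ g θ l (σ.mul w) W *
              propagate χ g θ l (σ.mul v) W') := fun θ => by ring
        simp only [e]
        rw [integral_const_mul, ih hl.2 _ _ _ _ (by rwa [Word.mul_mul_mul_cancel])]
        simp
      · exact integral_rot_mul p (mild _ _) (ms _ _ _) (mild _ _)
          (fun θ x => upd _ _ _ _) (fun θ x => by rw [upd]) (fun θ x => upd _ _ _ _)
      · simp only [mul_comm (propagate χ g _ l w W)]
        exact integral_rot_mul p (mild _ _) (ms _ _ _) (mild _ _)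
          (fun θ x => upd _ _ _ _) (fun θ x => by rw [upd]) (fun θ x => upd _ _ _ _)
      · exact ih hl.2 _ _ _ _ (h (by simp [hw, hv]))
    | cliff V =>
      rw [CommutesAlong, Clifford.act_mul] at h
      have e : ∀ θ : P → ℝ, V.sign w * propagate χ g θ l (V.act w) W *
            (V.sign v * propagate χ g θ l (V.act v) W') =
            (V.sign w * V.sign v) * (propagate χ g θ l (V.act w) W *
              propagate χ g θ l (V.act v) W') := fun θ => by ring
      simp only [propagate, e]
      rw [integral_const_mul, ih hl _ _ _ _ h, mul_zero]
    | noise => exact ih hl _ _ _ _ h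

/-- At a branching the second moment is the average of those of the two branches, so a uniform bound
at the leaves survives regardless of how many branchings there are. -/
theorem integral_propagate_sq_le (χ : ℕ → ℝ) (g : Word n → ℝ) {δ : ℝ} (hχ : ∀ k, |χ k| ≤ δ)
    (hg : ∀ w, |g w| ≤ 1) (l : List (Step n P)) (hl : (stepParams l).Nodup) (w : Word n) (W : ℕ) :
    ∫ θ, propagate χ g θ l w W * propagate χ g θ l w W ∂(Measure.pi fun _ => angleMeasure) ≤
      δ ^ 2 := by
  classical
  induction l generalizing w W with
  | nil =>
    simp only [propagate, integral_const, probReal_univ, one_smul]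
    rw [← pow_two, ← sq_abs, abs_mul]
    have h0 : 0 ≤ δ := (abs_nonneg _).trans (hχ 0)
    have : |χ W| * |g w| ≤ δ * 1 := mul_le_mul (hχ W) (hg w) (abs_nonneg _) h0
    rw [mul_one] at this
    exact pow_le_pow_left₀ (by positivity) this 2
  | cons s l ih =>
    cases s with
    | rot p σ =>
      simp only [stepParams, List.nodup_cons] at hl
      have upd := propagate_update χ g l p hl.1
      have mild := mild_propagate χ g l
      have ms : ∀ (c : ℝ) (u : Word n) (W : ℕ), Mild fun θ => c * propagate χ g θ l u W :=
        fun c u W => (mild_const c).mul (mild u W)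
      by_cases hw : σ.Anti w <;> simp only [propagate, hw, if_true, if_false]
      · rw [integral_rot_mul_rot p (mild _ _) (ms _ _ _) (mild _ _) (ms _ _ _)
          (fun θ x => upd _ _ _ _) (fun θ x => by rw [upd]) (fun θ x => upd _ _ _ _)
          (fun θ x => by rw [upd])]
        have e : ∀ θ : P → ℝ, σ.rotSign w * propagate χ g θ l (σ.mul w) W *
            (σ.rotSign w * propagate χ g θ l (σ.mul w) W) =
            propagate χ g θ l (σ.mul w) W * propagate χ g θ l (σ.mul w) W := fun θ => by
          linear_combination (propagate χ g θ l (σ.mul w) W) ^ 2 * Word.rotSign_mul_self σ w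
        simp only [e]
        linarith [ih hl.2 w W, ih hl.2 (σ.mul w) W]
      · exact ih hl.2 w W
    | cliff V =>
      have e : ∀ θ : P → ℝ, V.sign w * propagate χ g θ l (V.act w) W *
            (V.sign w * propagate χ g θ l (V.act w) W) =
            propagate χ g θ l (V.act w) W * propagate χ g θ l (V.act w) W := fun θ => by
          linear_combination (propagate χ g θ l (V.act w) W) ^ 2 * Clifford.sign_mul_self V w
      simp only [propagate, e]
      exact ih hl _ _
    | noise => exact ih hl _ _

theorem integral_sum_propagate_sq_le (χ : ℕ → ℝ) (g : Word n → ℝ) {δ : ℝ} (hχ : ∀ k, |χ k| ≤ δ)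
    (hg : ∀ w, |g w| ≤ 1) (l : List (Step n P)) (hl : (stepParams l).Nodup)
    (hc : ∀ r, CommutesAlong l r → r = fun _ => .I) (H : Hamiltonian n) :
    ∫ θ, (∑ k, H.coeff k * propagate χ g θ l (H.word k) 0) ^ 2
      ∂(Measure.pi fun _ => angleMeasure) ≤ δ ^ 2 * ∑ k, H.coeff k ^ 2 := by
  have e : ∀ θ : P → ℝ, (∑ k, H.coeff k * propagate χ g θ l (H.word k) 0) ^ 2 =
      ∑ k, ∑ k', H.coeff k * H.coeff k' *
        (propagate χ g θ l (H.word k) 0 * propagate χ g θ l (H.word k') 0) := by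
    intro θ
    rw [pow_two, Finset.sum_mul_sum]
    refine Finset.sum_congr rfl fun k _ => Finset.sum_congr rfl fun k' _ => ?_
    ring
  have mild : ∀ k k', Mild fun θ : P → ℝ => H.coeff k * H.coeff k' *
        (propagate χ g θ l (H.word k) 0 * propagate χ g θ l (H.word k') 0) := fun k k' =>
    (mild_const _).mul ((mild_propagate _ _ _ _ _).mul (mild_propagate _ _ _ _ _))
  simp only [e]
  rw [integral_finsetSum _ fun k _ => (Mild.sum _ (mild k)).integrable, Finset.mul_sum]
  refine Finset.sum_le_sum fun k _ => ?_
  rw [integral_finsetSum _ fun k' _ => (mild k k').integrable, Finset.sum_eq_single k]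
  · rw [integral_const_mul, ← pow_two, mul_comm]
    exact mul_le_mul_of_nonneg_right (integral_propagate_sq_le χ g hχ hg l hl _ _) (sq_nonneg _)
  · intro k' _ hk
    rw [integral_const_mul, integral_propagate_mul_eq_zero _ _ _ hl, mul_zero]
    intro h
    exact Word.mul_ne_one (fun h' => hk (H.word_injective h').symm) (hc _ h)
  · simp

end Moments

/-! ### The generation hypothesis -/

theorem stepParams_append (l l' : List (Step n P)) :
    stepParams (l ++ l') = stepParams l ++ stepParams l' := by
  induction l with
  | nil => rfl
  | cons s l ih => cases s <;> simp [stepParams, ih]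

theorem stepParams_gates (l : Layer n) (f : Fin l.R → P) :
    stepParams (l.gates f) = List.ofFn f := by
  have h1 : ∀ (k : ℕ) (p : Fin k → P) (σ : Fin k → Word n),
      stepParams (List.ofFn fun j => Step.rot (p j) (σ j)) = List.ofFn p := by
    intro k
    induction k with
    | zero => intro p σ; simp [stepParams]
    | succ k ih => intro p σ; simp [List.ofFn_succ, stepParams, ih]
  have h2 : ∀ (k : ℕ) (V : Fin k → Clifford n),
      stepParams (List.ofFn fun j => (Step.cliff (V j) : Step n P)) = [] := by
    intro k
    induction k with
    | zero => intro V; simp [stepParams]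
    | succ k ih => intro V; simp [List.ofFn_succ, stepParams, ih]
  rw [Layer.gates, stepParams_append, h1, h2, List.append_nil]

theorem mem_stepParams_steps (U : Circuit n L) (m : ℕ) (h : m ≤ L) (p : U.Param)
    (hp : p ∈ stepParams (U.steps m h)) : (p.1 : ℕ) < m := by
  induction m with
  | zero => simp [Circuit.steps, stepParams] at hp
  | succ m ih =>
    simp only [Circuit.steps, stepParams, stepParams_append, stepParams_gates, List.mem_append,
      List.mem_ofFn] at hp
    rcases hp with ⟨j, rfl⟩ | hp
    · simp
    · exact (ih _ hp).trans (Nat.lt_succ_self m)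

theorem nodup_stepParams_steps (U : Circuit n L) (m : ℕ) (h : m ≤ L) :
    (stepParams (U.steps m h)).Nodup := by
  induction m with
  | zero => simp [Circuit.steps, stepParams]
  | succ m ih =>
    simp only [Circuit.steps, stepParams, stepParams_append, stepParams_gates]
    refine List.Nodup.append ?_ (ih _) ?_
    · rw [List.nodup_ofFn]
      intro j j' hj
      simpa using hj
    · intro p hp hp'
      obtain ⟨j, rfl⟩ := List.mem_ofFn.mp hp
      exact lt_irrefl _ (mem_stepParams_steps U m _ _ hp')

/-- The product of the Clifford gates of the first `m` layers. -/
def Circuit.cliffPrefix (U : Circuit n L) : (m : ℕ) → m ≤ L → Op n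
  | 0, _ => 1
  | m + 1, h => (U ⟨m, h⟩).cliffOp * U.cliffPrefix m (Nat.le_of_succ_le h)

theorem Circuit.cliffBefore_eq (U : Circuit n L) (i : Fin L) :
    U.cliffBefore i = U.cliffPrefix i i.isLt.le := by
  have h : ∀ (m : ℕ) (hm : m ≤ L), (List.ofFn fun k : Fin m =>
      (U (Fin.castLE hm k)).cliffOp).reverse.prod = U.cliffPrefix m hm := by
    intro m
    induction m with
    | zero => intro hm; simp [Circuit.cliffPrefix]
    | succ m ih =>
      intro hm
      rw [List.ofFn_succ_last, List.reverse_append, List.prod_append, Circuit.cliffPrefix,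
        ← ih (Nat.le_of_succ_le hm)]
      simp
      rfl
  exact h i i.isLt.le

/-- The action of a list of Clifford gates on words, up to sign. -/
def actList (Vs : List (Clifford n)) (w : Word n) : Word n := Vs.foldl (fun w V => V.act w) w

theorem conj_op_list (Vs : List (Clifford n)) (w : Word n) : ∃ c : ℂ, c ≠ 0 ∧
    ((Vs.map Clifford.op).prod)ᴴ * w.op * (Vs.map Clifford.op).prod =
      c • (actList Vs w).op := by
  induction Vs generalizing w with
  | nil => exact ⟨1, one_ne_zero, by simp [actList]⟩
  | cons V Vs ih =>
    obtain ⟨c, hc, h⟩ := ih (V.act w)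
    have hs : (V.sign w : ℂ) ≠ 0 := by
      unfold Clifford.sign
      split_ifs <;> simp
    refine ⟨V.sign w * c, mul_ne_zero hs hc, ?_⟩
    rw [List.map_cons, List.prod_cons, Matrix.conjTranspose_mul]
    have : ((Vs.map Clifford.op).prod)ᴴ * V.opᴴ * w.op * (V.op * (Vs.map Clifford.op).prod) =
        ((Vs.map Clifford.op).prod)ᴴ * (V.opᴴ * w.op * V.op) * (Vs.map Clifford.op).prod := by
      simp only [mul_assoc]
    rw [this, V.conj_op, Matrix.mul_smul, Matrix.smul_mul, h, smul_smul]
    rfl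

theorem prod_list_mul_conjTranspose (Vs : List (Clifford n)) :
    (Vs.map Clifford.op).prod * ((Vs.map Clifford.op).prod)ᴴ = 1 := by
  induction Vs with
  | nil => simp
  | cons V Vs ih =>
    rw [List.map_cons, List.prod_cons, Matrix.conjTranspose_mul]
    have : V.op * (Vs.map Clifford.op).prod * (((Vs.map Clifford.op).prod)ᴴ * V.opᴴ) =
        V.op * ((Vs.map Clifford.op).prod * ((Vs.map Clifford.op).prod)ᴴ) * V.opᴴ := by
      simp only [mul_assoc]
    rw [this, ih, mul_one, V.op_mul_conjTranspose]

theorem commutesAlong_gates_append (l : Layer n) (f : Fin l.R → P) (rest : List (Step n P))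
    (r : Word n) : CommutesAlong (l.gates f ++ rest) r ↔
      (∀ j, ¬ (l.rot j).Anti r) ∧ CommutesAlong rest (actList (List.ofFn l.cliff) r) := by
  have h1 : ∀ (k : ℕ) (p : Fin k → P) (σ : Fin k → Word n) (rest : List (Step n P)) (r : Word n),
      CommutesAlong ((List.ofFn fun j => Step.rot (p j) (σ j)) ++ rest) r ↔
        (∀ j, ¬ (σ j).Anti r) ∧ CommutesAlong rest r := by
    intro k
    induction k with
    | zero => intro p σ rest r; simp
    | succ k ih =>
      intro p σ rest r
      simp [List.ofFn_succ, CommutesAlong, ih, Fin.forall_fin_succ, and_assoc]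
  have h2 : ∀ (Vs : List (Clifford n)) (rest : List (Step n P)) (r : Word n),
      CommutesAlong (Vs.map Step.cliff ++ rest) r ↔ CommutesAlong rest (actList Vs r) := by
    intro Vs
    induction Vs with
    | nil => intro rest r; simp [actList]
    | cons V Vs ih =>
      intro rest r
      simp [CommutesAlong, ih, actList]
  have h3 : (List.ofFn fun k => (Step.cliff (l.cliff k) : Step n P)) =
      (List.ofFn l.cliff).map Step.cliff := by
    rw [List.map_ofFn]
    rfl
  rw [Layer.gates, List.append_assoc, h1, h3, h2]

theorem Layer.cliffOp_eq (l : Layer n) : l.cliffOp = ((List.ofFn l.cliff).map Clifford.op).prod := by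
  rw [Layer.cliffOp, List.map_ofFn]
  rfl

theorem Layer.conj_rot (l : Layer n) (j : Fin l.R) :
    l.cliffOpᴴ * (l.rot j).op * l.cliffOp = (l.rot j).op := by
  have h : ∀ Vs : List (Clifford n), (∀ V ∈ Vs, Disjoint (l.rot j).supp V.supp) →
      ((Vs.map Clifford.op).prod)ᴴ * (l.rot j).op * (Vs.map Clifford.op).prod = (l.rot j).op := by
    intro Vs
    induction Vs with
    | nil => simp
    | cons V Vs ih =>
      intro hd
      rw [List.map_cons, List.prod_cons, Matrix.conjTranspose_mul]
      have : ((Vs.map Clifford.op).prod)ᴴ * V.opᴴ * (l.rot j).op *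
          (V.op * (Vs.map Clifford.op).prod) = ((Vs.map Clifford.op).prod)ᴴ *
          (V.opᴴ * (l.rot j).op * V.op) * (Vs.map Clifford.op).prod := by
        simp only [mul_assoc]
      rw [this, V.conj_op_of_disjoint _ (hd V (by simp))]
      exact ih fun V' hV' => hd V' (by simp [hV'])
  rw [l.cliffOp_eq]
  refine h _ fun V hV => ?_
  obtain ⟨k, rfl⟩ := List.mem_ofFn.mp hV
  exact l.rot_cliff_disjoint j k

theorem commute_conj {A X Y : Op n} (hA : A * Aᴴ = 1) (h : X * Y = Y * X) :
    (Aᴴ * X * A) * (Aᴴ * Y * A) = (Aᴴ * Y * A) * (Aᴴ * X * A) := by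
  have e : ∀ X Y : Op n, (Aᴴ * X * A) * (Aᴴ * Y * A) = Aᴴ * (X * Y) * A := by
    intro X Y
    calc (Aᴴ * X * A) * (Aᴴ * Y * A) = Aᴴ * X * (A * Aᴴ) * Y * A := by simp only [mul_assoc]
      _ = Aᴴ * (X * Y) * A := by rw [hA, mul_one, mul_assoc Aᴴ X Y]
  rw [e, e, h]

theorem Layer.cliffOp_mul_conjTranspose (l : Layer n) : l.cliffOp * l.cliffOpᴴ = 1 := by
  rw [l.cliffOp_eq, prod_list_mul_conjTranspose]

theorem Circuit.cliffPrefix_mul_conjTranspose (U : Circuit n L) (m : ℕ) (h : m ≤ L) :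
    U.cliffPrefix m h * (U.cliffPrefix m h)ᴴ = 1 := by
  induction m with
  | zero => simp [Circuit.cliffPrefix]
  | succ m ih =>
    rw [Circuit.cliffPrefix, Matrix.conjTranspose_mul]
    have : ∀ A B : Op n, A * B * (Bᴴ * Aᴴ) = A * (B * Bᴴ) * Aᴴ := fun A B => by
      simp only [mul_assoc]
    rw [this, ih, mul_one, Layer.cliffOp_mul_conjTranspose]

/-- For rotations of earlier layers this is the induction hypothesis, applied to the word that `r`
becomes under the last Clifford layer. In the last layer itself `r` commutes with the rotation word,
which is fixed by the Clifford gates of its own layer because the supports are disjoint; so both can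
be pulled back to the input by the same unitary. -/
theorem commute_effected_of_commutesAlong (U : Circuit n L) (m : ℕ) (h : m ≤ L) (r : Word n)
    (hr : CommutesAlong (U.steps m h) r) (p : U.Param) (hp : (p.1 : ℕ) < m) :
    ((U.cliffPrefix m h)ᴴ * r.op * U.cliffPrefix m h) * U.effected p =
      U.effected p * ((U.cliffPrefix m h)ᴴ * r.op * U.cliffPrefix m h) := by
  induction m generalizing r with
  | zero => exact absurd hp (Nat.not_lt_zero _)
  | succ m ih =>
    rw [Circuit.steps, CommutesAlong, commutesAlong_gates_append] at hr
    have hpre : (U.cliffPrefix (m + 1) h)ᴴ * r.op * U.cliffPrefix (m + 1) h =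
        (U.cliffPrefix m (Nat.le_of_succ_le h))ᴴ *
          ((U ⟨m, h⟩).cliffOpᴴ * r.op * (U ⟨m, h⟩).cliffOp) *
            U.cliffPrefix m (Nat.le_of_succ_le h) := by
      rw [Circuit.cliffPrefix, Matrix.conjTranspose_mul]
      simp only [mul_assoc]
    rw [hpre]
    rcases Nat.lt_succ_iff_lt_or_eq.mp hp with hlt | heq
    · obtain ⟨c, -, hc⟩ := conj_op_list (List.ofFn (U ⟨m, h⟩).cliff) r
      rw [← Layer.cliffOp_eq] at hc
      have := ih (Nat.le_of_succ_le h) _ hr.2 hlt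
      rw [hc]
      simp only [Matrix.mul_smul, Matrix.smul_mul, this]
    · obtain ⟨i, j⟩ := p
      obtain rfl : i = ⟨m, h⟩ := Fin.ext heq
      rw [Circuit.effected, Circuit.cliffBefore_eq]
      refine commute_conj (U.cliffPrefix_mul_conjTranspose _ _) ?_
      have h1 := (Word.commute_of_not_anti (hr.1 j)).symm
      have h2 := commute_conj (Layer.cliffOp_mul_conjTranspose (U ⟨m, h⟩)) h1
      rwa [Layer.conj_rot] at h2

/-- Under the generation hypothesis only the identity word commutes with all rotations that it
meets on its way through the circuit. -/
theorem eq_one_of_commutesAlong (U : Circuit n L) (hU : U.Generates) (r : Word n)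
    (hr : CommutesAlong (U.steps L le_rfl) r) : r = fun _ => .I := by
  set A := U.cliffPrefix L le_rfl with hA
  have hAA : A * Aᴴ = 1 := U.cliffPrefix_mul_conjTranspose _ _
  have hAA' : Aᴴ * A = 1 := mul_eq_one_comm.mp hAA
  set D := Aᴴ * r.op * A with hD
  have h1 : ∀ X ∈ Submonoid.closure (Set.range U.effected), D * X = X * D := by
    intro X hX
    induction hX using Submonoid.closure_induction with
    | mem X hX =>
      obtain ⟨p, rfl⟩ := hX
      exact commute_effected_of_commutesAlong U L le_rfl r hr p p.1.isLt
    | one => simp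
    | mul X Y _ _ hX hY => rw [← mul_assoc, hX, mul_assoc, hY, mul_assoc]
  have h2 : ∀ w : Word n, D * w.op = w.op * D := by
    intro w
    obtain ⟨k, hk⟩ := hU w
    have h := h1 _ hk
    rw [Matrix.mul_smul, Matrix.smul_mul] at h
    exact smul_right_injective _ (pow_ne_zero k Complex.I_ne_zero) h
  -- Pauli words span all operators, so `D` is central.
  have h3 : ∀ X : Op n, D * X = X * D := by
    intro X
    rw [← sum_pauliCoeff_smul_op X]
    simp only [Finset.mul_sum, Finset.sum_mul, Matrix.mul_smul, Matrix.smul_mul, h2]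
  -- Conjugation by the unitary `A` does not move a central operator, so pulling `r` back has not
  -- changed it.
  have h4 : r.op = D := by
    have : A * D * Aᴴ = r.op := by
      rw [hD]
      calc A * (Aᴴ * r.op * A) * Aᴴ = (A * Aᴴ) * r.op * (A * Aᴴ) := by simp only [mul_assoc]
        _ = r.op := by rw [hAA, one_mul, mul_one]
    rw [← this, ← h3, mul_assoc, hAA, mul_one]
  have h5 : ∀ w : Word n, ¬ w.Anti r := by
    intro w hw
    have e1 := Word.anticommute_of_anti hw
    have e2 := h2 w
    rw [← h4] at e2
    rw [e2] at e1
    have e3 : w.op * r.op = 0 := by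
      have : (2 : ℂ) • (w.op * r.op) = 0 := by
        rw [two_smul]
        nth_rewrite 1 [e1]
        simp
      exact (smul_eq_zero.mp this).resolve_left two_ne_zero
    have e4 : w.op * (w.op * r.op) = r.op := by rw [← mul_assoc, Word.op_mul_self, one_mul]
    rw [e3, mul_zero] at e4
    exact Word.op_ne_zero r e4.symm
  funext q
  -- Test words with one letter at `q`: the letters `X` and `Z` together detect every non-identity
  -- letter.
  have key : ∀ a : Pauli, ¬ (Word.Anti (Function.update (fun _ => .I) q a) r) →
      a.phase (r q) % 2 = 0 := by
    intro a ha
    unfold Word.Anti Word.phase at ha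
    rw [Finset.sum_eq_single q] at ha
    · simp only [Function.update_self] at ha
      omega
    · intro q' _ hq'
      simp [Function.update_of_ne hq', Pauli.phase]
    · simp
  have hX := key .X (h5 _)
  have hZ := key .Z (h5 _)
  revert hX hZ
  generalize r q = b
  cases b <;> simp [Pauli.phase]

/-! ### The mean square error of the truncation -/

/-- For `s = ±1` the operator `Q = 1 + s w` is Hermitian with `Q² = 2 Q`, so positivity of `Q ρ Q`
gives `1 + s Tr(w ρ) ≥ 0`. -/
theorem InputState.abs_expect_le_one (ρ : InputState n) (w : Word n) : |ρ.expect w| ≤ 1 := by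
  have h : ∀ s : ℝ, s * s = 1 → 0 ≤ 1 + s * ρ.expect w := by
    intro s hs
    set Q : Op n := 1 + (s : ℂ) • w.op with hQ
    have hs' : (s : ℂ) * s = 1 := by rw [← Complex.ofReal_mul, hs, Complex.ofReal_one]
    have hQH : Qᴴ = Q := by
      rw [hQ, Matrix.conjTranspose_add, Matrix.conjTranspose_one, Matrix.conjTranspose_smul,
        Word.conjTranspose_op, Complex.star_def, Complex.conj_ofReal]
    have hQQ : Q * Q = (2 : ℂ) • Q := by
      rw [hQ]
      simp only [add_mul, mul_add, one_mul, mul_one, Matrix.smul_mul, Matrix.mul_smul, smul_smul,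
        Word.op_mul_self, hs']
      module
    have h1 := (ρ.op_posSemidef.conjTranspose_mul_mul_same Q).trace_nonneg
    rw [hQH, Matrix.trace_mul_comm, ← mul_assoc, hQQ, Matrix.smul_mul, Matrix.trace_smul, hQ,
      add_mul, one_mul, Matrix.trace_add, Matrix.smul_mul, Matrix.trace_smul, ← ρ.ofReal_expect]
      at h1
    have h2 : ρ.op.trace = 1 := ρ.trace_eq_one
    rw [h2, smul_eq_mul, smul_eq_mul] at h1
    have h3 : (2 : ℂ) * (1 + s * ρ.expect w) = ((2 * (1 + s * ρ.expect w) : ℝ) : ℂ) := by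
      push_cast
      ring
    rw [h3, Complex.zero_le_real] at h1
    linarith
  rw [abs_le]
  constructor
  · linarith [h 1 (by norm_num)]
  · linarith [h (-1) (by norm_num)]

theorem propagate_sub (χ χ' : ℕ → ℝ) (g : Word n → ℝ) (θ : P → ℝ) (l : List (Step n P))
    (w : Word n) (W : ℕ) :
    propagate χ g θ l w W - propagate χ' g θ l w W =
      propagate (fun k => χ k - χ' k) g θ l w W := by
  induction l generalizing w W with
  | nil => simp only [propagate]; ring
  | cons s l ih =>
    cases s with
    | rot p σ =>
      simp only [propagate, ← ih]
      split_ifs <;> ring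
    | cliff V => simp only [propagate, ← ih]; ring
    | noise => simp only [propagate, ← ih]

theorem norm_truncatedCost_sub_noisyCost_sq (lam : ℝ) (U : Circuit n L) (H : Hamiltonian n)
    (ρ : InputState n) (M : ℕ) (θ : U.Param → ℝ) :
    ‖truncatedCost lam U H ρ M θ - noisyCost lam U H ρ θ‖ ^ 2 = (∑ k, H.coeff k *
      propagate (fun k => cutoff lam M k - (1 - lam) ^ k) ρ.expect θ (U.steps L le_rfl)
        (H.word k) 0) ^ 2 := by
  rw [truncatedCost_eq_sum, noisyCost_eq_sum, ← Complex.ofReal_sub, Complex.norm_real,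
    Real.norm_eq_abs, sq_abs, ← Finset.sum_sub_distrib]
  simp only [← mul_sub, propagate_sub]

theorem integrable_norm_truncatedCost_sub_noisyCost_sq (lam : ℝ) (U : Circuit n L)
    (H : Hamiltonian n) (ρ : InputState n) (M : ℕ) :
    Integrable (fun θ => ‖truncatedCost lam U H ρ M θ - noisyCost lam U H ρ θ‖ ^ 2)
      (paramMeasure U) := by
  simp only [norm_truncatedCost_sub_noisyCost_sq]
  have h : Mild fun θ : U.Param → ℝ => ∑ k, H.coeff k *
      propagate (fun k => cutoff lam M k - (1 - lam) ^ k) ρ.expect θ (U.steps L le_rfl)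
        (H.word k) 0 :=
    Mild.sum _ fun k => (mild_const _).mul (mild_propagate _ _ _ _ _)
  have e := (h.mul h).integrable
  simp only [← pow_two] at e
  exact e

theorem integral_norm_truncatedCost_sub_noisyCost_sq_le {lam : ℝ} (h0 : 0 < lam) (h1 : lam ≤ 1)
    (U : Circuit n L) (H : Hamiltonian n) (ρ : InputState n) (hU : U.Generates) (M : ℕ) :
    ∫ θ, ‖truncatedCost lam U H ρ M θ - noisyCost lam U H ρ θ‖ ^ 2 ∂(paramMeasure U) ≤
      ((1 - lam) ^ M) ^ 2 * ∑ k, H.coeff k ^ 2 := by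
  simp only [norm_truncatedCost_sub_noisyCost_sq]
  refine integral_sum_propagate_sq_le _ _ (fun k => ?_) ρ.abs_expect_le_one _
    (nodup_stepParams_steps U L le_rfl) (fun r hr => eq_one_of_commutesAlong U hU r hr) H
  have hl : 0 ≤ 1 - lam := by linarith
  have hl' : 1 - lam ≤ 1 := by linarith
  -- The error function vanishes up to weight `M`, and beyond it has modulus `(1 - lam) ^ k ≤ (1 -
  -- lam) ^ M`.
  unfold cutoff
  split_ifs with hk
  · simpa using pow_nonneg hl M
  · rw [zero_sub, abs_neg, abs_of_nonneg (pow_nonneg hl k)]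
    exact pow_le_pow_of_le_one hl hl' (not_le.mp hk).le

end NoisyVQA
end

/-! ### Machine infrastructure: time bounds, lookup tables, variables and counted loops. -/

noncomputable section
namespace NoisyVQA

variable {n L : ℕ} {P : Type}

/-! ### Running times of programs with bounded loops -/

/-- A bound on the running time of a program in which no loop makes `D` iterations. -/
def Prog.timeBound (D : ℕ) : Prog → ℕ
  | .skip => 1
  | .setN _ i j k e => 1 + i.cost + j.cost + k.cost + e.cost
  | .setR _ i j k e => 1 + i.cost + j.cost + k.cost + e.cost
  | .seq c d => c.timeBound D + d.timeBound D
  | .ite b c d => 1 + b.cost + c.timeBound D + d.timeBound D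
  | .while b c => D * (1 + b.cost + c.timeBound D)

/-- A bound on the nesting depth of loops. -/
def Prog.depth : Prog → ℕ
  | .skip => 0
  | .setN _ _ _ _ _ => 0
  | .setR _ _ _ _ _ => 0
  | .seq c d => c.depth + d.depth
  | .ite _ c d => c.depth + d.depth
  | .while _ c => 1 + c.depth

/-- Each loop costs one factor `D`. Adding depths in sequences and conditionals overestimates the
nesting, which is harmless since `1 ≤ D`. -/
theorem Prog.timeBound_le (c : Prog) {D : ℕ} (hD : 1 ≤ D) :
    c.timeBound D ≤ c.timeBound 1 * D ^ c.depth := by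
  have mono : ∀ (x a b : ℕ), x * D ^ a ≤ x * D ^ (a + b) ∧ x * D ^ a ≤ x * D ^ (b + a) :=
    fun x a b => ⟨Nat.mul_le_mul_left _ (Nat.pow_le_pow_right hD (by omega)),
      Nat.mul_le_mul_left _ (Nat.pow_le_pow_right hD (by omega))⟩
  induction c with
  | skip => simp [timeBound, depth]
  | setN a i j k e => simp [timeBound, depth]
  | setR a i j k e => simp [timeBound, depth]
  | seq c d ihc ihd =>
    simp only [timeBound, depth, add_mul]
    exact add_le_add (ihc.trans (mono _ _ _).1) (ihd.trans (mono _ _ _).2)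
  | ite b c d ihc ihd =>
    simp only [timeBound, depth, add_mul]
    refine add_le_add (add_le_add ?_ (ihc.trans (mono _ _ _).1)) (ihd.trans (mono _ _ _).2)
    rw [← add_mul]
    exact Nat.le_mul_of_pos_right _ (Nat.pow_pos hD)
  | _ =>
    rename_i b c ih
    simp only [timeBound, depth, pow_add, pow_one, one_mul]
    have h1 : 1 + b.cost ≤ (1 + b.cost) * D ^ c.depth :=
      Nat.le_mul_of_pos_right _ (Nat.pow_pos hD)
    calc D * (1 + b.cost + c.timeBound D)
        ≤ D * ((1 + b.cost) * D ^ c.depth + c.timeBound 1 * D ^ c.depth) :=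
          Nat.mul_le_mul_left _ (add_le_add h1 ih)
      _ = (1 + b.cost + c.timeBound 1) * (D * D ^ c.depth) := by ring

/-- The program leads from one memory to another within its time bound. -/
def Exec (D : ℕ) (c : Prog) (m m' : Mem) : Prop := ∃ t ≤ c.timeBound D, Run c m m' t

theorem Exec.skip (D : ℕ) (m : Mem) : Exec D .skip m m := ⟨1, le_rfl, .skip m⟩

theorem Exec.seq {D : ℕ} {c d : Prog} {m m' m'' : Mem} (h : Exec D c m m')
    (h' : Exec D d m' m'') : Exec D (.seq c d) m m'' := by
  obtain ⟨t, ht, hr⟩ := h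
  obtain ⟨t', ht', hr'⟩ := h'
  exact ⟨t + t', add_le_add ht ht', .seq hr hr'⟩

theorem Exec.ite_pos {D : ℕ} {b : BExp} {c d : Prog} {m m' : Mem} (hb : b.holds m)
    (h : Exec D c m m') : Exec D (.ite b c d) m m' := by
  obtain ⟨t, ht, hr⟩ := h
  exact ⟨_, by simp only [Prog.timeBound]; omega, .iteTrue hb hr⟩

theorem Exec.ite_neg {D : ℕ} {b : BExp} {c d : Prog} {m m' : Mem} (hb : ¬ b.holds m)
    (h : Exec D d m m') : Exec D (.ite b c d) m m' := by
  obtain ⟨t, ht, hr⟩ := h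
  exact ⟨_, by simp only [Prog.timeBound]; omega, .iteFalse hb hr⟩

/-- `N` rounds need `N + 1` tests, whence the bound on `N + 1`. The induction is on the number of
remaining rounds, as a run of a loop is built from its first round. -/
theorem Exec.while {D : ℕ} {b : BExp} {c : Prog} (σ : ℕ → Mem) {N : ℕ} (hN : N + 1 ≤ D)
    (hb : ∀ i < N, b.holds (σ i)) (hc : ∀ i < N, Exec D c (σ i) (σ (i + 1)))
    (hbN : ¬ b.holds (σ N)) : Exec D (.while b c) (σ 0) (σ N) := by
  have h : ∀ r ≤ N, ∃ t ≤ (r + 1) * (1 + b.cost + c.timeBound D),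
      Run (.while b c) (σ (N - r)) (σ N) t := by
    intro r
    induction r with
    | zero =>
      intro _
      exact ⟨1 + b.cost, by omega, .whileFalse hbN⟩
    | succ r ih =>
      intro hr
      obtain ⟨t', ht', hr'⟩ := ih (by omega)
      obtain ⟨t, ht, hrun⟩ := hc (N - (r + 1)) (by omega)
      have e : N - (r + 1) + 1 = N - r := by omega
      rw [e] at hrun
      refine ⟨_, ?_, .whileTrue (hb _ (by omega)) hrun hr'⟩
      rw [add_mul (r + 1) 1, one_mul]
      omega
  obtain ⟨t, ht, hr⟩ := h N le_rfl
  rw [Nat.sub_self] at hr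
  exact ⟨t, ht.trans (Nat.mul_le_mul_right _ hN), hr⟩

/-! ### Table lookup by arithmetic -/

/-- `1` if the expression has the value `a`, otherwise `0`. -/
def NExp.is (x : NExp) (a : ℕ) : NExp := .sub (.lit 1) (.add (.sub x (.lit a)) (.sub (.lit a) x))

/-- A constant multiple of an expression. -/
def NExp.times (x : NExp) : ℕ → NExp
  | 0 => .lit 0
  | c + 1 => .add (x.times c) x

/-- A sum of a fixed number of expressions. -/
def NExp.sumTo (g : ℕ → NExp) : ℕ → NExp
  | 0 => .lit 0
  | c + 1 => .add (NExp.sumTo g c) (g c)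

/-- The value of a function of two arguments less than `5`. -/
def NExp.tab (f : ℕ → ℕ → ℕ) (x y : NExp) : NExp :=
  NExp.sumTo (fun a => NExp.sumTo (fun b =>
    (NExp.sub (.add (x.is a) (y.is b)) (.lit 1)).times (f a b)) 5) 5

/-- With truncated subtraction `(x - a) + (a - x)` is the distance of `x` and `a`, and one minus the
distance is `1` exactly at equality. -/
theorem NExp.eval_is (x : NExp) (a : ℕ) (m : Mem) :
    (x.is a).eval m = if x.eval m = a then 1 else 0 := by
  simp only [NExp.is, NExp.eval]
  split_ifs <;> omega

theorem NExp.eval_times (x : NExp) (c : ℕ) (m : Mem) : (x.times c).eval m = c * x.eval m := by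
  induction c with
  | zero => simp [NExp.times, NExp.eval]
  | succ c ih => simp [NExp.times, NExp.eval, ih, add_mul]

theorem NExp.eval_sumTo (g : ℕ → NExp) (c : ℕ) (m : Mem) :
    (NExp.sumTo g c).eval m = ∑ i ∈ Finset.range c, (g i).eval m := by
  induction c with
  | zero => simp [NExp.sumTo, NExp.eval]
  | succ c ih => simp [NExp.sumTo, NExp.eval, ih, Finset.sum_range_succ]

/-- Subtracting `1` from the sum of two indicators gives their conjunction, so a single term
survives. The range up to `4` covers Pauli codes, exponents of `i` modulo `4`, and the extra code
`4` for zero. -/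
theorem NExp.eval_tab (f : ℕ → ℕ → ℕ) (x y : NExp) (m : Mem) (hx : x.eval m < 5)
    (hy : y.eval m < 5) : (NExp.tab f x y).eval m = f (x.eval m) (y.eval m) := by
  simp only [NExp.tab, NExp.eval_sumTo, NExp.eval_times, NExp.eval, NExp.eval_is]
  rw [Finset.sum_eq_single (x.eval m), Finset.sum_eq_single (y.eval m)]
  · simp
  · intro b _ hb
    simp [hb.symm]
  · simp [hy]
  · intro a _ ha
    refine Finset.sum_eq_zero fun b _ => ?_
    rw [if_neg ha.symm]
    split_ifs <;> simp
  · simp [hx]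

/-! ### Memory layout -/

/-- Natural-number variables of the program. -/
inductive NVar where
  | k | c | l | j | q | wt | rem | e | N | M

/-- Real variables of the program. -/
inductive RVar where
  | acc | coef | x | tr

/-- The natural-number arrays below `8` hold the input, and array `8` the current word. -/
def NVar.addr : NVar → ℕ
  | .k => 9
  | .c => 10
  | .l => 11
  | .j => 12
  | .q => 13
  | .wt => 14
  | .rem => 15
  | .e => 16
  | .N => 17
  | .M => 18

/-- The real arrays `1` to `4` hold the input; `acc` lives in array `0`, where the output is read.
-/
def RVar.addr : RVar → ℕ
  | .acc => 0
  | .coef => 5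
  | .x => 6
  | .tr => 7

/-- A walk along one branch of the propagation of a Pauli word: the current word, its coefficient,
the bits that select the remaining branches, and the weight collected so far. -/
@[ext] structure Walk (n : ℕ) where
  w : Word n
  coef : ℝ
  rem : ℕ
  wt : ℕ

/-- The values of all variables of the program. -/
@[ext] structure St (n : ℕ) where
  walk : Walk n
  k : ℕ
  c : ℕ
  l : ℕ
  j : ℕ
  q : ℕ
  e : ℕ
  N : ℕ
  M : ℕ
  x : ℝ
  tr : ℝ
  acc : ℝ

def St.getN (s : St n) : NVar → ℕ
  | .k => s.k
  | .c => s.c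
  | .l => s.l
  | .j => s.j
  | .q => s.q
  | .wt => s.walk.wt
  | .rem => s.walk.rem
  | .e => s.e
  | .N => s.N
  | .M => s.M

def St.setN (s : St n) : NVar → ℕ → St n
  | .k, v => { s with k := v }
  | .c, v => { s with c := v }
  | .l, v => { s with l := v }
  | .j, v => { s with j := v }
  | .q, v => { s with q := v }
  | .wt, v => { s with walk := { s.walk with wt := v } }
  | .rem, v => { s with walk := { s.walk with rem := v } }
  | .e, v => { s with e := v }
  | .N, v => { s with N := v }
  | .M, v => { s with M := v }

def St.getR (s : St n) : RVar → ℝ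
  | .acc => s.acc
  | .coef => s.walk.coef
  | .x => s.x
  | .tr => s.tr

def St.setR (s : St n) : RVar → ℝ → St n
  | .acc, v => { s with acc := v }
  | .coef, v => { s with walk := { s.walk with coef := v } }
  | .x, v => { s with x := v }
  | .tr, v => { s with tr := v }

def St.natCell (s : St n) : ℕ → ℕ
  | 9 => s.k
  | 10 => s.c
  | 11 => s.l
  | 12 => s.j
  | 13 => s.q
  | 14 => s.walk.wt
  | 15 => s.walk.rem
  | 16 => s.e
  | 17 => s.N
  | 18 => s.M
  | _ => 0

def St.realCell (s : St n) : ℕ → ℝ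
  | 0 => s.acc
  | 5 => s.walk.coef
  | 6 => s.x
  | 7 => s.tr
  | _ => 0

/-- The memory that holds the variables of the program in addition to the input. -/
def embed (b : Mem) (s : St n) : Mem where
  nat := fun a i j k =>
    if a < 8 then b.nat a i j k
    else if a = 8 then (if j = 0 ∧ k = 0 then pad (fun q => (s.walk.w q).code) i else 0)
    else if i = 0 ∧ j = 0 ∧ k = 0 then s.natCell a else 0
  real := fun a i j k =>
    if a = 0 ∨ 5 ≤ a then (if i = 0 ∧ j = 0 ∧ k = 0 then s.realCell a else 0)
    else b.real a i j k
  angle := b.angle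

/-- Reading a variable. -/
def NVar.get (v : NVar) : NExp := .read v.addr (.lit 0) (.lit 0) (.lit 0)
def RVar.get (v : RVar) : RExp := .read v.addr (.lit 0) (.lit 0) (.lit 0)

/-- Assignment to a variable. -/
def NVar.set (v : NVar) (e : NExp) : Prog := .setN v.addr (.lit 0) (.lit 0) (.lit 0) e
def RVar.set (v : RVar) (e : RExp) : Prog := .setR v.addr (.lit 0) (.lit 0) (.lit 0) e

/-- The letter of the current word at a qubit. -/
def letter (q : NExp) : NExp := .read 8 q (.lit 0) (.lit 0)

/-- Assignment to a letter of the current word. -/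
def setLetter (q e : NExp) : Prog := .setN 8 q (.lit 0) (.lit 0) e

theorem NVar.eval_get (v : NVar) (b : Mem) (s : St n) : v.get.eval (embed b s) = s.getN v := by
  cases v <;> rfl

theorem RVar.eval_get (v : RVar) (b : Mem) (s : St n) : v.get.eval (embed b s) = s.getR v := by
  cases v <;> rfl

theorem eval_letter (b : Mem) (s : St n) (e : NExp) (q : Fin n)
    (h : e.eval (embed b s) = q) :
    (letter e).eval (embed b s) = (s.walk.w q).code := by
  simp only [letter, NExp.eval, h]
  simp [embed, pad]

/-- Writing to the cell of a variable commutes with `embed`, so execution can be followed on states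
instead of memories. -/
theorem Exec.setN {D : ℕ} {b : Mem} {s s' : St n} (v : NVar) (e : NExp)
    (h : s.setN v (e.eval (embed b s)) = s') :
    Exec D (v.set e) (embed b s) (embed b s') := by
  refine ⟨_, le_rfl, ?_⟩
  subst h
  have key : ∀ x : ℕ, ({ embed b s with nat := upd (embed b s).nat v.addr 0 0 0 x } : Mem) =
      embed b (s.setN v x) := by
    intro x
    have h1 : upd (embed b s).nat v.addr 0 0 0 x = (embed b (s.setN v x)).nat := by
      funext a i j k
      by_cases ha : a = v.addr
      · subst ha
        by_cases hi : i = 0 ∧ j = 0 ∧ k = 0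
        · obtain ⟨rfl, rfl, rfl⟩ := hi
          cases v <;> rfl
        · cases v <;> simp [upd, embed, NVar.addr, hi]
      · have h2 : (s.setN v x).natCell a = s.natCell a := by
          unfold St.natCell
          split <;> cases v <;> first | rfl | exact absurd rfl ha
        have h3 : (s.setN v x).walk.w = s.walk.w := by cases v <;> rfl
        simp [upd, embed, ha, h2, h3]
    rw [h1]
    have h4 : (embed b s).real = (embed b (s.setN v x)).real := by
      have h5 : (s.setN v x).realCell = s.realCell := by cases v <;> rfl
      simp [embed, h5]
    change Mem.mk _ (embed b s).real _ = _
    rw [h4]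
    rfl
  have := Run.setN v.addr (.lit 0) (.lit 0) (.lit 0) e (embed b s)
  simp only [NExp.eval, key] at this
  exact this

theorem Exec.setR {D : ℕ} {b : Mem} {s s' : St n} (v : RVar) (e : RExp)
    (h : s.setR v (e.eval (embed b s)) = s') :
    Exec D (v.set e) (embed b s) (embed b s') := by
  refine ⟨_, le_rfl, ?_⟩
  subst h
  have key : ∀ x : ℝ, ({ embed b s with real := upd (embed b s).real v.addr 0 0 0 x } : Mem) =
      embed b (s.setR v x) := by
    intro x
    have h1 : upd (embed b s).real v.addr 0 0 0 x = (embed b (s.setR v x)).real := by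
      funext a i j k
      by_cases ha : a = v.addr
      · subst ha
        by_cases hi : i = 0 ∧ j = 0 ∧ k = 0
        · obtain ⟨rfl, rfl, rfl⟩ := hi
          cases v <;> simp [upd, embed, RVar.addr, St.realCell, St.setR]
        · cases v <;> simp [upd, embed, RVar.addr, hi]
      · have h2 : (s.setR v x).realCell a = s.realCell a := by
          unfold St.realCell
          split <;> cases v <;> first | rfl | exact absurd rfl ha
        simp [upd, embed, ha, h2]
    rw [h1]
    have h4 : (embed b s).nat = (embed b (s.setR v x)).nat := by
      have h5 : (s.setR v x).natCell = s.natCell := by cases v <;> rfl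
      have h3 : (s.setR v x).walk.w = s.walk.w := by cases v <;> rfl
      simp [embed, h5, h3]
    change Mem.mk (embed b s).nat _ _ = _
    rw [h4]
    rfl
  have := Run.setR v.addr (.lit 0) (.lit 0) (.lit 0) e (embed b s)
  simp only [NExp.eval, key] at this
  exact this

theorem Exec.setLetter {D : ℕ} {b : Mem} {s s' : St n} (qe e : NExp) (q : Fin n) (p : Pauli)
    (hq : qe.eval (embed b s) = q) (he : e.eval (embed b s) = p.code)
    (h : { s with walk := { s.walk with w := Function.update s.walk.w q p } } = s') :
    Exec D (setLetter qe e) (embed b s) (embed b s') := by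
  refine ⟨_, le_rfl, ?_⟩
  subst h
  have key : ({ embed b s with nat := upd (embed b s).nat 8 q 0 0 p.code } : Mem) =
      embed b { s with walk := { s.walk with w := Function.update s.walk.w q p } } := by
    have h1 : upd (embed b s).nat 8 q 0 0 p.code =
        (embed b { s with walk := { s.walk with w := Function.update s.walk.w q p } }).nat := by
      funext a i j k
      by_cases ha : a = 8
      · subst ha
        by_cases hjk : j = 0 ∧ k = 0
        · obtain ⟨rfl, rfl⟩ := hjk
          by_cases hi : i = q
          · subst hi
            simp [upd, embed, pad]
          · have : ∀ hin : i < n, (⟨i, hin⟩ : Fin n) ≠ q := fun hin h => hi (by rw [← h])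
            simp only [upd, embed, pad, hi]
            by_cases hin : i < n
            · simp [hin, Function.update_of_ne (this hin)]
            · simp [hin]
        · have : ¬ (j = 0 ∧ k = 0) := hjk
          simp [upd, embed, this]
      · have h2 : ∀ s' : St n, (s'.k = s.k ∧ s'.c = s.c ∧ s'.l = s.l ∧ s'.j = s.j ∧ s'.q = s.q ∧
            s'.walk.wt = s.walk.wt ∧ s'.walk.rem = s.walk.rem ∧ s'.e = s.e ∧ s'.N = s.N ∧
            s'.M = s.M) → s'.natCell a = s.natCell a := by
          rintro s' ⟨h1, h2, h3, h4, h5, h6, h7, h8, h9, h10⟩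
          unfold St.natCell
          rw [h1, h2, h3, h4, h5, h6, h7, h8, h9, h10]
        have h3 := h2 { s with walk := { s.walk with w := Function.update s.walk.w q p } }
          ⟨rfl, rfl, rfl, rfl, rfl, rfl, rfl, rfl, rfl, rfl⟩
        simp [upd, embed, ha, h3]
    rw [h1]
    rfl
  have := Run.setN 8 qe (.lit 0) (.lit 0) e (embed b s)
  simp only [NExp.eval, hq, he, key] at this
  exact this

/-- A loop with a counter that is reset in the end. -/
def forLoop (v : NVar) (bound : NExp) (body : Prog) : Prog :=
  .seq (.while (.ltN v.get bound) (.seq body (v.set (.add v.get (.lit 1))))) (v.set (.lit 0))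

theorem St.getN_setN (s : St n) (v : NVar) (x : ℕ) : (s.setN v x).getN v = x := by
  cases v <;> rfl

theorem St.setN_setN (s : St n) (v : NVar) (x y : ℕ) : (s.setN v x).setN v y = s.setN v y := by
  cases v <;> rfl

/-- The invariant `f i` need not track the counter, which is overwritten by `i`. The bound is
evaluated anew before every round, so it has to keep the value `N`. -/
theorem Exec.forLoop {D : ℕ} {b : Mem} (v : NVar) (bound : NExp) (body : Prog) (f : ℕ → St n)
    {s s' : St n} {N : ℕ} (hN : N + 1 ≤ D)
    (hb : ∀ i ≤ N, bound.eval (embed b ((f i).setN v i)) = N)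
    (hbody : ∀ i < N, Exec D body (embed b ((f i).setN v i)) (embed b ((f (i + 1)).setN v i)))
    (h0 : (f 0).setN v 0 = s) (h1 : (f N).setN v 0 = s') :
    Exec D (forLoop v bound body) (embed b s) (embed b s') := by
  subst h0 h1
  refine Exec.seq (m' := embed b ((f N).setN v N))
    (Exec.while (fun i => embed b ((f i).setN v i)) hN ?_ ?_ ?_) ?_
  · intro i hi
    simp only [BExp.holds, NVar.eval_get, St.getN_setN, hb i hi.le, hi]
  · intro i hi
    refine (hbody i hi).seq (Exec.setN v _ ?_)
    simp only [NExp.eval, NVar.eval_get, St.getN_setN, St.setN_setN]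
  · simp only [BExp.holds, NVar.eval_get, St.getN_setN, hb N le_rfl, lt_irrefl, not_false_eq_true]
  · refine Exec.setN v _ ?_
    simp only [NExp.eval, St.setN_setN]

end NoisyVQA
end

/-! ### The enumeration program and the execution of its single gates. -/

noncomputable section
namespace NoisyVQA

variable {n L : ℕ} {P : Type}

/-! ### Walks -/

/-- One step of a walk. At an anticommuting rotation the leading one of `log₂ N` bits is removed
from `rem`; it selects the branch. -/
def Walk.step (N : ℕ) (lam : ℝ) (θ : P → ℝ) : Step n P → Walk n → Walk n
  | .rot p σ, y =>
    if σ.Anti y.w then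
      if y.rem + y.rem < N then
        { y with rem := y.rem + y.rem, coef := y.coef * Real.cos (θ p) }
      else { y with rem := y.rem + y.rem - N,
                    coef := y.coef * Real.sin (θ p) * σ.rotSign y.w, w := σ.mul y.w }
    else y
  | .cliff V, y => { y with w := V.act y.w, coef := y.coef * V.sign y.w }
  | .noise, y => { y with wt := y.wt + y.w.weight, coef := y.coef * (1 - lam) ^ y.w.weight }

/-- A walk through a list of steps. -/
def Walk.run (N : ℕ) (lam : ℝ) (θ : P → ℝ) (l : List (Step n P)) (y : Walk n) : Walk n :=
  l.foldl (fun y s => y.step N lam θ s) y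

/-! ### Codes of Pauli labels -/

/-- The Pauli label with a given code. -/
def Pauli.ofCode : ℕ → Pauli
  | 1 => .X
  | 2 => .Y
  | 3 => .Z
  | _ => .I

theorem Pauli.ofCode_code (p : Pauli) : Pauli.ofCode p.code = p := by cases p <;> rfl

theorem Pauli.code_lt (p : Pauli) : p.code < 5 := by cases p <;> decide

theorem Pauli.code_eq_zero_iff (p : Pauli) : p.code = 0 ↔ p = .I := by cases p <;> simp [Pauli.code]

theorem Pauli.code_eq_one_iff (p : Pauli) : p.code = 1 ↔ p = .X := by cases p <;> simp [Pauli.code]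

theorem Pauli.code_eq_two_iff (p : Pauli) : p.code = 2 ↔ p = .Y := by cases p <;> simp [Pauli.code]

/-- Table lookup for a function of two Pauli labels. -/
def pauliTab (f : Pauli → Pauli → ℕ) (x y : NExp) : NExp :=
  NExp.tab (fun a b => f (.ofCode a) (.ofCode b)) x y

theorem eval_pauliTab (f : Pauli → Pauli → ℕ) (x y : NExp) (m : Mem) (a b : Pauli)
    (hx : x.eval m = a.code) (hy : y.eval m = b.code) : (pauliTab f x y).eval m = f a b := by
  rw [pauliTab, NExp.eval_tab _ _ _ _ (by rw [hx]; exact a.code_lt) (by rw [hy]; exact b.code_lt),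
    hx, hy, Pauli.ofCode_code, Pauli.ofCode_code]

/-! ### The program -/

def qubitCount : NExp := .read 0 (.lit 0) (.lit 0) (.lit 0)
def layerCount : NExp := .read 0 (.lit 1) (.lit 0) (.lit 0)
def termCount : NExp := .read 0 (.lit 2) (.lit 0) (.lit 0)
def entryCount : NExp := .read 0 (.lit 3) (.lit 0) (.lit 0)

/-- The layer at hand; layers are visited from the last to the first. -/
def layerIndex : NExp := .sub (.sub layerCount (.lit 1)) NVar.l.get

def rotCount : NExp := .read 1 layerIndex (.lit 0) (.lit 0)
def rotLetter : NExp := .read 2 layerIndex NVar.j.get NVar.q.get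
def cliffCount : NExp := .read 3 layerIndex (.lit 0) (.lit 0)
def cliffData (i : ℕ) : NExp := .read 4 layerIndex NVar.j.get (.lit i)
def keepRate : RExp := .sub (.lit 1) (.read 1 (.lit 0) (.lit 0) (.lit 0))
def termCoeff : RExp := .read 2 NVar.k.get (.lit 0) (.lit 0)

/-- Overwrite all letters of the current word. -/
def fillProg (e : NExp) : Prog := forLoop .q qubitCount (setLetter NVar.q.get e)

def noiseProg : Prog :=
  forLoop .q qubitCount (.ite (.eqN (letter NVar.q.get) (.lit 0)) .skip
    (.seq (NVar.wt.set (.add NVar.wt.get (.lit 1)))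
      (RVar.coef.set (.mul RVar.coef.get keepRate))))

/-- Choice of a branch at an anticommuting rotation. -/
def branchProg (sgn : ℤ) : Prog :=
  .seq (NVar.rem.set (.add NVar.rem.get NVar.rem.get))
    (.ite (.ltN NVar.rem.get NVar.N.get)
      (RVar.coef.set (.mul RVar.coef.get (.cosAngle layerIndex NVar.j.get)))
      (.seq (NVar.rem.set (.sub NVar.rem.get NVar.N.get))
        (.seq (RVar.coef.set
            (.mul (.mul RVar.coef.get (.sinAngle layerIndex NVar.j.get)) (.lit sgn)))
          (fillProg (pauliTab (fun a b => (a.mul b).code) rotLetter (letter NVar.q.get))))))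

/-- The variable `e` collects the exponent of `i` in the product modulo `4`. The residues `1` and
`3` are the anticommuting cases, and multiplication by one more `i` turns them into the signs `-1`
and `1`. -/
def rotProg : Prog :=
  .seq (forLoop .q qubitCount (NVar.e.set (NExp.tab (fun a b => (a + b) % 4) NVar.e.get
      (pauliTab Pauli.phase rotLetter (letter NVar.q.get)))))
    (.seq (.ite (.eqN NVar.e.get (.lit 1)) (branchProg (-1))
        (.ite (.eqN NVar.e.get (.lit 3)) (branchProg 1) .skip))
      (NVar.e.set (.lit 0)))

def negProg : Prog := RVar.coef.set (.mul RVar.coef.get (.lit (-1)))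

/-- For a CNOT gate the new control letter is parked in `e`, since the new target letter depends on
the old control letter. -/
def cliffProg : Prog :=
  .ite (.eqN (cliffData 0) (.lit 0))
    (.seq (.ite (.eqN (letter (cliffData 1)) (.lit 2)) negProg .skip)
      (setLetter (cliffData 1)
        (pauliTab (fun a _ => a.hadamard.code) (letter (cliffData 1)) (letter (cliffData 1)))))
    (.ite (.eqN (cliffData 0) (.lit 1))
      (.seq (.ite (.eqN (letter (cliffData 1)) (.lit 1)) negProg .skip)
        (setLetter (cliffData 1)
          (pauliTab (fun a _ => a.phaseGate.code) (letter (cliffData 1)) (letter (cliffData 1)))))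
      (.seq (.ite (.eqN (pauliTab (fun a b => if (a = .X ∧ b = .Z) ∨ (a = .Y ∧ b = .Y) then 1 else 0)
            (letter (cliffData 1)) (letter (cliffData 2))) (.lit 1)) negProg .skip)
        (.seq (NVar.e.set (pauliTab (fun a b => (a.cnotControl b).code)
            (letter (cliffData 1)) (letter (cliffData 2))))
          (.seq (setLetter (cliffData 2) (pauliTab (fun a b => (a.cnotTarget b).code)
              (letter (cliffData 1)) (letter (cliffData 2))))
            (.seq (setLetter (cliffData 1) NVar.e.get) (NVar.e.set (.lit 0)))))))

def layerProg : Prog :=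
  .seq noiseProg (.seq (forLoop .j rotCount rotProg) (forLoop .j cliffCount cliffProg))

/-- The code of a matrix entry of a Pauli label: an exponent of `i`, or `4` for the entry zero. -/
def entryCode (p : Pauli) (x : ℕ) : ℕ :=
  match p, x with
  | .I, 0 => 0
  | .I, 3 => 0
  | .X, 1 => 0
  | .X, 2 => 0
  | .Y, 1 => 1
  | .Y, 2 => 3
  | .Z, 0 => 0
  | .Z, 3 => 2
  | _, _ => 4

/-- The code of a product of two powers of `i`, or zero. -/
def mulCode (a b : ℕ) : ℕ := if a = 4 ∨ b = 4 then 4 else (a + b) % 4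

def rowBit : NExp := .read 6 NVar.j.get NVar.q.get (.lit 0)
def colBit : NExp := .read 7 NVar.j.get NVar.q.get (.lit 0)
def entryRe : RExp := .read 3 NVar.j.get (.lit 0) (.lit 0)
def entryIm : RExp := .read 4 NVar.j.get (.lit 0) (.lit 0)

/-- A listed entry contributes `val · w(col, row)` to the trace, and the matrix entry of the word is
zero or a power of `i`. The real part of the product is then plus or minus the real or imaginary
part of `val`. -/
def entryProg : Prog :=
  .seq (forLoop .q qubitCount (NVar.e.set (NExp.tab mulCode NVar.e.get
      (NExp.tab (fun a x => entryCode (.ofCode a) x) (letter NVar.q.get)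
        (.add (.add rowBit rowBit) colBit)))))
    (.seq (.ite (.eqN NVar.e.get (.lit 0)) (RVar.tr.set (.add RVar.tr.get entryRe))
      (.ite (.eqN NVar.e.get (.lit 1)) (RVar.tr.set (.sub RVar.tr.get entryIm))
        (.ite (.eqN NVar.e.get (.lit 2)) (RVar.tr.set (.sub RVar.tr.get entryRe))
          (.ite (.eqN NVar.e.get (.lit 3)) (RVar.tr.set (.add RVar.tr.get entryIm)) .skip))))
      (NVar.e.set (.lit 0)))

def loadProg : Prog :=
  .seq (fillProg (.read 5 NVar.k.get NVar.q.get (.lit 0)))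
    (.seq (NVar.rem.set NVar.c.get) (RVar.coef.set termCoeff))

/-- Working variables return to zero, so that every walk starts from the same kind of state. -/
def clearProg : Prog :=
  .seq (fillProg (.lit 0)) (.seq (NVar.rem.set (.lit 0)) (.seq (NVar.wt.set (.lit 0))
    (.seq (RVar.coef.set (.lit 0)) (RVar.tr.set (.lit 0)))))

/-- The walk selected by the variables `k` and `c`, and its contribution to the result. -/
def walkProg : Prog :=
  .seq loadProg (.seq (forLoop .l layerCount layerProg) (.seq noiseProg
    (.seq (forLoop .j entryCount entryProg)
      (.seq (.ite (.and (.eqN NVar.rem.get (.lit 0)) (.not (.ltN NVar.M.get NVar.wt.get)))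
          (RVar.acc.set (.add RVar.acc.get (.mul RVar.coef.get RVar.tr.get))) .skip)
        clearProg))))

/-- The choice of the cutoff `M` and of `N = 2 ^ M`. -/
def cutoffProg : Prog :=
  .seq (forLoop .k termCount (RVar.x.set (.add RVar.x.get (.mul termCoeff termCoeff))))
    (.seq (NVar.N.set (.lit 1))
      (.seq (.while (.not (.leR RVar.x.get (.read 1 (.lit 1) (.lit 0) (.lit 0))))
          (.seq (RVar.x.set (.mul RVar.x.get (.mul keepRate keepRate)))
            (.seq (NVar.M.set (.add NVar.M.get (.lit 1)))
              (NVar.N.set (.add NVar.N.get NVar.N.get)))))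
        (RVar.x.set (.lit 0))))

/-- The truncated path integral. -/
def mainProg : Prog :=
  .seq cutoffProg (forLoop .k termCount (forLoop .c NVar.N.get walkProg))

/-! ### Correctness of the program -/

section Correct

variable (lam ν : ℝ) (U : Circuit n L) (H : Hamiltonian n) (ρ : InputState n) (θ : U.Param → ℝ)

theorem eval_qubitCount (s : St n) :
    qubitCount.eval (embed (input lam ν U H ρ θ) s) = n := rfl

theorem eval_layerCount (s : St n) :
    layerCount.eval (embed (input lam ν U H ρ θ) s) = L := rfl

theorem eval_termCount (s : St n) :
    termCount.eval (embed (input lam ν U H ρ θ) s) = H.K := rfl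

theorem eval_entryCount (s : St n) :
    entryCount.eval (embed (input lam ν U H ρ θ) s) = ρ.K := rfl

theorem eval_layerIndex (s : St n) :
    layerIndex.eval (embed (input lam ν U H ρ θ) s) = L - 1 - s.l := rfl

theorem eval_keepRate (s : St n) :
    keepRate.eval (embed (input lam ν U H ρ θ) s) = 1 - lam := by
  simp [keepRate, RExp.eval, NExp.eval, embed, input, inputReal]

theorem eval_termCoeff (s : St n) (k : Fin H.K) (hk : s.k = k) :
    termCoeff.eval (embed (input lam ν U H ρ θ) s) = H.coeff k := by
  simp only [termCoeff, RExp.eval, NVar.eval_get, St.getN, hk, NExp.eval]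
  simp [embed, input, inputReal, pad]

theorem eval_rotCount (s : St n) (i : Fin L) (hi : L - 1 - s.l = i) :
    rotCount.eval (embed (input lam ν U H ρ θ) s) = (U i).R := by
  simp only [rotCount, NExp.eval, eval_layerIndex, hi]
  simp [embed, input, inputNat, pad]

theorem eval_cliffCount (s : St n) (i : Fin L) (hi : L - 1 - s.l = i) :
    cliffCount.eval (embed (input lam ν U H ρ θ) s) = (U i).C := by
  simp only [cliffCount, NExp.eval, eval_layerIndex, hi]
  simp [embed, input, inputNat, pad]

theorem eval_rotLetter (s : St n) (i : Fin L) (hi : L - 1 - s.l = i) (j : Fin (U i).R)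
    (hj : s.j = j) (q : Fin n) (hq : s.q = q) :
    rotLetter.eval (embed (input lam ν U H ρ θ) s) = ((U i).rot j q).code := by
  simp only [rotLetter, NExp.eval, eval_layerIndex, hi, NVar.eval_get, St.getN, hj, hq]
  simp [embed, input, inputNat, pad]

theorem eval_cliffData (s : St n) (i : Fin L) (hi : L - 1 - s.l = i) (j : Fin (U i).C)
    (hj : s.j = j) :
    (cliffData 0).eval (embed (input lam ν U H ρ θ) s) = ((U i).cliff j).code.1 ∧
    (cliffData 1).eval (embed (input lam ν U H ρ θ) s) = ((U i).cliff j).code.2.1 ∧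
    (cliffData 2).eval (embed (input lam ν U H ρ θ) s) = ((U i).cliff j).code.2.2 := by
  simp only [cliffData, NExp.eval, eval_layerIndex, hi, NVar.eval_get, St.getN, hj]
  simp [embed, input, inputNat, pad]

theorem input_angle (i : Fin L) (j : Fin (U i).R) (s : St n) :
    (embed (input lam ν U H ρ θ) s).angle i j = θ ⟨i, j⟩ := by
  simp [embed, input, pad]

variable {D : ℕ}

/-- The word is overwritten in place, so when letter `i` is computed the earlier letters are already
new. Hence `he` must hold for all words that agree with the old one at `i`. -/
theorem exec_fill (hD : n + 1 ≤ D) (e : NExp) (v : Word n) (s : St n) (hq : s.q = 0)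
    (he : ∀ (i : Fin n) (w : Word n), w i = s.walk.w i →
      e.eval (embed (input lam ν U H ρ θ) { s with q := i, walk := { s.walk with w := w } }) =
        (v i).code) :
    Exec D (fillProg e) (embed (input lam ν U H ρ θ) s)
      (embed (input lam ν U H ρ θ) { s with walk := { s.walk with w := v } }) := by
  refine Exec.forLoop .q _ _ (fun i => { s with walk := { s.walk with
    w := fun q => if (q : ℕ) < i then v q else s.walk.w q } }) hD
    (fun i _ => eval_qubitCount _ _ _ _ _ _ _) ?_ ?_ ?_
  · intro i hi
    refine Exec.setLetter _ _ ⟨i, hi⟩ (v ⟨i, hi⟩) (NVar.eval_get _ _ _) (he ⟨i, hi⟩ _ (by simp)) ?_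
    simp only [St.setN]
    congr 2
    funext q
    by_cases h : q = ⟨i, hi⟩
    · subst h; simp
    · have : (q : ℕ) ≠ i := fun h' => h (Fin.ext h')
      rw [Function.update_of_ne h]
      have h2 : (q : ℕ) < i + 1 ↔ (q : ℕ) < i := by omega
      simp [h2]
  · ext <;> simp [St.setN, hq]
  · ext <;> simp [St.setN, hq]

/-- The number of non-identity letters among the first `i` letters. -/
def partialWeight (w : Word n) (i : ℕ) : ℕ :=
  ∑ q ∈ Finset.range i, if h : q < n then (if w ⟨q, h⟩ = .I then 0 else 1) else 0

theorem partialWeight_self (w : Word n) : partialWeight w n = w.weight := by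
  rw [partialWeight, Finset.sum_range, Word.weight, Word.supp, Finset.card_filter]
  refine Finset.sum_congr rfl fun q _ => ?_
  simp

theorem exec_noise (hD : n + 1 ≤ D) (s : St n) (hq : s.q = 0) :
    Exec D noiseProg (embed (input lam ν U H ρ θ) s)
      (embed (input lam ν U H ρ θ) { s with walk := s.walk.step s.N lam θ .noise }) := by
  refine Exec.forLoop .q _ _ (fun i => { s with walk := { s.walk with
    wt := s.walk.wt + partialWeight s.walk.w i,
    coef := s.walk.coef * (1 - lam) ^ partialWeight s.walk.w i } }) hD
    (fun i _ => eval_qubitCount _ _ _ _ _ _ _) ?_ ?_ ?_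
  · intro i hi
    have hl := eval_letter (input lam ν U H ρ θ) (St.setN { s with walk := { s.walk with
      wt := s.walk.wt + partialWeight s.walk.w i,
      coef := s.walk.coef * (1 - lam) ^ partialWeight s.walk.w i } } .q i) NVar.q.get ⟨i, hi⟩
      (NVar.eval_get _ _ _)
    by_cases h : s.walk.w ⟨i, hi⟩ = .I
    · have hp : partialWeight s.walk.w (i + 1) = partialWeight s.walk.w i := by
        rw [partialWeight, Finset.sum_range_succ, dif_pos hi, if_pos h]
        rfl
      rw [hp]
      refine Exec.ite_pos ?_ (Exec.skip _ _)
      simp only [BExp.holds, hl, NExp.eval]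
      exact (Pauli.code_eq_zero_iff _).mpr h
    · have hp : partialWeight s.walk.w (i + 1) = partialWeight s.walk.w i + 1 := by
        rw [partialWeight, Finset.sum_range_succ, dif_pos hi, if_neg h]
        rfl
      refine Exec.ite_neg ?_ ((Exec.setN _ _ rfl).seq (Exec.setR _ _ ?_))
      · simp only [BExp.holds, hl, NExp.eval]
        exact fun h' => h ((Pauli.code_eq_zero_iff _).mp h')
      · simp only [RExp.eval, eval_keepRate, RVar.eval_get, NVar.eval_get, St.getR, St.setR,
          St.setN, St.getN, NExp.eval, hp, pow_succ]
        congr 2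
        ring
  · ext <;> simp [St.setN, hq, partialWeight]
  · ext <;> simp [St.setN, hq, partialWeight_self, Walk.step]

theorem exec_branch (hD : n + 1 ≤ D) (s : St n) (hq : s.q = 0) (i : Fin L) (hi : L - 1 - s.l = i)
    (j : Fin (U i).R) (hj : s.j = j) (ha : ((U i).rot j).Anti s.walk.w) (sgn : ℤ)
    (hs : ((U i).rot j).rotSign s.walk.w = sgn) :
    Exec D (branchProg sgn) (embed (input lam ν U H ρ θ) s) (embed (input lam ν U H ρ θ)
      { s with walk := s.walk.step s.N lam θ (.rot ⟨i, j⟩ ((U i).rot j)) }) := by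
  refine (Exec.setN (s' := { s with walk := { s.walk with rem := s.walk.rem + s.walk.rem } })
    _ _ ?_).seq ?_
  · simp only [NExp.eval, NVar.eval_get, St.getN, St.setN]
  by_cases h : s.walk.rem + s.walk.rem < s.N
  · refine Exec.ite_pos ?_ (Exec.setR _ _ ?_)
    · simpa only [BExp.holds, NVar.eval_get, St.getN] using h
    · simp only [RExp.eval, RVar.eval_get, NVar.eval_get, eval_layerIndex, St.getN, hi, hj,
        input_angle, St.setR, St.getR, Walk.step, if_pos ha, if_pos h]
  · refine Exec.ite_neg ?_ ((Exec.setN (s' := { s with walk := { s.walk with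
      rem := s.walk.rem + s.walk.rem - s.N } }) _ _ ?_).seq
      ((Exec.setR (s' := { s with walk := { s.walk with
        rem := s.walk.rem + s.walk.rem - s.N,
        coef := s.walk.coef * Real.sin (θ ⟨i, j⟩) * sgn } }) _ _ ?_).seq ?_))
    · simpa only [BExp.holds, NVar.eval_get, St.getN] using h
    · simp only [NExp.eval, NVar.eval_get, St.getN, St.setN]
    · simp only [RExp.eval, RVar.eval_get, NVar.eval_get, eval_layerIndex, St.getN, hi, hj,
        input_angle, St.setR, St.getR]
    · have := exec_fill lam ν U H ρ θ hD
        (pauliTab (fun a b => (a.mul b).code) rotLetter (letter NVar.q.get))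
        (((U i).rot j).mul s.walk.w) { s with walk := { s.walk with
          rem := s.walk.rem + s.walk.rem - s.N,
          coef := s.walk.coef * Real.sin (θ ⟨i, j⟩) * sgn } } hq ?_
      · simpa only [Walk.step, if_pos ha, if_neg h, hs] using this
      · intro q w hw
        refine eval_pauliTab _ _ _ _ ((U i).rot j q) (s.walk.w q)
          (eval_rotLetter lam ν U H ρ θ _ i (by exact hi) j (by exact hj) q rfl) ?_
        rw [← hw]
        exact eval_letter _ _ _ _ (NVar.eval_get _ _ _)

/-- The exponent of `i` in the product of the first letters of two words. -/
def partialPhase (v w : Word n) (i : ℕ) : ℕ :=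
  ∑ q ∈ Finset.range i, if h : q < n then (v ⟨q, h⟩).phase (w ⟨q, h⟩) else 0

theorem partialPhase_self (v w : Word n) : partialPhase v w n = v.phase w := by
  rw [partialPhase, Finset.sum_range, Word.phase]
  refine Finset.sum_congr rfl fun q _ => ?_
  simp

theorem Pauli.phase_lt (a b : Pauli) : a.phase b < 5 := by cases a <;> cases b <;> decide

theorem exec_rot (hD : n + 1 ≤ D) (s : St n) (hq : s.q = 0) (he : s.e = 0) (i : Fin L)
    (hi : L - 1 - s.l = i) (j : Fin (U i).R) (hj : s.j = j) :
    Exec D rotProg (embed (input lam ν U H ρ θ) s) (embed (input lam ν U H ρ θ)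
      { s with walk := s.walk.step s.N lam θ (.rot ⟨i, j⟩ ((U i).rot j)) }) := by
  set σ := (U i).rot j with hσ
  refine (Exec.forLoop (s' := { s with e := σ.phase s.walk.w % 4 }) .q _ _
    (fun r => { s with e := partialPhase σ s.walk.w r % 4 }) hD
    (fun i _ => eval_qubitCount _ _ _ _ _ _ _) ?_ ?_ ?_).seq ?_
  · intro r hr
    refine Exec.setN _ _ ?_
    have h1 := eval_pauliTab Pauli.phase rotLetter (letter NVar.q.get)
      (embed (input lam ν U H ρ θ) (St.setN { s with e := partialPhase σ s.walk.w r % 4 } .q r))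
      (σ ⟨r, hr⟩) (s.walk.w ⟨r, hr⟩)
      (eval_rotLetter lam ν U H ρ θ _ i (by exact hi) j (by exact hj) ⟨r, hr⟩ rfl)
      (eval_letter _ _ _ _ (NVar.eval_get _ _ _))
    have h2 := NVar.eval_get .e (input lam ν U H ρ θ)
      (St.setN { s with e := partialPhase σ s.walk.w r % 4 } .q r)
    rw [NExp.eval_tab, h1, h2]
    · simp only [St.setN, St.getN]
      congr 1
      rw [partialPhase, partialPhase, Finset.sum_range_succ, dif_pos hr]
      omega
    · rw [h2]
      simp only [St.setN, St.getN]
      omega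
    · rw [h1]
      exact Pauli.phase_lt _ _
  · ext <;> simp [St.setN, hq, partialPhase, he]
  · ext <;> simp [St.setN, hq, partialPhase_self]
  · refine Exec.seq (m' := embed (input lam ν U H ρ θ) { s with
      e := σ.phase s.walk.w % 4, walk := s.walk.step s.N lam θ (.rot ⟨i, j⟩ σ) }) ?_
      (Exec.setN _ _ ?_)
    · by_cases h1 : σ.phase s.walk.w % 4 = 1
      · refine Exec.ite_pos ?_ (exec_branch lam ν U H ρ θ hD
          { s with e := σ.phase s.walk.w % 4 } hq i hi j hj ?_ (-1) ?_)
        · simpa only [BExp.holds, NVar.eval_get, St.getN, NExp.eval] using h1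
        · change σ.phase s.walk.w % 2 = 1
          omega
        · simp [Word.rotSign, ← hσ, h1]
      · refine Exec.ite_neg ?_ ?_
        · simpa only [BExp.holds, NVar.eval_get, St.getN, NExp.eval] using h1
        by_cases h3 : σ.phase s.walk.w % 4 = 3
        · refine Exec.ite_pos ?_ (exec_branch lam ν U H ρ θ hD
            { s with e := σ.phase s.walk.w % 4 } hq i hi j hj ?_ 1 ?_)
          · simpa only [BExp.holds, NVar.eval_get, St.getN, NExp.eval] using h3
          · change σ.phase s.walk.w % 2 = 1
            omega
          · simp [Word.rotSign, ← hσ, h1]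
        · refine Exec.ite_neg ?_ ?_
          · simpa only [BExp.holds, NVar.eval_get, St.getN, NExp.eval] using h3
          · have ha : ¬ σ.Anti s.walk.w := by
              unfold Word.Anti
              omega
            simp only [Walk.step, if_neg ha]
            exact Exec.skip _ _
    · simp only [St.setN, NExp.eval, ← he]

theorem exec_neg (s : St n) (c : Prop) [Decidable c] (t : BExp)
    (ht : t.holds (embed (input lam ν U H ρ θ) s) ↔ c) :
    Exec D (.ite t negProg .skip) (embed (input lam ν U H ρ θ) s) (embed (input lam ν U H ρ θ)
      { s with walk := { s.walk with coef := s.walk.coef * if c then -1 else 1 } }) := by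
  by_cases hc : c
  · refine Exec.ite_pos (ht.mpr hc) (Exec.setR _ _ ?_)
    simp [RExp.eval, RVar.eval_get, St.getR, St.setR, hc]
  · refine Exec.ite_neg (fun h => hc (ht.mp h)) ?_
    simp only [if_neg hc, mul_one]
    exact Exec.skip _ _

theorem exec_cliff (s : St n) (he : s.e = 0) (i : Fin L) (hi : L - 1 - s.l = i)
    (j : Fin (U i).C) (hj : s.j = j) :
    Exec D cliffProg (embed (input lam ν U H ρ θ) s) (embed (input lam ν U H ρ θ)
      { s with walk := s.walk.step s.N lam θ (.cliff ((U i).cliff j)) }) := by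
  classical
  -- The description of the gate is also read in intermediate states, which differ from `s` only in
  -- other variables.
  have data : ∀ s' : St n, s'.l = s.l → s'.j = s.j → _ := fun s' hl hj' =>
    eval_cliffData lam ν U H ρ θ s' i (by rw [hl, hi]) j (by rw [hj', hj])
  generalize (U i).cliff j = V at data
  cases V with
  | H a =>
    have h0 := fun s' hl hj' => (data s' hl hj').1
    have h1 := fun s' hl hj' => (data s' hl hj').2.1
    simp only [Clifford.code] at h0 h1
    refine Exec.ite_pos (by simp only [BExp.holds, h0 s rfl rfl, NExp.eval])
      ((exec_neg lam ν U H ρ θ s (s.walk.w a = .Y) _ ?_).seq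
        (Exec.setLetter _ _ a (s.walk.w a).hadamard (h1 _ rfl rfl)
          (eval_pauliTab _ _ _ _ (s.walk.w a) (s.walk.w a) (eval_letter _ _ _ _ (h1 _ rfl rfl))
            (eval_letter _ _ _ _ (h1 _ rfl rfl))) ?_))
    · simp only [BExp.holds, eval_letter _ _ _ _ (h1 s rfl rfl), NExp.eval, Pauli.code_eq_two_iff]
    · simp only [Walk.step, Clifford.act, Clifford.sign, Clifford.Flips]
      congr
  | S a =>
    have h0 := fun s' hl hj' => (data s' hl hj').1
    have h1 := fun s' hl hj' => (data s' hl hj').2.1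
    simp only [Clifford.code] at h0 h1
    refine Exec.ite_neg (by simp [BExp.holds, h0 s rfl rfl, NExp.eval])
      (Exec.ite_pos (by simp only [BExp.holds, h0 s rfl rfl, NExp.eval])
      ((exec_neg lam ν U H ρ θ s (s.walk.w a = .X) _ ?_).seq
        (Exec.setLetter _ _ a (s.walk.w a).phaseGate (h1 _ rfl rfl)
          (eval_pauliTab _ _ _ _ (s.walk.w a) (s.walk.w a) (eval_letter _ _ _ _ (h1 _ rfl rfl))
            (eval_letter _ _ _ _ (h1 _ rfl rfl))) ?_)))
    · simp only [BExp.holds, eval_letter _ _ _ _ (h1 s rfl rfl), NExp.eval, Pauli.code_eq_one_iff]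
    · simp only [Walk.step, Clifford.act, Clifford.sign, Clifford.Flips]
      congr
  | CNOT a b hab =>
    have h0 := fun s' hl hj' => (data s' hl hj').1
    have h1 := fun s' hl hj' => (data s' hl hj').2.1
    have h2 := fun s' hl hj' => (data s' hl hj').2.2
    simp only [Clifford.code] at h0 h1 h2
    set s₁ : St n := { s with walk := { s.walk with coef := s.walk.coef *
      if (s.walk.w a = .X ∧ s.walk.w b = .Z) ∨ (s.walk.w a = .Y ∧ s.walk.w b = .Y)
        then -1 else 1 } } with hs₁
    set s₂ : St n := { s₁ with e := ((s.walk.w a).cnotControl (s.walk.w b)).code } with hs₂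
    set s₃ : St n := { s₂ with walk := { s₂.walk with
      w := Function.update s₂.walk.w b ((s.walk.w a).cnotTarget (s.walk.w b)) } } with hs₃
    refine Exec.ite_neg (by simp [BExp.holds, h0 s rfl rfl, NExp.eval])
      (Exec.ite_neg (by simp [BExp.holds, h0 s rfl rfl, NExp.eval])
      ((exec_neg lam ν U H ρ θ s ((s.walk.w a = .X ∧ s.walk.w b = .Z) ∨
          (s.walk.w a = .Y ∧ s.walk.w b = .Y)) _ ?_).seq
        ((Exec.setN (s' := s₂) _ _ ?_).seq
          ((Exec.setLetter (s := s₂) _ _ b ((s.walk.w a).cnotTarget (s.walk.w b)) (h2 _ rfl rfl)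
            (eval_pauliTab _ _ _ _ (s.walk.w a) (s.walk.w b) (eval_letter _ s₂ _ _ (h1 _ rfl rfl))
              (eval_letter _ s₂ _ _ (h2 _ rfl rfl))) hs₃.symm).seq
            ((Exec.setLetter (s := s₃) _ _ a ((s.walk.w a).cnotControl (s.walk.w b))
              (h1 s₃ rfl rfl) (NVar.eval_get _ _ _) rfl).seq (Exec.setN _ _ ?_))))))
    · rw [BExp.holds, eval_pauliTab _ _ _ _ (s.walk.w a) (s.walk.w b)
        (eval_letter _ s _ _ (h1 _ rfl rfl)) (eval_letter _ s _ _ (h2 _ rfl rfl)), NExp.eval]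
      split_ifs with h <;> simp [h]
    · rw [eval_pauliTab _ _ _ _ (s.walk.w a) (s.walk.w b)
        (eval_letter _ s₁ _ _ (h1 s₁ rfl rfl)) (eval_letter _ s₁ _ _ (h2 s₁ rfl rfl))]
      rfl
    · simp only [NExp.eval, St.setN, hs₁, hs₂, hs₃, Walk.step, Clifford.act, Clifford.sign,
        Clifford.Flips, ← he]
      congr

end Correct

end NoisyVQA
end

/-! ### Execution of layers, traces, whole walks and the main program. -/

noncomputable section
namespace NoisyVQA

variable {n L : ℕ} {P : Type}

theorem Walk.run_append (N : ℕ) (lam : ℝ) (θ : P → ℝ) (l l' : List (Step n P)) (y : Walk n) :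
    Walk.run N lam θ (l ++ l') y = Walk.run N lam θ l' (Walk.run N lam θ l y) := by
  simp [Walk.run]

theorem Walk.run_take_succ (N : ℕ) (lam : ℝ) (θ : P → ℝ) {R : ℕ} (f : Fin R → Step n P) {r : ℕ}
    (hr : r < R) (y : Walk n) :
    Walk.run N lam θ ((List.ofFn f).take (r + 1)) y =
      (Walk.run N lam θ ((List.ofFn f).take r) y).step N lam θ (f ⟨r, hr⟩) := by
  rw [List.take_succ_eq_append_getElem (by simpa using hr), Walk.run_append]
  simp [Walk.run]

/-- The walk through one layer and the noise after it. -/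
def Circuit.walkLayer (U : Circuit n L) (N : ℕ) (lam : ℝ) (θ : U.Param → ℝ) (i : Fin L)
    (y : Walk n) : Walk n :=
  Walk.run N lam θ (.noise :: (U i).gates fun j => ⟨i, j⟩) y

/-- The walk after the last `r` layers. -/
def Circuit.walkAt (U : Circuit n L) (N : ℕ) (lam : ℝ) (θ : U.Param → ℝ) (y : Walk n) : ℕ → Walk n
  | 0 => y
  | r + 1 => if h : r < L then
      U.walkLayer N lam θ ⟨L - 1 - r, by omega⟩ (U.walkAt N lam θ y r) else y

/-- After the last `r` layers there remain the steps of the first `L - r`; for `r = L` only the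
noise on the input state is left. -/
theorem Circuit.run_walkAt (U : Circuit n L) (N : ℕ) (lam : ℝ) (θ : U.Param → ℝ) (y : Walk n)
    (r m : ℕ) (hm : m ≤ L) (hr : m + r = L) :
    Walk.run N lam θ (U.steps m hm) (U.walkAt N lam θ y r) =
      Walk.run N lam θ (U.steps L le_rfl) y := by
  induction r generalizing m with
  | zero =>
    obtain rfl : m = L := hr
    rfl
  | succ r ih =>
    rw [← ih (m + 1) (by omega) (by omega), Circuit.walkAt, dif_pos (by omega), Circuit.walkLayer,
      Circuit.steps, ← List.cons_append, Walk.run_append]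
    congr 1
    have e : (⟨L - 1 - r, by omega⟩ : Fin L) = ⟨m, by omega⟩ := Fin.ext (by simp; omega)
    rw [e]

/-- The code of the product of the first letters of an entry of a Pauli word. -/
def partialEntry (w : Word n) (row col : Basis n) : ℕ → ℕ
  | 0 => 0
  | r + 1 => mulCode (partialEntry w row col r)
      (if h : r < n then entryCode (w ⟨r, h⟩) (row ⟨r, h⟩ + row ⟨r, h⟩ + col ⟨r, h⟩) else 0)

theorem mulCode_lt (a b : ℕ) : mulCode a b < 5 := by
  unfold mulCode
  split_ifs <;> omega

theorem entryCode_lt (p : Pauli) (x : ℕ) : entryCode p x < 5 := by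
  unfold entryCode
  split <;> omega

theorem partialEntry_lt (w : Word n) (row col : Basis n) (r : ℕ) :
    partialEntry w row col r < 5 := by
  cases r with
  | zero => exact Nat.succ_pos 4
  | succ r => exact mulCode_lt _ _

/-- The complex number with a given code. -/
def codeVal (a : ℕ) : ℂ := if a = 4 then 0 else Complex.I ^ a

theorem codeVal_mulCode (a b : ℕ) : codeVal (mulCode a b) = codeVal a * codeVal b := by
  unfold mulCode
  by_cases ha : a = 4
  · simp [ha, codeVal]
  by_cases hb : b = 4
  · simp [hb, codeVal]
  have h : (a + b) % 4 ≠ 4 := by omega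
  simp only [codeVal, ha, hb, or_self, if_false, h]
  rw [← pow_add]
  conv_rhs => rw [← Nat.mod_add_div (a + b) 4]
  simp only [pow_add, pow_mul, Complex.I_pow_four, one_pow, mul_one]

theorem codeVal_entryCode (p : Pauli) (r c : Fin 2) :
    codeVal (entryCode p (r + r + c)) = p.mat c r := by
  have h3 : Complex.I ^ 3 = -Complex.I := by rw [pow_succ, Complex.I_sq]; ring
  cases p <;> fin_cases r <;> fin_cases c <;> simp [codeVal, entryCode, Pauli.mat, h3]

theorem codeVal_partialEntry (w : Word n) (row col : Basis n) :
    codeVal (partialEntry w row col n) = w.op col row := by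
  have h : ∀ r ≤ n, codeVal (partialEntry w row col r) = ∏ q ∈ Finset.range r,
      if h : q < n then (w ⟨q, h⟩).mat (col ⟨q, h⟩) (row ⟨q, h⟩) else 1 := by
    intro r
    induction r with
    | zero => simp [partialEntry, codeVal]
    | succ r ih =>
      intro hr
      have hr' : r < n := hr
      rw [partialEntry, codeVal_mulCode, ih (by omega), Finset.prod_range_succ, dif_pos hr',
        dif_pos hr', codeVal_entryCode]
  rw [h n le_rfl, Finset.prod_range, Word.op, tensor, Matrix.of_apply]
  refine Finset.prod_congr rfl fun q _ => ?_
  simp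

/-- The contribution of a walk to the expectation value. -/
def Walk.value (M : ℕ) (g : Word n → ℝ) (y : Walk n) : ℝ :=
  if y.rem = 0 ∧ y.wt ≤ M then y.coef * g y.w else 0

section Correct

variable (lam ν : ℝ) (U : Circuit n L) (H : Hamiltonian n) (ρ : InputState n) (θ : U.Param → ℝ)
variable {D : ℕ}

theorem exec_layer (hn : n + 1 ≤ D) (i : Fin L) (hR : (U i).R + 1 ≤ D) (hC : (U i).C + 1 ≤ D)
    (s : St n) (hq : s.q = 0) (he : s.e = 0) (hj : s.j = 0) (hi : L - 1 - s.l = i) :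
    Exec D layerProg (embed (input lam ν U H ρ θ) s) (embed (input lam ν U H ρ θ)
      { s with walk := U.walkLayer s.N lam θ i s.walk }) := by
  set y₁ := s.walk.step s.N lam θ (.noise : Step n U.Param) with hy₁
  set rots := List.ofFn fun j => (Step.rot ⟨i, j⟩ ((U i).rot j) : Step n U.Param) with hrots
  set cliffs := List.ofFn fun k => (Step.cliff ((U i).cliff k) : Step n U.Param) with hcliffs
  have hy : U.walkLayer s.N lam θ i s.walk =
      Walk.run s.N lam θ cliffs (Walk.run s.N lam θ rots y₁) := by
    rw [← Walk.run_append]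
    rfl
  rw [hy]
  refine (exec_noise lam ν U H ρ θ hn s hq).seq ((Exec.forLoop (s' := { s with
    walk := Walk.run s.N lam θ rots y₁ }) .j _ _ (fun r => { s with
    walk := Walk.run s.N lam θ (rots.take r) y₁ }) hR ?_ ?_ ?_ ?_).seq
    (Exec.forLoop .j _ _ (fun r => { s with
    walk := Walk.run s.N lam θ (cliffs.take r) (Walk.run s.N lam θ rots y₁) }) hC ?_ ?_ ?_ ?_))
  · exact fun r _ => eval_rotCount lam ν U H ρ θ _ i hi
  · intro r hr
    have := exec_rot lam ν U H ρ θ hn (St.setN { s with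
      walk := Walk.run s.N lam θ (rots.take r) y₁ } .j r) hq he i hi ⟨r, hr⟩ rfl
    rw [hrots, Walk.run_take_succ _ _ _ _ hr]
    exact this
  · ext <;> simp [St.setN, hj, Walk.run, hy₁]
  · have : rots.take (U i).R = rots := List.take_of_length_le (by simp [hrots])
    rw [this]
    ext <;> simp [St.setN, hj]
  · exact fun r _ => eval_cliffCount lam ν U H ρ θ _ i hi
  · intro r hr
    have := exec_cliff (D := D) lam ν U H ρ θ (St.setN { s with
      walk := Walk.run s.N lam θ (cliffs.take r) (Walk.run s.N lam θ rots y₁) } .j r) he i hi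
      ⟨r, hr⟩ rfl
    rw [hcliffs, Walk.run_take_succ _ _ _ _ hr]
    exact this
  · ext <;> simp [St.setN, hj, Walk.run]
  · have : cliffs.take (U i).C = cliffs := List.take_of_length_le (by simp [hcliffs])
    rw [this]
    ext <;> simp [St.setN, hj]

theorem exec_entry (hn : n + 1 ≤ D) (s : St n) (hq : s.q = 0) (he : s.e = 0) (k : Fin ρ.K)
    (hk : s.j = k) :
    Exec D entryProg (embed (input lam ν U H ρ θ) s) (embed (input lam ν U H ρ θ)
      { s with tr := s.tr + (ρ.val k * s.walk.w.op (ρ.col k) (ρ.row k)).re }) := by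
  set a := partialEntry s.walk.w (ρ.row k) (ρ.col k) with ha
  have hre : ∀ s' : St n, s'.j = s.j →
      entryRe.eval (embed (input lam ν U H ρ θ) s') = (ρ.val k).re := by
    intro s' hs'
    simp only [entryRe, RExp.eval, NVar.eval_get, St.getN, hs', hk, NExp.eval]
    simp [embed, input, inputReal, pad]
  have him : ∀ s' : St n, s'.j = s.j →
      entryIm.eval (embed (input lam ν U H ρ θ) s') = (ρ.val k).im := by
    intro s' hs'
    simp only [entryIm, RExp.eval, NVar.eval_get, St.getN, hs', hk, NExp.eval]
    simp [embed, input, inputReal, pad]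
  refine (Exec.forLoop (s' := { s with e := a n }) .q _ _ (fun r => { s with e := a r }) hn
    (fun i _ => eval_qubitCount _ _ _ _ _ _ _) ?_ ?_ ?_).seq ?_
  · intro r hr
    set s' : St n := St.setN { s with e := a r } .q r with hs'
    have h1 : (letter NVar.q.get).eval (embed (input lam ν U H ρ θ) s') =
        (s.walk.w ⟨r, hr⟩).code := eval_letter _ s' _ ⟨r, hr⟩ (NVar.eval_get _ _ _)
    have h2 : rowBit.eval (embed (input lam ν U H ρ θ) s') = ρ.row k ⟨r, hr⟩ := by
      simp only [rowBit, NVar.eval_get, St.getN, hs', St.setN, hk, NExp.eval]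
      simp [embed, input, inputNat, pad, hr]
    have h3 : colBit.eval (embed (input lam ν U H ρ θ) s') = ρ.col k ⟨r, hr⟩ := by
      simp only [colBit, NVar.eval_get, St.getN, hs', St.setN, hk, NExp.eval]
      simp [embed, input, inputNat, pad, hr]
    have h4 : (NExp.tab (fun a x => entryCode (.ofCode a) x) (letter NVar.q.get)
        (.add (.add rowBit rowBit) colBit)).eval (embed (input lam ν U H ρ θ) s') =
        entryCode (s.walk.w ⟨r, hr⟩)
          (ρ.row k ⟨r, hr⟩ + ρ.row k ⟨r, hr⟩ + ρ.col k ⟨r, hr⟩) := by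
      rw [NExp.eval_tab]
      · simp only [NExp.eval, h1, h2, h3, Pauli.ofCode_code]
      · rw [h1]
        exact Pauli.code_lt _
      · simp only [NExp.eval, h2, h3]
        omega
    have h5 : NVar.e.get.eval (embed (input lam ν U H ρ θ) s') = a r := NVar.eval_get _ _ _
    refine Exec.setN _ _ ?_
    rw [NExp.eval_tab _ _ _ _ (by rw [h5]; exact partialEntry_lt _ _ _ _)
      (by rw [h4]; exact entryCode_lt _ _), h4, h5]
    simp only [hs', ha, partialEntry, dif_pos hr]
    rfl
  · ext <;> simp [St.setN, hq, he, ha, partialEntry]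
  · ext <;> simp [St.setN, hq]
  · have hval : s.walk.w.op (ρ.col k) (ρ.row k) = codeVal (a n) := (codeVal_partialEntry _ _ _).symm
    have hlt : a n < 5 := partialEntry_lt _ _ _ _
    rw [hval]
    generalize a n = e at hlt
    refine Exec.seq (m' := embed (input lam ν U H ρ θ) { s with
      e := e, tr := s.tr + (ρ.val k * codeVal e).re }) ?_ (Exec.setN _ _ ?_)
    · have hI : Complex.I ^ 3 = -Complex.I := by rw [pow_succ, Complex.I_sq]; ring
      have ht : ∀ c : ℕ, (BExp.eqN NVar.e.get (.lit c)).holds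
          (embed (input lam ν U H ρ θ) { s with e := e }) ↔ e = c := by
        intro c
        simp only [BExp.holds, NVar.eval_get, St.getN, NExp.eval]
      by_cases h0 : e = 0
      · refine Exec.ite_pos ((ht 0).mpr h0) (Exec.setR _ _ ?_)
        simp only [RExp.eval, RVar.eval_get, hre { s with e := e } rfl, St.getR, St.setR]
        simp [h0, codeVal]
      refine Exec.ite_neg (fun h => h0 ((ht 0).mp h)) ?_
      by_cases h1 : e = 1
      · refine Exec.ite_pos ((ht 1).mpr h1) (Exec.setR _ _ ?_)
        simp only [RExp.eval, RVar.eval_get, him { s with e := e } rfl, St.getR, St.setR]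
        simp [h1, codeVal, sub_eq_add_neg]
      refine Exec.ite_neg (fun h => h1 ((ht 1).mp h)) ?_
      by_cases h2 : e = 2
      · refine Exec.ite_pos ((ht 2).mpr h2) (Exec.setR _ _ ?_)
        simp only [RExp.eval, RVar.eval_get, hre { s with e := e } rfl, St.getR, St.setR]
        simp [h2, codeVal, sub_eq_add_neg]
      refine Exec.ite_neg (fun h => h2 ((ht 2).mp h)) ?_
      by_cases h3 : e = 3
      · refine Exec.ite_pos ((ht 3).mpr h3) (Exec.setR _ _ ?_)
        simp only [RExp.eval, RVar.eval_get, him { s with e := e } rfl, St.getR, St.setR]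
        simp [h3, codeVal, hI]
      refine Exec.ite_neg (fun h => h3 ((ht 3).mp h)) ?_
      have h4 : e = 4 := by omega
      simp only [h4, codeVal, if_true, mul_zero, Complex.zero_re, add_zero]
      exact Exec.skip _ _
    · simp only [St.setN, NExp.eval, ← he]

theorem InputState.expect_eq_sum (w : Word n) :
    ρ.expect w = ∑ k, (ρ.val k * w.op (ρ.col k) (ρ.row k)).re := by
  rw [InputState.expect, InputState.op, Finset.mul_sum, Matrix.trace_sum, Complex.re_sum]
  refine Finset.sum_congr rfl fun k _ => ?_
  rw [Matrix.trace_mul_single]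
  simp [mul_comm]

theorem exec_trace (hn : n + 1 ≤ D) (hK : ρ.K + 1 ≤ D) (s : St n) (hq : s.q = 0) (he : s.e = 0)
    (hj : s.j = 0) (ht : s.tr = 0) :
    Exec D (forLoop .j entryCount entryProg) (embed (input lam ν U H ρ θ) s)
      (embed (input lam ν U H ρ θ) { s with tr := ρ.expect s.walk.w }) := by
  refine Exec.forLoop .j _ _ (fun r => { s with tr := ∑ k ∈ Finset.range r,
    if h : k < ρ.K then (ρ.val ⟨k, h⟩ * s.walk.w.op (ρ.col ⟨k, h⟩) (ρ.row ⟨k, h⟩)).re else 0 }) hK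
    (fun i _ => eval_entryCount _ _ _ _ _ _ _) ?_ ?_ ?_
  · intro r hr
    rw [Finset.sum_range_succ, dif_pos hr]
    exact exec_entry lam ν U H ρ θ hn (St.setN { s with tr := ∑ k ∈ Finset.range r,
      if h : k < ρ.K then (ρ.val ⟨k, h⟩ * s.walk.w.op (ρ.col ⟨k, h⟩) (ρ.row ⟨k, h⟩)).re else 0 }
      .j r) hq he ⟨r, hr⟩ rfl
  · ext <;> simp [St.setN, hj, ht]
  · rw [InputState.expect_eq_sum, Finset.sum_range]
    ext <;> simp [St.setN, hj]

/-- Bounds on all loops of the program. -/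
structure LoopBound (D : ℕ) (U : Circuit n L) (H : Hamiltonian n) (ρ : InputState n) : Prop where
  qubits : n + 1 ≤ D
  layers : L + 1 ≤ D
  terms : H.K + 1 ≤ D
  entries : ρ.K + 1 ≤ D
  rotations : ∀ i, (U i).R + 1 ≤ D
  cliffords : ∀ i, (U i).C + 1 ≤ D

/-- The state of the program before and after each walk. -/
def restState (n N M : ℕ) (acc : ℝ) : St n :=
  { walk := ⟨fun _ => .I, 0, 0, 0⟩, k := 0, c := 0, l := 0, j := 0, q := 0, e := 0,
    N := N, M := M, x := 0, tr := 0, acc := acc }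

/-- The value of the walk for term `k` and the branch with number `c`. -/
def walkValue (N M : ℕ) (k : Fin H.K) (c : ℕ) : ℝ :=
  (Walk.run N lam θ (U.steps L le_rfl) ⟨H.word k, H.coeff k, c, 0⟩).value M ρ.expect

theorem exec_walk (hD : LoopBound D U H ρ) (N M : ℕ) (acc : ℝ) (k : Fin H.K) (c : ℕ) :
    Exec D walkProg
      (embed (input lam ν U H ρ θ) { restState n N M acc with k := k, c := c })
      (embed (input lam ν U H ρ θ) { restState n N M (acc + walkValue lam U H ρ θ N M k c) with
        k := k, c := c }) := by
  set s₀ : St n := { restState n N M acc with k := k, c := c } with hs₀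
  set y₀ : Walk n := ⟨H.word k, H.coeff k, c, 0⟩ with hy₀
  set y₁ := U.walkAt N lam θ y₀ L with hy₁
  set y₂ := y₁.step N lam θ (.noise : Step n U.Param) with hy₂
  have hrun : Walk.run N lam θ (U.steps L le_rfl) y₀ = y₂ := by
    rw [← U.run_walkAt N lam θ y₀ L 0 (Nat.zero_le _) (by omega)]
    rfl
  refine Exec.seq (m' := embed (input lam ν U H ρ θ) { s₀ with walk := y₀ }) ?_
    (Exec.seq (m' := embed (input lam ν U H ρ θ) { s₀ with walk := y₁ }) ?_
    ((exec_noise lam ν U H ρ θ hD.qubits { s₀ with walk := y₁ } rfl).seq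
    ((exec_trace lam ν U H ρ θ hD.qubits hD.entries { s₀ with walk := y₂ } rfl rfl rfl rfl).seq
    (Exec.seq (m' := embed (input lam ν U H ρ θ) { s₀ with
      walk := y₂, tr := ρ.expect y₂.w, acc := acc + walkValue lam U H ρ θ N M k c }) ?_ ?_))))
  · refine (exec_fill lam ν U H ρ θ hD.qubits _ (H.word k) s₀ rfl ?_).seq
      ((Exec.setN _ _ rfl).seq (Exec.setR _ _ ?_))
    · intro i w _
      simp only [NExp.eval, NVar.eval_get, St.getN, hs₀, restState]
      simp [embed, input, inputNat, pad]
    · rw [eval_termCoeff _ _ _ _ _ _ _ k rfl]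
      simp only [NVar.eval_get]
      rfl
  · refine Exec.forLoop .l _ _ (fun r => { s₀ with walk := U.walkAt N lam θ y₀ r }) hD.layers
      (fun i _ => eval_layerCount _ _ _ _ _ _ _) ?_ rfl rfl
    intro r hr
    have := exec_layer lam ν U H ρ θ hD.qubits ⟨L - 1 - r, by omega⟩ (hD.rotations _)
      (hD.cliffords _) (St.setN { s₀ with walk := U.walkAt N lam θ y₀ r } .l r) rfl rfl rfl rfl
    rw [Circuit.walkAt, dif_pos hr]
    exact this
  · have hb : (BExp.and (.eqN NVar.rem.get (.lit 0)) (.not (.ltN NVar.M.get NVar.wt.get))).holds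
        (embed (input lam ν U H ρ θ) { s₀ with walk := y₂, tr := ρ.expect y₂.w }) ↔
        (y₂.rem = 0 ∧ y₂.wt ≤ M) := by
      simp only [BExp.holds, NVar.eval_get, St.getN, NExp.eval, not_lt]
      rfl
    rw [walkValue, hrun, Walk.value]
    by_cases h : y₂.rem = 0 ∧ y₂.wt ≤ M
    · refine Exec.ite_pos (hb.mpr h) (Exec.setR _ _ ?_)
      simp only [RExp.eval, RVar.eval_get, St.getR, St.setR, if_pos h]
      rfl
    · refine Exec.ite_neg (fun h' => h (hb.mp h')) ?_
      simp only [if_neg h, add_zero]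
      exact Exec.skip _ _
  · refine (exec_fill lam ν U H ρ θ hD.qubits _ (fun _ => .I) _ rfl (fun _ _ _ => rfl)).seq
      ((Exec.setN _ _ rfl).seq ((Exec.setN _ _ rfl).seq ((Exec.setR _ _ rfl).seq
        (Exec.setR _ _ ?_))))
    simp only [NExp.eval, RExp.eval, Int.cast_zero]
    rfl

/-- The hypotheses say that `M` is the first exponent meeting the error bound, so the loop makes
exactly `M` rounds, doubling `N` in each of them. -/
theorem exec_cutoff (hK : H.K + 1 ≤ D) (M : ℕ) (hM : M + 1 ≤ D)
    (hle : (∑ k, H.coeff k ^ 2) * ((1 - lam) ^ M) ^ 2 ≤ ν)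
    (hlt : ∀ i < M, ν < (∑ k, H.coeff k ^ 2) * ((1 - lam) ^ i) ^ 2) :
    Exec D cutoffProg (embed (input lam ν U H ρ θ) (restState n 0 0 0))
      (embed (input lam ν U H ρ θ) (restState n (2 ^ M) M 0)) := by
  set S := ∑ k, H.coeff k ^ 2 with hS
  let a : ℕ → ℝ := fun r => ∑ k ∈ Finset.range r,
    if h : k < H.K then H.coeff ⟨k, h⟩ ^ 2 else 0
  refine Exec.seq (m' := embed (input lam ν U H ρ θ) { restState n 0 0 0 with x := S }) ?_
    ((Exec.setN (s' := { restState n 1 0 0 with x := S }) _ _ rfl).seq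
    (Exec.seq (m' := embed (input lam ν U H ρ θ)
      { restState n (2 ^ M) M 0 with x := S * ((1 - lam) ^ M) ^ 2 }) ?_ (Exec.setR _ _ ?_)))
  · refine Exec.forLoop .k _ _ (fun r => { restState n 0 0 0 with x := a r }) hK
      (fun i _ => eval_termCount _ _ _ _ _ _ _) ?_ ?_ ?_
    · intro r hr
      refine Exec.setR _ _ ?_
      have ha : a (r + 1) = a r + H.coeff ⟨r, hr⟩ ^ 2 := by
        simp only [a]
        rw [Finset.sum_range_succ, dif_pos hr]
      rw [ha]
      simp only [RExp.eval, RVar.eval_get, eval_termCoeff lam ν U H ρ θ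
        (St.setN { restState n 0 0 0 with x := a r } .k r) ⟨r, hr⟩ rfl, ← pow_two]
      rfl
    · simp [St.setN, restState, a]
    · have ha : a H.K = S := by
        simp only [a]
        rw [Finset.sum_range]
        simp [hS]
      simp [St.setN, restState, ha]
  · have e0 : ({ restState n 1 0 0 with x := S } : St n) =
        { restState n (2 ^ 0) 0 0 with x := S * ((1 - lam) ^ 0) ^ 2 } := by simp [restState]
    rw [e0]
    have hν : ∀ s : St n, (RExp.read 1 (.lit 1) (.lit 0) (.lit 0)).eval
        (embed (input lam ν U H ρ θ) s) = ν := by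
      intro s
      simp [RExp.eval, NExp.eval, embed, input, inputReal]
    refine Exec.while (fun i => embed (input lam ν U H ρ θ)
      { restState n (2 ^ i) i 0 with x := S * ((1 - lam) ^ i) ^ 2 }) hM ?_ ?_ ?_
    · intro i hi
      simp only [BExp.holds, hν, RVar.eval_get, St.getR, not_le]
      exact hlt i hi
    · intro i hi
      refine (Exec.setR _ _ rfl).seq ((Exec.setN _ _ rfl).seq (Exec.setN _ _ ?_))
      simp only [RExp.eval, eval_keepRate, RVar.eval_get, NVar.eval_get, NExp.eval, St.getR,
        St.setR, St.setN, St.getN, restState]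
      congr 1
      · ring
      · ring
    · simp only [BExp.holds, hν, RVar.eval_get, St.getR, not_not]
      exact hle
  · simp only [RExp.eval, Int.cast_zero]
    rfl

theorem exec_main (hD : LoopBound D U H ρ) (M : ℕ) (hM : M + 1 ≤ D) (hN : 2 ^ M + 1 ≤ D)
    (hle : (∑ k, H.coeff k ^ 2) * ((1 - lam) ^ M) ^ 2 ≤ ν)
    (hlt : ∀ i < M, ν < (∑ k, H.coeff k ^ 2) * ((1 - lam) ^ i) ^ 2) :
    Exec D mainProg (embed (input lam ν U H ρ θ) (restState n 0 0 0))
      (embed (input lam ν U H ρ θ) (restState n (2 ^ M) M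
        (∑ k, ∑ c ∈ Finset.range (2 ^ M), walkValue lam U H ρ θ (2 ^ M) M k c))) := by
  refine (exec_cutoff lam ν U H ρ θ hD.terms M hM hle hlt).seq ?_
  refine Exec.forLoop .k _ _ (fun r => restState n (2 ^ M) M (∑ k ∈ Finset.range r,
    if h : k < H.K then ∑ c ∈ Finset.range (2 ^ M), walkValue lam U H ρ θ (2 ^ M) M ⟨k, h⟩ c
      else 0)) hD.terms (fun i _ => eval_termCount _ _ _ _ _ _ _) ?_ ?_ ?_
  · intro r hr
    rw [Finset.sum_range_succ, dif_pos hr]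
    generalize (∑ k ∈ Finset.range r, if h : k < H.K then ∑ c ∈ Finset.range (2 ^ M),
      walkValue lam U H ρ θ (2 ^ M) M ⟨k, h⟩ c else 0) = a
    refine Exec.forLoop .c _ _ (fun c => { restState n (2 ^ M) M (a +
      ∑ c' ∈ Finset.range c, walkValue lam U H ρ θ (2 ^ M) M ⟨r, hr⟩ c') with k := r }) hN
      (fun i _ => NVar.eval_get _ _ _) ?_ ?_ ?_
    · intro c _
      rw [Finset.sum_range_succ, ← add_assoc]
      exact exec_walk lam ν U H ρ θ hD (2 ^ M) M _ ⟨r, hr⟩ c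
    · simp [St.setN, restState]
    · simp [St.setN, restState]
  · simp [St.setN, restState]
  · rw [Finset.sum_range]
    simp [St.setN, restState]

/-- Cells outside the input are initially zero, which is also the code of the identity letter, so
the initial memory already has the form of a program state. -/
theorem embed_restState :
    embed (input lam ν U H ρ θ) (restState n 0 0 0) = input lam ν U H ρ θ := by
  have hc : (restState n 0 0 0).natCell = fun _ => 0 := by
    funext a
    unfold St.natCell
    split <;> rfl
  have hr : (restState n 0 0 0).realCell = fun _ => 0 := by
    funext a
    unfold St.realCell
    split <;> rfl
  have hp : ∀ i, pad (fun q : Fin n => ((restState n 0 0 0).walk.w q).code) i = 0 := by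
    intro i
    simp [pad, restState, Pauli.code]
  have h1 : (embed (input lam ν U H ρ θ) (restState n 0 0 0)).nat =
      (input lam ν U H ρ θ).nat := by
    funext a i j k
    by_cases ha : a < 8
    · simp [embed, ha]
    · have : (input lam ν U H ρ θ).nat a i j k = 0 := by
        obtain ⟨b, rfl⟩ := Nat.exists_eq_add_of_le (not_lt.mp ha)
        rw [add_comm]
        rfl
      rw [this]
      simp [embed, ha, hc, hp]
  have h2 : (embed (input lam ν U H ρ θ) (restState n 0 0 0)).real =
      (input lam ν U H ρ θ).real := by
    funext a i j k
    by_cases ha : a = 0 ∨ 5 ≤ a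
    · have : (input lam ν U H ρ θ).real a i j k = 0 := by
        rcases ha with rfl | ha
        · rfl
        · obtain ⟨b, rfl⟩ := Nat.exists_eq_add_of_le ha
          rw [add_comm]
          rfl
      rw [this]
      simp [embed, ha, hr]
    · simp [embed, ha]
  change Mem.mk _ _ _ = Mem.mk _ _ _
  rw [Mem.mk.injEq]
  exact ⟨h1, h2, rfl⟩

end Correct

end NoisyVQA
end

/-! ### Counting branches, and polynomial bounds on the computation. -/

noncomputable section
namespace NoisyVQA

variable {n L : ℕ} {P : Type}

/-! ### The sum over all walks -/

/-- The largest number of branchings on the way of a word through a list of steps, up to the point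
where the weight exceeds `M`. -/
def branchings (M : ℕ) : List (Step n P) → Word n → ℕ → ℕ
  | [], _, _ => 0
  | .rot _ σ :: l, w, W =>
    if σ.Anti w then 1 + max (branchings M l w W) (branchings M l (σ.mul w) W)
    else branchings M l w W
  | .cliff V :: l, w, W => branchings M l (V.act w) W
  | .noise :: l, w, W => if W + w.weight ≤ M then branchings M l w (W + w.weight) else 0

theorem Walk.le_wt_run (N : ℕ) (lam : ℝ) (θ : P → ℝ) (l : List (Step n P)) (y : Walk n) :
    y.wt ≤ (Walk.run N lam θ l y).wt := by
  induction l generalizing y with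
  | nil => exact le_rfl
  | cons s l ih =>
    refine le_trans ?_ (ih (y.step N lam θ s))
    cases s with
    | rot p σ =>
      simp only [Walk.step]
      split_ifs <;> exact le_rfl
    | cliff V => exact le_rfl
    | noise => exact Nat.le_add_right _ _

theorem Walk.value_run_eq_zero (N M : ℕ) (lam : ℝ) (θ : P → ℝ) (g : Word n → ℝ)
    (l : List (Step n P)) (y : Walk n) (h : M < y.wt) : (Walk.run N lam θ l y).value M g = 0 := by
  have := Walk.le_wt_run N lam θ l y
  rw [Walk.value, if_neg (by omega)]

theorem propagate_cutoff_eq_zero (M : ℕ) (lam : ℝ) (θ : P → ℝ) (g : Word n → ℝ)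
    (l : List (Step n P)) (w : Word n) (W : ℕ) (h : M < W) :
    propagate (cutoff lam M) g θ l w W = 0 := by
  induction l generalizing w W with
  | nil => simp [propagate, cutoff, not_le.mpr h]
  | cons s l ih =>
    cases s with
    | rot p σ => simp [propagate, ih _ _ h]
    | cliff V => simp [propagate, ih _ _ h]
    | noise => exact ih _ _ (by omega)

/-- The `m` unread bits `r` are stored as leading bits, in the form `2 ^ (M - m) * r`. A branching
splits the range of `r` in halves according to the top bit. At the end only `r = 0` contributes, so
a branch with fewer than `m` decisions is counted once. Weights above `M` give zero on both sides.
The walk multiplies by the damping as it goes, whereas `propagate` applies it at the leaf; this is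
the factor `(1 - lam) ^ W`. -/
theorem sum_value_run (M : ℕ) (lam : ℝ) (θ : P → ℝ) (g : Word n → ℝ) (l : List (Step n P))
    (w : Word n) (W : ℕ) (a : ℝ) (m : ℕ) (hm : m ≤ M) (h : branchings M l w W ≤ m) :
    ∑ r ∈ Finset.range (2 ^ m), (Walk.run (2 ^ M) lam θ l
      ⟨w, a * (1 - lam) ^ W, 2 ^ (M - m) * r, W⟩).value M g =
      a * propagate (cutoff lam M) g θ l w W := by
  induction l generalizing w W a m with
  | nil =>
    rw [Finset.sum_eq_single 0]
    · simp only [Walk.run, List.foldl_nil, Walk.value, propagate, cutoff]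
      by_cases hW : W ≤ M <;> simp [hW, mul_assoc]
    · intro r _ hr
      simp [Walk.run, Walk.value, hr]
    · simp
  | cons s l ih =>
    cases s with
    | rot p σ =>
      by_cases ha : σ.Anti w
      · rw [branchings, if_pos ha] at h
        obtain ⟨m, rfl⟩ : ∃ m', m = m' + 1 := ⟨m - 1, by omega⟩
        have h1 : 2 ^ (M - (m + 1)) + 2 ^ (M - (m + 1)) = 2 ^ (M - m) := by
          rw [← two_mul, ← pow_succ']
          congr 1
          omega
        have h2 : 2 ^ (M - m) * 2 ^ m = 2 ^ M := by
          rw [← pow_add]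
          congr 1
          omega
        -- Top bit `0`: doubling stays below `2 ^ M`, and the walk takes the cosine branch.
        have e1 : ∀ r ∈ Finset.range (2 ^ m), (Walk.run (2 ^ M) lam θ (.rot p σ :: l)
            ⟨w, a * (1 - lam) ^ W, 2 ^ (M - (m + 1)) * r, W⟩).value M g =
            (Walk.run (2 ^ M) lam θ l
              ⟨w, (a * Real.cos (θ p)) * (1 - lam) ^ W, 2 ^ (M - m) * r, W⟩).value M g := by
          intro r hr
          have hr' : 2 ^ (M - (m + 1)) * r + 2 ^ (M - (m + 1)) * r = 2 ^ (M - m) * r := by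
            rw [← add_mul, h1]
          have hlt : 2 ^ (M - m) * r < 2 ^ M := by
            rw [← h2]
            exact Nat.mul_lt_mul_of_pos_left (Finset.mem_range.mp hr) (by positivity)
          have hs : (⟨w, a * (1 - lam) ^ W, 2 ^ (M - (m + 1)) * r, W⟩ : Walk n).step (2 ^ M) lam θ
              (.rot p σ) = ⟨w, (a * Real.cos (θ p)) * (1 - lam) ^ W, 2 ^ (M - m) * r, W⟩ := by
            simp only [Walk.step, if_pos ha, hr', if_pos hlt]
            congr 1
            ring
          rw [← hs]
          rfl
        -- Top bit `1`: doubling reaches `2 ^ M`, which is subtracted, and the walk takes the sine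
        -- branch.
        have e2 : ∀ r ∈ Finset.range (2 ^ m), (Walk.run (2 ^ M) lam θ (.rot p σ :: l)
            ⟨w, a * (1 - lam) ^ W, 2 ^ (M - (m + 1)) * (2 ^ m + r), W⟩).value M g =
            (Walk.run (2 ^ M) lam θ l ⟨σ.mul w, (a * (Real.sin (θ p) * σ.rotSign w)) *
              (1 - lam) ^ W, 2 ^ (M - m) * r, W⟩).value M g := by
          intro r hr
          have hr' : 2 ^ (M - (m + 1)) * (2 ^ m + r) + 2 ^ (M - (m + 1)) * (2 ^ m + r) =
              2 ^ M + 2 ^ (M - m) * r := by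
            rw [← add_mul, h1, mul_add, h2]
          have hs : (⟨w, a * (1 - lam) ^ W, 2 ^ (M - (m + 1)) * (2 ^ m + r), W⟩ : Walk n).step
              (2 ^ M) lam θ (.rot p σ) = ⟨σ.mul w, (a * (Real.sin (θ p) * σ.rotSign w)) *
              (1 - lam) ^ W, 2 ^ (M - m) * r, W⟩ := by
            simp only [Walk.step, if_pos ha, hr', if_neg (not_lt.mpr (Nat.le_add_right _ _)),
              Nat.add_sub_cancel_left]
            congr 1
            ring
          rw [← hs]
          rfl
        have h3 : 2 ^ (m + 1) = 2 ^ m + 2 ^ m := by rw [pow_succ, mul_two]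
        rw [h3, Finset.sum_range_add, Finset.sum_congr rfl e1, Finset.sum_congr rfl e2,
          ih _ _ _ m (by omega) (by omega), ih _ _ _ m (by omega) (by omega), propagate, if_pos ha]
        ring
      · rw [branchings, if_neg ha] at h
        rw [propagate, if_neg ha, ← ih w W a m hm h]
        refine Finset.sum_congr rfl fun r _ => ?_
        have hs : (⟨w, a * (1 - lam) ^ W, 2 ^ (M - m) * r, W⟩ : Walk n).step (2 ^ M) lam θ
            (.rot p σ) = ⟨w, a * (1 - lam) ^ W, 2 ^ (M - m) * r, W⟩ := by
          simp only [Walk.step, if_neg ha]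
        conv_rhs => rw [← hs]
        rfl
    | cliff V =>
      rw [propagate, ← mul_assoc, ← ih (V.act w) W (a * V.sign w) m hm h]
      refine Finset.sum_congr rfl fun r _ => ?_
      rw [mul_right_comm]
      rfl
    | noise =>
      rw [propagate]
      by_cases hW : W + w.weight ≤ M
      · rw [branchings, if_pos hW] at h
        rw [← ih w (W + w.weight) a m hm h]
        refine Finset.sum_congr rfl fun r _ => ?_
        rw [pow_add, ← mul_assoc]
        rfl
      · rw [propagate_cutoff_eq_zero _ _ _ _ _ _ _ (not_le.mp hW), mul_zero]
        refine Finset.sum_eq_zero fun r _ => ?_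
        exact Walk.value_run_eq_zero _ _ _ _ _ l
          ((⟨w, a * (1 - lam) ^ W, 2 ^ (M - m) * r, W⟩ : Walk n).step (2 ^ M) lam θ .noise)
          (not_le.mp hW)

/-- `T` contains the qubits of the rotations already passed. A rotation that anticommutes with `w`
overlaps its support, necessarily outside `T` by disjointness, so moving its support into `T` lowers
the count. Multiplication by `σ` changes letters only on that support, so both branches have the
same count afterwards. -/
theorem branchings_rots_append_le (M : ℕ) (rest : List (Step n P)) (W B : ℕ)
    (hB : ∀ w, branchings M rest w W ≤ B) (ps : List (P × Word n))
    (hps : ps.Pairwise fun a b => Disjoint a.2.supp b.2.supp) (T : Finset (Fin n))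
    (hT : ∀ a ∈ ps, Disjoint a.2.supp T) (w : Word n) :
    branchings M (ps.map (fun a => Step.rot a.1 a.2) ++ rest) w W ≤ (w.supp \ T).card + B := by
  induction ps generalizing T w with
  | nil => exact (hB w).trans (Nat.le_add_left _ _)
  | cons a ps ih =>
    obtain ⟨p, σ⟩ := a
    rw [List.pairwise_cons] at hps
    have ih' := ih hps.2 (T ∪ σ.supp) (fun b hb => by
      rw [Finset.disjoint_union_right]
      exact ⟨hT b (List.mem_cons_of_mem _ hb), (hps.1 b hb).symm⟩)
    have hle : (w.supp \ (T ∪ σ.supp)).card ≤ (w.supp \ T).card :=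
      Finset.card_le_card (Finset.sdiff_subset_sdiff subset_rfl Finset.subset_union_left)
    simp only [List.map_cons, List.cons_append, branchings]
    split_ifs with ha
    · have hq : ∃ q, q ∈ σ.supp ∧ q ∈ w.supp := by
        by_contra hc
        push Not at hc
        have : σ.phase w = 0 := by
          refine Finset.sum_eq_zero fun q _ => ?_
          by_cases hσ : σ q = .I
          · rw [hσ]
            rfl
          · have hw := hc q (by simp [Word.supp, hσ])
            have hw' : w q = .I := by simpa [Word.supp] using hw
            rw [hw']
            cases σ q <;> rfl
        rw [Word.Anti, this] at ha
        simp at ha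
      obtain ⟨q, hqσ, hqw⟩ := hq
      have hqT : q ∉ T := Finset.disjoint_left.mp (hT _ List.mem_cons_self) hqσ
      have hlt : (w.supp \ (T ∪ σ.supp)).card < (w.supp \ T).card := by
        refine Finset.card_lt_card ⟨Finset.sdiff_subset_sdiff subset_rfl
          Finset.subset_union_left, fun hsub => ?_⟩
        have := hsub (Finset.mem_sdiff.mpr ⟨hqw, hqT⟩)
        simp [hqσ] at this
      have hsupp : (σ.mul w).supp \ (T ∪ σ.supp) = w.supp \ (T ∪ σ.supp) := by
        ext q
        by_cases hσ : σ q = .I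
        · have : (σ.mul w) q = w q := by
            rw [Word.mul, hσ]
            rfl
          simp [Word.supp, this]
        · simp [Word.supp, hσ]
      have h1 := ih' w
      have h2 := ih' (σ.mul w)
      rw [hsupp] at h2
      omega
    · exact (ih' w).trans (by omega)

theorem branchings_gates_append_le (M : ℕ) (l : Layer n) (f : Fin l.R → P)
    (rest : List (Step n P)) (W B : ℕ) (hB : ∀ w, branchings M rest w W ≤ B) (w : Word n) :
    branchings M (l.gates f ++ rest) w W ≤ w.weight + B := by
  have hc : ∀ (Vs : List (Clifford n)) (w : Word n),
      branchings M (Vs.map Step.cliff ++ rest) w W ≤ B := by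
    intro Vs
    induction Vs with
    | nil => exact hB
    | cons V Vs ih => exact fun w => ih _
  have h1 : (List.ofFn fun j => Step.rot (f j) (l.rot j)) =
      (List.ofFn fun j => (f j, l.rot j)).map fun a => Step.rot a.1 a.2 := by
    rw [List.map_ofFn]
    rfl
  have h2 : (List.ofFn fun k => (Step.cliff (l.cliff k) : Step n P)) =
      (List.ofFn l.cliff).map Step.cliff := by
    rw [List.map_ofFn]
    rfl
  rw [Layer.gates, h1, h2, List.append_assoc]
  have := branchings_rots_append_le M _ W B (hc (List.ofFn l.cliff))
    (List.ofFn fun j => (f j, l.rot j)) (by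
      rw [List.pairwise_ofFn]
      exact fun j j' hj => l.rot_disjoint j j' hj.ne) ∅ (by simp) w
  rwa [Finset.sdiff_empty] at this

/-- In backward order noise precedes the gates of each layer, so the at most `|w|` branchings there
are paid for by the `|w|` just added to the weight. -/
theorem branchings_steps_le (M : ℕ) (U : Circuit n L) (m : ℕ) (h : m ≤ L) (w : Word n) (W : ℕ) :
    branchings M (U.steps m h) w W ≤ M - W := by
  induction m generalizing w W with
  | zero =>
    rw [Circuit.steps, branchings]
    split_ifs <;> simp [branchings]
  | succ m ih =>
    rw [Circuit.steps, branchings]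
    split_ifs with hW
    · refine (branchings_gates_append_le M _ _ _ _ (M - (W + w.weight)) (fun v => ih _ _ _) w).trans
        ?_
      omega
    · exact Nat.zero_le _

theorem sum_walkValue (lam : ℝ) (U : Circuit n L) (H : Hamiltonian n) (ρ : InputState n)
    (M : ℕ) (θ : U.Param → ℝ) :
    ((∑ k, ∑ c ∈ Finset.range (2 ^ M), walkValue lam U H ρ θ (2 ^ M) M k c : ℝ) : ℂ) =
      truncatedCost lam U H ρ M θ := by
  rw [truncatedCost_eq_sum]
  congr 1
  refine Finset.sum_congr rfl fun k _ => ?_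
  rw [← sum_value_run M lam θ ρ.expect (U.steps L le_rfl) (H.word k) 0 (H.coeff k) M le_rfl
    (branchings_steps_le M U L le_rfl _ 0)]
  refine Finset.sum_congr rfl fun c _ => ?_
  simp [walkValue]

/-! ### Bounds on the size of the computation -/

theorem norm_apply_self_le {m : Type*} [Fintype m] [DecidableEq m] (A : Matrix m m ℂ) (x : m) :
    ‖A x x‖ ≤ ‖Matrix.toEuclideanCLM (n := m) (𝕜 := ℂ) A‖ := by
  have h1 := (Matrix.toEuclideanCLM (n := m) (𝕜 := ℂ) A).le_opNorm (EuclideanSpace.single x 1)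
  rw [show ‖EuclideanSpace.single x (1 : ℂ)‖ = 1 from
    (PiLp.norm_single 2 (fun _ => ℂ) x 1).trans norm_one, mul_one] at h1
  have h2 := PiLp.norm_apply_le (Matrix.toEuclideanCLM (n := m) (𝕜 := ℂ) A
    (EuclideanSpace.single x 1)) x
  have h3 : (Matrix.toEuclideanCLM (n := m) (𝕜 := ℂ) A (EuclideanSpace.single x 1)) x = A x x := by
    simp
  rw [h3] at h2
  exact h2.trans h1

/-- The coefficient is the mean of the `2 ^ n` diagonal entries of the word times `H`. Each of them
is at most the norm of this product, and the word is unitary. -/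
theorem Hamiltonian.abs_coeff_le (H : Hamiltonian n) (k : Fin H.K) : |H.coeff k| ≤ H.norm := by
  have h1 : pauliCoeff (H.word k) H.op = H.coeff k := by
    rw [pauliCoeff_hamiltonian, Finset.sum_eq_single k]
    · simp
    · intro k' _ hk
      rw [if_neg fun h => hk (H.word_injective h)]
    · simp
  set T := Matrix.toEuclideanCLM (n := Basis n) (𝕜 := ℂ) with hT
  have hw : ‖T (H.word k).op‖ ≤ 1 := by
    have h2 : star (T (H.word k).op) * T (H.word k).op = 1 := by
      rw [← map_star, ← map_mul, Matrix.star_eq_conjTranspose, Word.conjTranspose_op,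
        Word.op_mul_self, map_one]
    have h3 := CStarRing.norm_star_mul_self (x := T (H.word k).op)
    rw [h2] at h3
    have h4 : ‖(1 : EuclideanSpace ℂ (Basis n) →L[ℂ] EuclideanSpace ℂ (Basis n))‖ ≤ 1 :=
      ContinuousLinearMap.norm_id_le
    nlinarith [norm_nonneg (T (H.word k).op)]
  have hb : ∀ x, ‖((H.word k).op * H.op) x x‖ ≤ H.norm := by
    intro x
    refine (norm_apply_self_le _ x).trans ?_
    rw [← hT, map_mul]
    refine (norm_mul_le _ _).trans ?_
    calc ‖T (H.word k).op‖ * ‖T H.op‖ ≤ 1 * ‖T H.op‖ :=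
          mul_le_mul_of_nonneg_right hw (norm_nonneg _)
      _ = H.norm := by rw [one_mul]; rfl
  have h5 : ‖((H.word k).op * H.op).trace‖ ≤ 2 ^ n * H.norm := by
    refine (norm_sum_le _ _).trans ?_
    refine (Finset.sum_le_sum fun x _ => hb x).trans ?_
    simp
  have h6 : |H.coeff k| = ‖((H.word k).op * H.op).trace‖ / 2 ^ n := by
    rw [← Real.norm_eq_abs, ← Complex.norm_real, ← h1, pauliCoeff, norm_div]
    simp
  rw [h6, div_le_iff₀ (by positivity)]
  linarith

theorem Hamiltonian.sum_coeff_sq_le (H : Hamiltonian n) :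
    ∑ k, H.coeff k ^ 2 ≤ H.K * H.norm ^ 2 := by
  have : ∀ k ∈ Finset.univ, H.coeff k ^ 2 ≤ H.norm ^ 2 := fun k _ => by
    rw [← sq_abs]
    exact pow_le_pow_left₀ (abs_nonneg _) (H.abs_coeff_le k) 2
  simpa using Finset.sum_le_sum this

theorem Layer.C_le (l : Layer n) : l.C ≤ n := by
  have hne : ∀ k, (l.cliff k).supp.Nonempty := by
    intro k
    cases l.cliff k <;> simp [Clifford.supp]
  choose q hq using hne
  have hinj : Function.Injective q := by
    intro k k' h
    by_contra hk
    exact Finset.disjoint_left.mp (l.cliff_disjoint k k' hk) (hq k) (h ▸ hq k')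
  simpa using Fintype.card_le_of_injective q hinj

theorem exists_cutoff {lam : ℝ} (h0 : 0 < lam) (h1 : lam ≤ 1) {S ν : ℝ} (hS : 0 ≤ S)
    (hν : 0 < ν) : ∃ M : ℕ, S * ((1 - lam) ^ M) ^ 2 ≤ ν ∧
      ∀ i < M, ν < S * ((1 - lam) ^ i) ^ 2 := by
  classical
  have hex : ∃ M : ℕ, S * ((1 - lam) ^ M) ^ 2 ≤ ν := by
    -- Dividing by `S + 1` instead of `S` includes the case `S = 0`.
    obtain ⟨M, hM⟩ := exists_pow_lt_of_lt_one (show 0 < ν / (S + 1) by positivity)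
      (show (1 - lam) ^ 2 < 1 by nlinarith)
    refine ⟨M, ?_⟩
    rw [lt_div_iff₀ (by positivity)] at hM
    rw [← pow_mul, mul_comm M 2, pow_mul]
    nlinarith [pow_nonneg (sq_nonneg (1 - lam)) M]
  exact ⟨Nat.find hex, Nat.find_spec hex, fun i hi => not_le.mp (Nat.find_min hex hi)⟩

/-- The error bound still fails at `M - 1`. Raising that inequality to the power `d` turns the
damping into at most `2 ^ (-(M - 1))`. The summand `1` covers `M = 0`. -/
theorem two_pow_le_of_cutoff {lam : ℝ} {d : ℕ} (hd : ((1 - lam) ^ 2) ^ d ≤ 1 / 2) {S ν : ℝ}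
    (hS : 0 ≤ S) (hν : 0 < ν) {M : ℕ} (hM : ∀ i < M, ν < S * ((1 - lam) ^ i) ^ 2) :
    (2 : ℝ) ^ M ≤ 1 + 2 * (S / ν) ^ d := by
  have hpos : 0 ≤ (S / ν) ^ d := by positivity
  cases M with
  | zero =>
    rw [pow_zero]
    linarith
  | succ k =>
    have h := hM k (Nat.lt_succ_self k)
    have h2 : ν ^ d ≤ S ^ d * (1 / 2) ^ k := by
      calc ν ^ d ≤ (S * ((1 - lam) ^ k) ^ 2) ^ d := pow_le_pow_left₀ hν.le h.le d
        _ = S ^ d * (((1 - lam) ^ 2) ^ d) ^ k := by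
          rw [mul_pow]
          congr 1
          rw [← pow_mul, ← pow_mul, ← pow_mul, ← pow_mul]
          congr 1
          ring
        _ ≤ S ^ d * (1 / 2) ^ k :=
          mul_le_mul_of_nonneg_left (pow_le_pow_left₀ (by positivity) hd k) (by positivity)
    have h3 : (2 : ℝ) ^ k ≤ (S / ν) ^ d := by
      rw [div_pow, le_div_iff₀ (by positivity)]
      calc (2 : ℝ) ^ k * ν ^ d ≤ 2 ^ k * (S ^ d * (1 / 2) ^ k) :=
            mul_le_mul_of_nonneg_left h2 (by positivity)
        _ = S ^ d * (2 * (1 / 2)) ^ k := by rw [mul_pow]; ring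
        _ = S ^ d := by norm_num
    rw [pow_succ]
    linarith

/-- The size bound `q` as a polynomial in the first of four variables. -/
def sizePolynomial (q : Polynomial ℕ) : MvPolynomial (Fin 4) ℝ :=
  q.eval₂ (Nat.castRingHom _) (MvPolynomial.X 0)

theorem eval_sizePolynomial (q : Polynomial ℕ) (n : ℕ) (a b c : ℝ) :
    MvPolynomial.eval ![(n : ℝ), a, b, c] (sizePolynomial q) = (q.eval n : ℕ) := by
  rw [sizePolynomial, Polynomial.hom_eval₂, MvPolynomial.eval_X]
  have : (MvPolynomial.eval ![(n : ℝ), a, b, c]).comp (Nat.castRingHom _) = Nat.castRingHom ℝ :=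
    Subsingleton.elim _ _
  rw [this]
  simp [Polynomial.eval₂_at_natCast]

/-- A polynomial bound on the running time. -/
def runtimePolynomial (q : Polynomial ℕ) (d : ℕ) : MvPolynomial (Fin 4) ℝ :=
  .C (mainProg.timeBound 1 : ℝ) * (.X 0 + .X 1 + sizePolynomial q + 2 +
    2 * (sizePolynomial q * .X 3 ^ 2 * .X 2 ^ 2) ^ d) ^ mainProg.depth

end NoisyVQA

end

/-! ### The main theorem. -/

open NoisyVQA

theorem corollary1 :
    ∃ prog : NoisyVQA.Prog,
      ∀ (lam : ℝ), 0 < lam → lam ≤ 1 → ∀ q : Polynomial ℕ,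
      ∃ p : MvPolynomial (Fin 4) ℝ,
      ∀ (n L : ℕ) (U : NoisyVQA.Circuit n L) (H : NoisyVQA.Hamiltonian n)
        (ρ : NoisyVQA.InputState n),
        NoisyVQA.SizeBound q U H ρ → U.Generates →
      ∀ ν : ℝ, 0 < ν →
      ∃ M : ℕ,
        (MeasureTheory.Integrable
          (fun θ => ‖NoisyVQA.truncatedCost lam U H ρ M θ - NoisyVQA.noisyCost lam U H ρ θ‖ ^ 2)
          (NoisyVQA.paramMeasure U) ∧
        ∫ θ, ‖NoisyVQA.truncatedCost lam U H ρ M θ - NoisyVQA.noisyCost lam U H ρ θ‖ ^ 2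
          ∂(NoisyVQA.paramMeasure U) ≤ ν) ∧
        ∀ θ : U.Param → ℝ, ∃ (m : NoisyVQA.Mem) (t : ℕ),
          NoisyVQA.Run prog (NoisyVQA.input lam ν U H ρ θ) m t ∧
          (m.output : ℂ) = NoisyVQA.truncatedCost lam U H ρ M θ ∧
          (t : ℝ) ≤ MvPolynomial.eval ![(n : ℝ), (L : ℝ), 1 / Real.sqrt ν, H.norm] p := by
  refine ⟨mainProg, fun lam h0 h1 q => ?_⟩
  -- The exponent `d` depends on the noise rate alone, so it may enter the degree of the polynomial.
  obtain ⟨d, hd⟩ := exists_pow_lt_of_lt_one (show (0 : ℝ) < 1 / 2 by norm_num)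
    (show (1 - lam) ^ 2 < 1 by nlinarith)
  refine ⟨runtimePolynomial q d, fun n L U H ρ hq hU ν hν => ?_⟩
  have hS : 0 ≤ ∑ k, H.coeff k ^ 2 := Finset.sum_nonneg fun k _ => sq_nonneg _
  obtain ⟨M, hM, hM'⟩ := exists_cutoff h0 h1 hS hν
  refine ⟨M, ⟨integrable_norm_truncatedCost_sub_noisyCost_sq lam U H ρ M, ?_⟩, fun θ => ?_⟩
  · refine (integral_norm_truncatedCost_sub_noisyCost_sq_le h0 h1 U H ρ hU M).trans ?_
    rwa [mul_comm]
  obtain ⟨hK, hρ, hR⟩ := hq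
  -- A strict bound on the number of rounds of every loop; the Clifford gates of a layer number at
  -- most `n`.
  set D := n + L + q.eval n + 2 ^ M + 1 with hD
  have hlt : M < 2 ^ M := Nat.lt_two_pow_self
  have hloop : LoopBound D U H ρ :=
    ⟨by omega, by omega, by omega, by omega, fun i => by have := hR i; omega,
      fun i => by have := (U i).C_le; omega⟩
  obtain ⟨t, ht, hrun⟩ := exec_main lam ν U H ρ θ hloop M (by omega) (by omega) hM hM'
  rw [embed_restState] at hrun
  refine ⟨_, t, hrun, sum_walkValue lam U H ρ M θ, ?_⟩
  have ht' := ht.trans (mainProg.timeBound_le (show 1 ≤ D by omega))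
  have hD' : (D : ℝ) ≤ n + L + (q.eval n : ℕ) + 2 +
      2 * ((q.eval n : ℕ) * H.norm ^ 2 * (1 / Real.sqrt ν) ^ 2) ^ d := by
    have h2 := two_pow_le_of_cutoff hd.le hS hν hM'
    have h3 : (∑ k, H.coeff k ^ 2) / ν ≤ (q.eval n : ℕ) * H.norm ^ 2 * (1 / Real.sqrt ν) ^ 2 := by
      rw [div_pow, one_pow, Real.sq_sqrt hν.le, mul_one_div]
      refine div_le_div_of_nonneg_right ?_ hν.le
      refine H.sum_coeff_sq_le.trans (mul_le_mul_of_nonneg_right ?_ (sq_nonneg _))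
      exact_mod_cast hK
    have h4 := pow_le_pow_left₀ (div_nonneg hS hν.le) h3 d
    rw [hD]
    push_cast
    linarith
  calc (t : ℝ) ≤ (mainProg.timeBound 1 : ℝ) * (D : ℝ) ^ mainProg.depth := by exact_mod_cast ht'
    _ ≤ (mainProg.timeBound 1 : ℝ) * ((n + L + (q.eval n : ℕ) + 2 +
        2 * ((q.eval n : ℕ) * H.norm ^ 2 * (1 / Real.sqrt ν) ^ 2) ^ d) ^ mainProg.depth) :=
      mul_le_mul_of_nonneg_left (pow_le_pow_left₀ (Nat.cast_nonneg _) hD' _) (Nat.cast_nonneg _)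
    _ = _ := by
      simp only [runtimePolynomial, map_mul, map_pow, map_add, MvPolynomial.eval_C,
        MvPolynomial.eval_X, eval_sizePolynomial, map_ofNat]
      simp
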